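/- **Setting.** Consider $u_t=u_{xx}+f(x,u,u_x)$ on $0<x<1$ with Neumann boundary conditions $u_x=0$ at $x=0,1$, where $f\in C^2([0,1]\times\mathbb R^2)$ is dissipative in the following sense: $u\,f(x,u,0)<0$ for all $x\in[0,1]$ and all sufficiently large $|u|$, and for every $M$ there is $C$ with $|f(x,u,p)|\le C(1+p^2)$ for all $x\in[0,1]$, $|u|\le M$, $p\in\mathbb R$. Let $\mathcal E$ be the set of equilibria, i.e. of solutions $v\in C^2([0,1])$ of $v_{xx}+f(x,v,v_x)=0$ with $v_x=0$ at $x=0,1$. All equilibria are assumed hyperbolic: $0$ is not an eigenvalue of the linearization $\varphi\mapsto\varphi_{xx}+f_p(x,v,v_x)\varphi_x+f_u(x,v,v_x)\varphi$ with Neumann boundary conditions. The Morse index $i(v)$ is the number of positive eigenvalues of this linearization. The zero number $z(\varphi)$ is the number of strict sign changes of $\varphi:[0,1]\to\mathbb R$; we write $z(\varphi)=j_\pm$ if $z(\varphi)=j$ and $\pm\varphi(0)>0$. Let $N=|\mathcal E|$. For $\iota=0,1$ let $h_\iota:\{1,\dots,N\}\to\mathcal E$ be the bijection with $h_\iota(1)<h_\iota(2)<\dots<h_\iota(N)$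 at $x=\iota$, let $v<_\iota w$ denote the order at $x=\iota$, and let $\sigma=h_0^{-1}\circ h_1$. Define Morse numbers by $i_{h_0(1)}=0$ and $i_{h_0(j+1)}=i_{h_0(j)}+(-1)^{j+1}\,\mathrm{sign}(\sigma^{-1}(j+1)-\sigma^{-1}(j))$. A *polar $h_\iota$-serpent* is the set of all $h_\iota(m)$ with $m$ in a maximal interval of $\{1,\dots,N\}$ which contains $1$ ($\mathbf N$-polar) or $N$ ($\mathbf S$-polar) and on which $i_{h_\iota(m)}\in\{0,1\}$. $\mathbf N$-polar and $\mathbf S$-polar serpents are called anti-polar to each other. A polar $h_\iota$-serpent is *terminated* by the first vertex outside the serpent, counted from its pole along $h_\iota$. Assume that $\sigma$ defines a *3-meander template* with center $\mathcal O\in\mathcal E$. This means, first, that $\sigma$ is a Sturm permutation: $N$ is odd; the curve which passes through the points $1,\dots,N$ of a horizontal axis in the order $\sigma^{-1}(1),\dots,\sigma^{-1}(N)$, by arches alternately above and below the axis, starting above, has no self-crossings; $\sigma(1)=1$ and $\sigma(N)=N$; and $i_v\ge0$ for all $v\in\mathcal E$. Put $\mathbf N=h_0(1)=h_1(1)$ and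 $\mathbf S=h_0(N)=h_1(N)$. Second, for $\iota=0,1$: 1. $i_{\mathcal O}=3$, and $i_v\le2$ for all $v\ne\mathcal O$; 2. each polar $h_\iota$-serpent shares at least one vertex with the anti-polar $h_{1-\iota}$-serpent; 3. $\mathcal O$ is strictly between $\mathbf N$ and $h_\iota(2)$, and strictly between $h_\iota(N-1)$ and $\mathbf S$, in the order $<_{1-\iota}$; 4. the two $h_\iota$-neighbors $h_\iota(h_\iota^{-1}(\mathcal O)\pm1)$ of $\mathcal O$ have Morse number $2$ and are the vertices which terminate the two polar $h_{1-\iota}$-serpents. Define ${\mathcal E'}^0_-=\{\mathbf N\}$ and ${\mathcal E'}^0_+=\{\mathbf S\}$. Let ${\mathcal E'}^1_-$ be the union of the $\mathbf N$-polar $h_0$-serpent and the $\mathbf S$-polar $h_1$-serpent, without $\mathbf N$ and $\mathbf S$. Let ${\mathcal E'}^1_+$ be the union of the $\mathbf S$-polar $h_0$-serpent and the $\mathbf N$-polar $h_1$-serpent, without $\mathbf N$ and $\mathbf S$. Let ${\mathcal E'}^j=\bigcup_{k\le j,\ \delta=\pm}{\mathcal E'}^k_\delta$, with ${\mathcal E'}^{-1}=\emptyset$.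 Let ${\mathcal E'}^2_\delta$ be the set of all $v\in\mathcal E\smallsetminus{\mathcal E'}^1$ with $v\ne\mathcal O$ and $\delta\mathcal O<\delta v$ at $x=1$. Finally let $\mathrm{clos}\,{\mathcal E'}^j_\delta={\mathcal E'}^j_\delta\cup{\mathcal E'}^{j-1}$ and $\mathrm{clos}\,{\mathcal E'}^j=\bigcup_{\delta=\pm}\mathrm{clos}\,{\mathcal E'}^j_\delta$. **Proposition.** In this setting the following holds for all $0\le j\le2$ and $\delta=\pm$. (i) If $v\in{\mathcal E'}^j$, then $i(v)\le j$. (ii) If $v\in\mathrm{clos}\,{\mathcal E'}^j$, then $z(v-\mathcal O)\le j$. (iii) If $v\in{\mathcal E'}^j_\pm$, then $z(v-\mathcal O)=j_\pm$. (iv) If $v_1\ne v_2$ are elements of $\mathrm{clos}\,{\mathcal E'}^j_\delta$, then $z(v_1-v_2)<j$. -/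

import Mathlib

namespace SturmMeander

/-! ### Functions on the unit interval, zero number -/

/-- The derivative of a function on `[0,1]` (one-sided at the end points). -/
noncomputable def dx (v : unitInterval → ℝ) : unitInterval → ℝ := fun x =>
  derivWithin (Set.IccExtend (zero_le_one (α := ℝ)) v) (Set.Icc 0 1) x

/-- `v ∈ C²([0,1])` with Neumann boundary conditions `v' = 0` at `x = 0, 1`. -/
def IsC2Neumann (v : unitInterval → ℝ) : Prop :=
  ContDiffOn ℝ 2 (Set.IccExtend (zero_le_one (α := ℝ)) v) (Set.Icc 0 1) ∧ dx v 0 = 0 ∧ dx v 1 = 0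

/-- `φ` has at least `m` strict sign changes: there are `x₀ < x₁ < ⋯ < x_m` in `[0,1]` at which
`φ` has alternating strict signs. -/
def HasSignChanges (φ : unitInterval → ℝ) (m : ℕ) : Prop :=
  ∃ x : Fin (m + 1) → unitInterval, StrictMono x ∧
    ∀ i : Fin m, φ (x i.castSucc) * φ (x i.succ) < 0

/-- The zero number `0 ≤ z(φ) ≤ ∞`: the number of strict sign changes of `φ`. -/
noncomputable def zeroNumber (φ : unitInterval → ℝ) : ℕ∞ :=
  ⨆ (m : ℕ) (_ : HasSignChanges φ m), (m : ℕ∞)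

/-- The signed zero number: `z(φ) = j_δ` means `z(φ) = j` and `δ φ(0) > 0`, for a sign `δ = ±1`. -/
def SignedZeroNumberEq (φ : unitInterval → ℝ) (j : ℕ) (δ : ℤˣ) : Prop :=
  zeroNumber φ = (j : ℕ∞) ∧ 0 < ((δ : ℤ) : ℝ) * φ 0

/-! ### The equation `u_t = u_xx + f(x,u,u_x)`, its equilibria and their Morse indices -/

/-- `f(x,u,p)` is of class `C²` on `[0,1] × ℝ × ℝ`. -/
def IsC2Nonlinearity (f : ℝ → ℝ → ℝ → ℝ) : Prop :=
  ContDiffOn ℝ 2 (fun q : ℝ × ℝ × ℝ => f q.1 q.2.1 q.2.2) (Set.Icc 0 1 ×ˢ Set.univ)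

/-- The standard dissipativeness condition: a sign condition `u f(x,u,0) < 0` for large `|u|`, and
at most quadratic growth of `f` in `p = u_x`, locally uniformly in `u`. -/
def IsDissipative (f : ℝ → ℝ → ℝ → ℝ) : Prop :=
  (∃ R : ℝ, ∀ x ∈ Set.Icc (0 : ℝ) 1, ∀ u : ℝ, R ≤ |u| → u * f x u 0 < 0) ∧
  (∀ M : ℝ, ∃ C : ℝ, ∀ x ∈ Set.Icc (0 : ℝ) 1, ∀ u : ℝ, |u| ≤ M →
    ∀ p : ℝ, |f x u p| ≤ C * (1 + p ^ 2))

/-- Equilibria: `0 = v_xx + f(x,v,v_x)` on `[0,1]` with Neumann boundary conditions. -/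
def IsEquilibrium (f : ℝ → ℝ → ℝ → ℝ) (v : unitInterval → ℝ) : Prop :=
  IsC2Neumann v ∧ ∀ x : unitInterval, dx (dx v) x + f x (v x) (dx v x) = 0

/-- The set `ℰ_f` of equilibria, as a type. -/
abbrev Equilibria (f : ℝ → ℝ → ℝ → ℝ) : Type := {v : unitInterval → ℝ // IsEquilibrium f v}

/-- `lam` is an eigenvalue of the linearization at `v`:
`φ_xx + f_p(x,v,v_x) φ_x + f_u(x,v,v_x) φ = lam φ` has a nontrivial Neumann solution `φ`.
(As a regular Sturm-Liouville problem it has only real and simple eigenvalues.) -/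
def IsEigenvalue (f : ℝ → ℝ → ℝ → ℝ) (v : unitInterval → ℝ) (lam : ℝ) : Prop :=
  ∃ φ : unitInterval → ℝ, φ ≠ 0 ∧ IsC2Neumann φ ∧ ∀ x : unitInterval,
    dx (dx φ) x + deriv (fun p => f x (v x) p) (dx v x) * dx φ x
      + deriv (fun u => f x u (dx v x)) (v x) * φ x = lam * φ x

/-- Hyperbolicity: zero is not an eigenvalue of the linearization at `v`. -/
def IsHyperbolic (f : ℝ → ℝ → ℝ → ℝ) (v : unitInterval → ℝ) : Prop := ¬ IsEigenvalue f v 0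

/-- The Morse index `i(v)`: the number of positive eigenvalues of the linearization at `v`. -/
noncomputable def morseIndex (f : ℝ → ℝ → ℝ → ℝ) (v : unitInterval → ℝ) : ℕ∞ :=
  {lam : ℝ | 0 < lam ∧ IsEigenvalue f v lam}.encard

/-- The boundary point `x = ι`, for `ι = 0, 1`. -/
def bdryPoint (ι : Fin 2) : unitInterval := if ι = 0 then 0 else 1

/-- `h 0`, `h 1` are the labeling bijections of the equilibria by their boundary values:
`h ι 0 < h ι 1 < ⋯ < h ι n` at `x = ι`. There are `N = n + 1` equilibria, and labels start at `0`
instead of `1`. -/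
def IsBoundaryLabeling (f : ℝ → ℝ → ℝ → ℝ) {n : ℕ} (h : Fin 2 → (Fin (n + 1) ≃ Equilibria f)) :
    Prop :=
  ∀ ι : Fin 2, StrictMono fun k : Fin (n + 1) => (h ι k).1 (bdryPoint ι)

/-! ### Sturm permutations (labels `0, …, n` in place of `1, …, N`, where `N = n + 1`) -/

/-- `σ⁻¹(k)`, for `k = 0, …, n`: the position on the horizontal axis of the `k`-th intersection
point along the meander. (The value is irrelevant for `k > n`.) -/
def axisPos {n : ℕ} (σ : Equiv.Perm (Fin (n + 1))) (k : ℕ) : ℤ :=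
  ((σ⁻¹ (Fin.ofNat (n + 1) k) : Fin (n + 1)) : ℕ)

/-- The Morse number of the `k`-th intersection point along the meander, by recursion. The sign is
`(-1)^k` because the label `k` is `j - 1`, for labels `j` starting at `1`. -/
def morseRec {n : ℕ} (σ : Equiv.Perm (Fin (n + 1))) : ℕ → ℤ
  | 0 => 0
  | k + 1 => morseRec σ k + (-1) ^ k * Int.sign (axisPos σ (k + 1) - axisPos σ k)

/-- `σ` is a meander permutation. The curve of `σ` runs through the points `0, …, n` of the axis in
the order `σ⁻¹(0), σ⁻¹(1), …, σ⁻¹(n)`, by an arch above the axis from the `k`-th to the `(k+1)`-st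
point for even `k`, and by an arch below the axis for odd `k`. Their number `n + 1` is odd, and two
arches on the same side of the axis do not cross. -/
def IsMeanderPerm {n : ℕ} (σ : Equiv.Perm (Fin (n + 1))) : Prop :=
  Odd (n + 1) ∧ ∀ k l : ℕ, k < n → l < n → k % 2 = l % 2 →
    ¬ (min (axisPos σ k) (axisPos σ (k + 1)) < min (axisPos σ l) (axisPos σ (l + 1)) ∧
       min (axisPos σ l) (axisPos σ (l + 1)) < max (axisPos σ k) (axisPos σ (k + 1)) ∧
       max (axisPos σ k) (axisPos σ (k + 1)) < max (axisPos σ l) (axisPos σ (l + 1)))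

/-- Sturm permutations, i.e. dissipative Morse meanders. -/
def IsSturmPerm {n : ℕ} (σ : Equiv.Perm (Fin (n + 1))) : Prop :=
  IsMeanderPerm σ ∧ (σ 0 = 0 ∧ σ (Fin.last n) = Fin.last n) ∧ ∀ k ≤ n, 0 ≤ morseRec σ k

/-! ### 3-meander templates, with vertex set `E` and labelings `h 0`, `h 1` -/

section Template

variable {E : Type*} {n : ℕ}

/-- The permutation `σ = h₀⁻¹ ∘ h₁`. -/
def sturmPerm (h : Fin 2 → (Fin (n + 1) ≃ E)) : Equiv.Perm (Fin (n + 1)) :=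
  (h 1).trans (h 0).symm

/-- The label `h_ι⁻¹(v)`; the order `v <_ι w` is `pos h ι v < pos h ι w`. -/
def pos (h : Fin 2 → (Fin (n + 1) ≃ E)) (ι : Fin 2) (v : E) : ℕ := ((h ι).symm v : Fin (n + 1))

/-- The Morse number `i_v`. -/
def morseNumber (h : Fin 2 → (Fin (n + 1) ≃ E)) (v : E) : ℤ :=
  morseRec (sturmPerm h) (pos h 0 v)

/-- The poles: **N** for the sign `-1` and **S** for the sign `+1`. They are the first and the last
vertex in either of the two orders. -/
def pole (h : Fin 2 → (Fin (n + 1) ≃ E)) (δ : ℤˣ) : E :=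
  if δ = -1 then h 0 0 else h 0 (Fin.last n)

/-- `CloserToPole h ι δ w v`: the vertex `w` is strictly between the pole of sign `δ` and `v` in the
order of `h ι`, or it is that pole; i.e. `w <_ι v` for `δ = -1` and `v <_ι w` for `δ = +1`. -/
def CloserToPole (h : Fin 2 → (Fin (n + 1) ≃ E)) (ι : Fin 2) (δ : ℤˣ) (w v : E) : Prop :=
  (δ : ℤ) * pos h ι v < (δ : ℤ) * pos h ι w

/-- The polar `h_ι`-serpent at the pole of sign `δ`: the maximal `h_ι`-interval which contains that
pole and on which all Morse numbers are `0` or `1`. -/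
def polarSerpent (h : Fin 2 → (Fin (n + 1) ≃ E)) (ι : Fin 2) (δ : ℤˣ) : Set E :=
  {v | ∀ w : E, w = v ∨ CloserToPole h ι δ w v → morseNumber h w = 0 ∨ morseNumber h w = 1}

/-- `w` terminates the polar `h_ι`-serpent at the pole of sign `δ`: it is the first vertex, counted
from that pole along `h_ι`, which does not belong to the serpent. -/
def TerminatesSerpent (h : Fin 2 → (Fin (n + 1) ≃ E)) (ι : Fin 2) (δ : ℤˣ) (w : E) : Prop :=
  w ∉ polarSerpent h ι δ ∧ ∀ w' : E, CloserToPole h ι δ w' w → w' ∈ polarSerpent h ι δ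

/-- `w` is one of the two `h_ι`-neighbors `w^ι_±` of `O`. -/
def IsNeighbor (h : Fin 2 → (Fin (n + 1) ≃ E)) (ι : Fin 2) (O w : E) : Prop :=
  pos h ι w + 1 = pos h ι O ∨ pos h ι w = pos h ι O + 1

/-- The meander with axis intersections `E` and labelings `h 0` (along the meander), `h 1` (along
the horizontal axis) is a 3-meander template with central vertex `O`. -/
structure IsThreeMeanderTemplate (h : Fin 2 → (Fin (n + 1) ≃ E)) (O : E) : Prop where
  /-- The meander is a Sturm meander. -/
  sturm : IsSturmPerm (sturmPerm h)
  /-- `O` is the single vertex with Morse number `3`, and no other Morse number exceeds `2`. -/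
  center : morseNumber h O = 3 ∧ ∀ v : E, v ≠ O → morseNumber h v ≤ 2
  /-- Polar serpents overlap with their anti-polar serpents of the other labeling. -/
  overlap : ∀ (ι : Fin 2) (δ : ℤˣ),
    (polarSerpent h ι δ ∩ polarSerpent h (1 - ι) (-δ)).Nonempty
  /-- In the order of `h_{1-ι}`, `O` is strictly between the pole and the `h_ι`-neighbor `v` of the
  pole, for either pole; the pole is minimal (**N**) or maximal (**S**) in that order. -/
  between : ∀ (ι : Fin 2) (v : E),
    (pos h ι v = 1 → pos h (1 - ι) (pole h (-1)) < pos h (1 - ι) O ∧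
      pos h (1 - ι) O < pos h (1 - ι) v) ∧
    (pos h ι v + 1 = n → pos h (1 - ι) v < pos h (1 - ι) O ∧
      pos h (1 - ι) O < pos h (1 - ι) (pole h 1))
  /-- The `h_ι`-neighbors of `O` are sources, and they are the vertices which terminate the two
  polar `h_{1-ι}`-serpents. -/
  neighbors : ∀ (ι : Fin 2) (w : E),
    (IsNeighbor h ι O w → morseNumber h w = 2) ∧
    (IsNeighbor h ι O w ↔ ∃ δ : ℤˣ, TerminatesSerpent h (1 - ι) δ w)

/-! ### The sets `ℰ'^j_δ` -/

/-- `ℰ'^1_δ`: all vertices other than the two poles on the polar `h₀`-serpent at the pole of sign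
`δ` and on the anti-polar `h₁`-serpent. In traditional notation, `v_-^0 v_-^1 … v_-^{2m}` enumerates
the **N**-polar `h₀`-serpent followed by the rest of the (overlapping) **S**-polar `h₁`-serpent, and
`v_+^{2n} … v_+^1 v_+^0` the **N**-polar `h₁`-serpent followed by the rest of the **S**-polar
`h₀`-serpent. -/
def meridianSet (h : Fin 2 → (Fin (n + 1) ≃ E)) (δ : ℤˣ) : Set E :=
  (polarSerpent h 0 δ ∪ polarSerpent h 1 (-δ)) \ {pole h (-1), pole h 1}

/-- The sets `ℰ'^j_δ`, `j = 0, 1, 2`. -/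
def primedSet (h : Fin 2 → (Fin (n + 1) ≃ E)) (O : E) (δ : ℤˣ) : ℕ → Set E
  | 0 => {pole h δ}
  | 1 => meridianSet h δ
  | 2 => {v | v ∉ ({pole h (-1), pole h 1} ∪ meridianSet h (-1) ∪ meridianSet h 1 : Set E) ∧
      v ≠ O ∧ (δ : ℤ) * pos h 1 O < (δ : ℤ) * pos h 1 v}
  | _ => ∅

/-- `ℰ'^j`, the union of all `ℰ'^k_δ` with `k ≤ j` and `δ = ±`. -/
def primedUnion (h : Fin 2 → (Fin (n + 1) ≃ E)) (O : E) (j : ℕ) : Set E :=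
  {v | ∃ k ≤ j, ∃ δ : ℤˣ, v ∈ primedSet h O δ k}

/-- `clos ℰ'^j_δ = ℰ'^j_δ ∪ ℰ'^{j-1}`, where `ℰ'^{-1}` is empty. -/
def closPrimedSet (h : Fin 2 → (Fin (n + 1) ≃ E)) (O : E) (δ : ℤˣ) (j : ℕ) : Set E :=
  primedSet h O δ j ∪ {v | ∃ i : ℕ, i + 1 = j ∧ v ∈ primedUnion h O i}

/-- `clos ℰ'^j`, the union of `clos ℰ'^j_δ` over `δ = ±`. -/
def closPrimedUnion (h : Fin 2 → (Fin (n + 1) ≃ E)) (O : E) (j : ℕ) : Set E :=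
  {v | ∃ δ : ℤˣ, v ∈ closPrimedSet h O δ j}

end Template

end SturmMeander

open SturmMeander

/-!
The proof follows the shooting curve. After truncation, the initial value problem
`u'' + f(x,u,u') = 0`, `u(0) = a`, `u'(0) = 0` has a global solution `U a` on `[0,1]`, and the
equilibria are the zeros of `a ↦ (U a)'(1)`. Fix an equilibrium `V`. The difference `U a - V`,
divided by `a - V(0)`, has a polar angle in the phase plane. Its value `Φ a` at `x = 1` is a
continuous function of `a`, extended to `a = V(0)` by the Prüfer angle of the linearization at `V`
(`IsTame.exists_angle_function`). If `U a` is another equilibrium `W`, then `Φ a = -π z(V - W)`, by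
Sturm's argument: the angle passes the vertical directions clockwise only. At `a = V(0)`, the angle
lies between `-ρ π` and `(1 - ρ) π`, where `ρ` bounds the number of positive eigenvalues
(`encard_eigenvalues_le`). Between two consecutive equilibria `Φ` does not meet the multiples of
`π`. The recursions for zero numbers and for `ρ` along the curve follow by parity; they are recorded
as `ShootingData`. Shooting from far below all equilibria gives `ρ = 0` at the first one, so that
`ρ` is the Morse number defined by the permutation. Shooting from `x = 1` interchanges the two orders
of the equilibria, with the same zero numbers and the same `ρ` (`pruferAngle_reflect`), so there
are two sets of recursions, `exists_shootingData`.

The remaining argument is combinatorial, about a pair of labels `p` (along the curve) and `q` (along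
the axis) which obey both recursions.

* A polar serpent is monotone in both orders, its vertices have mutual zero number `0`, and zero
  number at most `1` with any other vertex. Overlapping anti-polar serpents thus form a chain
  (`TemplateData.zero_chain`), which contains the vertices of one meridian and both poles. The
  position of the neighbors of the poles gives the zero number `1` with the center on serpents.
* The terminators of the serpents are the neighbors of the center. By planarity, the curve between
  the first terminator and the center can therefore cross the vertical line through the center only
  along serpents, so that vertices outside serpents have zero number `2` with the center
  (`TemplateData.zero_center_of_lt`), and precede it in both orders or in neither.
* Vertices on the curve before the center have mutual zero numbers at most `1`
  (`TemplateData.zero_le_one_of_lt`), because a first pair with zero number `2` would contradict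
  planarity, as Morse numbers are at most `2` there.

The claims at the second pole follow by reversal of the curve, `TemplateData.reverse`.
-/

namespace SturmMeander

/-! ### Zero numbers along a meander -/

/-- The relations between the zero numbers `Z v w = z(v - w)` and the Morse numbers `r v` of
equilibria which arise by following the shooting curve. The labels `p` enumerate the equilibria
along the curve, the labels `q` along the axis; the arch which leaves `w` lies above the axis if
`p w` is even. Zero numbers `Z v w` change along an arch only if the arch passes above or below `v`:
they increase if the arch turns clockwise around `v`, and decrease otherwise. -/
structure ShootingData {E : Type*} (p q : E → ℤ) (n : ℤ) (Z : E → E → ℕ) (r : E → ℤ) : Prop where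
  nonneg : ∀ v, 0 ≤ p v
  le : ∀ v, p v ≤ n
  surj : ∀ k, 0 ≤ k → k ≤ n → ∃ v, p v = k
  inj : Function.Injective p
  inj' : Function.Injective q
  symm : ∀ v w, Z v w = Z w v
  parity : ∀ v w, p v < p w → (Even (Z v w) ↔ q v < q w)
  step_same : ∀ v w w', p w' = p w + 1 → w ≠ v → w' ≠ v → (q w < q v ↔ q w' < q v) →
    Z v w' = Z v w
  step_up : ∀ v w w', p w' = p w + 1 → (q w < q v ∧ q v < q w' ∨ q w' < q v ∧ q v < q w) →
    (Even (p w) ↔ q w < q w') → Z v w' = Z v w + 1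
  step_down : ∀ v w w', p w' = p w + 1 → (q w < q v ∧ q v < q w' ∨ q w' < q v ∧ q v < q w) →
    ¬ (Even (p w) ↔ q w < q w') → Z v w = Z v w' + 1
  morse_up : ∀ w w', p w' = p w + 1 → (Even (p w) ↔ q w < q w') → r w' = r w + 1 ∧ Z w w' = r w
  morse_down : ∀ w w', p w' = p w + 1 → ¬ (Even (p w) ↔ q w < q w') →
    r w' = r w - 1 ∧ Z w w' = r w'

/-- The initial interval of the order `p` on which all Morse numbers are `0` or `1`. -/
def serpent {E : Type*} (p : E → ℤ) (r : E → ℤ) : Set E :=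
  {v | ∀ w, w = v ∨ p w < p v → r w = 0 ∨ r w = 1}

/-- `w` is the first vertex in the order `p` which is not on the serpent. -/
def IsTerminator {E : Type*} (p : E → ℤ) (r : E → ℤ) (w : E) : Prop :=
  w ∉ serpent p r ∧ ∀ w', p w' < p w → w' ∈ serpent p r

section Serpent

variable {E : Type*} {p q : E → ℤ} {n : ℤ} {Z : E → E → ℕ} {r : E → ℤ}

theorem serpent_of_le {v w : E} (hp : Function.Injective p) (hv : v ∈ serpent p r)
    (h : p w ≤ p v) : w ∈ serpent p r := by
  intro u hu
  refine hv u ?_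
  rcases hu with rfl | hu
  · rcases h.lt_or_eq with h | h
    · exact Or.inr h
    · exact Or.inl (hp h)
  · exact Or.inr (hu.trans_le h)

theorem serpent_lt {v w : E} (hp : Function.Injective p) (hv : v ∈ serpent p r)
    (hw : w ∉ serpent p r) : p v < p w := by
  by_contra h
  exact hw (serpent_of_le hp hv (not_lt.mp h))

theorem morse_of_mem_serpent {v : E} (hv : v ∈ serpent p r) : r v = 0 ∨ r v = 1 :=
  hv v (Or.inl rfl)

namespace ShootingData

theorem induction (S : ShootingData p q n Z r) {P : E → Prop} (h0 : ∀ v, p v = 0 → P v)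
    (h1 : ∀ w w', p w' = p w + 1 → P w → P w') (v : E) : P v := by
  have key : ∀ (k : ℕ) (v : E), p v = k → P v := by
    intro k
    induction k with
    | zero => exact fun v hv => h0 v (by simpa using hv)
    | succ k ih =>
      intro v hv
      have := S.le v
      obtain ⟨w, hw⟩ := S.surj k (by lia) (by lia)
      exact h1 w v (by push_cast at hv; lia) (ih w hw)
  exact key (p v).toNat v (by have := S.nonneg v; lia)

theorem exists_succ (S : ShootingData p q n Z r) {v w : E} (h : p v < p w) :
    ∃ v', p v' = p v + 1 :=
  S.surj _ (by have := S.nonneg v; lia) (by have := S.le w; lia)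

theorem exists_pred (S : ShootingData p q n Z r) {v w : E} (h : p v < p w) :
    ∃ w', p w = p w' + 1 := by
  obtain ⟨w', h'⟩ := S.surj (p w - 1) (by have := S.nonneg v; lia) (by have := S.le w; lia)
  exact ⟨w', by lia⟩

theorem q_ne (S : ShootingData p q n Z r) {v w : E} (h : p v < p w) : q v ≠ q w := by
  intro h'
  rw [S.inj' h'] at h
  exact lt_irrefl _ h

/-- Following the curve reduces to the arches over `v`. -/
theorem step_cases (S : ShootingData p q n Z r) {v w w' : E} (h : p w' = p w + 1) (hw : w ≠ v)
    (hw' : w' ≠ v) : ((q w < q v ↔ q w' < q v) ∧ Z v w' = Z v w) ∨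
      ((q w < q v ∧ q v < q w' ∨ q w' < q v ∧ q v < q w) ∧
        (Z v w' = Z v w + 1 ∧ (Even (p w) ↔ q w < q w') ∨
          Z v w = Z v w' + 1 ∧ ¬ (Even (p w) ↔ q w < q w'))) := by
  by_cases hs : q w < q v ↔ q w' < q v
  · exact Or.inl ⟨hs, S.step_same v w w' h hw hw' hs⟩
  · right
    have h1 : q w ≠ q v := fun e => hw (S.inj' e)
    have h2 : q w' ≠ q v := fun e => hw' (S.inj' e)
    have hs' : q w < q v ∧ q v < q w' ∨ q w' < q v ∧ q v < q w := by
      rcases lt_or_gt_of_ne h1 with h1 | h1 <;> rcases lt_or_gt_of_ne h2 with h2 | h2 <;>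
        lia
    refine ⟨hs', ?_⟩
    by_cases he : Even (p w) ↔ q w < q w'
    · exact Or.inl ⟨S.step_up v w w' h hs' he, he⟩
    · exact Or.inr ⟨S.step_down v w w' h hs' he, he⟩

/-- Neighbors on the curve have Morse numbers of opposite parity. -/
theorem parity_morse (S : ShootingData p q n Z r) (h0 : ∀ v, p v = 0 → r v = 0) (v : E) :
    Even (r v) ↔ Even (p v) := by
  refine S.induction (P := fun v => Even (r v) ↔ Even (p v)) ?_ ?_ v
  · intro v hv
    rw [hv, h0 v hv]
  · intro w w' h ih
    by_cases he : Even (p w) ↔ q w < q w'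
    · rw [(S.morse_up w w' h he).1, h, Int.even_add_one, Int.even_add_one, ih]
    · rw [(S.morse_down w w' h he).1, h, Int.even_sub_one, Int.even_add_one, ih]

theorem serpent_step (S : ShootingData p q n Z r) {w w' : E} (h : p w' = p w + 1)
    (hw' : w' ∈ serpent p r) : q w < q w' ∧ Z w w' = 0 := by
  have h1 := morse_of_mem_serpent hw'
  have h2 := hw' w (Or.inr (by lia))
  have hz : Z w w' = 0 := by
    by_cases he : Even (p w) ↔ q w < q w'
    · have := S.morse_up w w' h he
      lia
    · have := S.morse_down w w' h he
      lia
  exact ⟨(S.parity w w' (by lia)).1 (by simp [hz]), hz⟩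

/-- Consecutive vertices of a serpent have zero number `0`. Therefore the serpent is ordered
alike by `p` and by `q`. -/
theorem serpent_pair (S : ShootingData p q n Z r) {v w : E} (hw : w ∈ serpent p r)
    (h : p v < p w) : q v < q w ∧ Z v w = 0 := by
  revert hw h
  refine S.induction (P := fun w => w ∈ serpent p r → p v < p w → q v < q w ∧ Z v w = 0) ?_ ?_ w
  · intro w hw _ h
    have := S.nonneg v
    lia
  · intro w w' hww ih hw' h
    have hs := S.serpent_step hww hw'
    rcases (show p v ≤ p w by lia).lt_or_eq with h1 | h1
    · have h2 := ih (serpent_of_le S.inj hw' (by lia)) h1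
      refine ⟨by lia, ?_⟩
      rw [S.step_same v w w' hww (by rintro rfl; lia) (by rintro rfl; lia) (by lia), h2.2]
    · rw [S.inj h1]
      exact hs

theorem serpent_mono (S : ShootingData p q n Z r) {v w : E} (hv : v ∈ serpent p r)
    (hw : w ∈ serpent p r) : p v < p w ↔ q v < q w := by
  refine ⟨fun h => (S.serpent_pair hw h).1, fun h => ?_⟩
  by_contra h'
  rcases (not_lt.mp h').lt_or_eq with h' | h'
  · exact absurd (S.serpent_pair hv h').1 (by lia)
  · rw [S.inj h'] at h
    exact lt_irrefl _ h

theorem serpent_zero (S : ShootingData p q n Z r) {v w : E} (hv : v ∈ serpent p r)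
    (hw : w ∈ serpent p r) (h : v ≠ w) : Z v w = 0 := by
  rcases lt_or_gt_of_ne (fun e => h (S.inj e)) with h | h
  · exact (S.serpent_pair hw h).2
  · rw [S.symm]
    exact (S.serpent_pair hv h).2

/-- The pole has zero number `0` with all other vertices. -/
theorem pole_zero (S : ShootingData p q n Z r) (h0 : ∀ v, p v = 0 → r v = 0 ∧ q v = 0)
    (hq : ∀ v, 0 ≤ q v) {v w : E} (hv : p v = 0) (h : w ≠ v) : Z v w = 0 := by
  have hqw : ∀ w, w ≠ v → q v < q w := fun w hw => by
    have h1 : q w ≠ q v := fun e => hw (S.inj' e)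
    have := hq w
    have := (h0 v hv).2
    lia
  revert h
  refine S.induction (P := fun w => w ≠ v → Z v w = 0) ?_ ?_ w
  · intro w hw h
    exact absurd (S.inj (hw.trans hv.symm)) h
  · intro w w' hww ih hw'
    by_cases hw : w = v
    · subst hw
      have := S.morse_up w w' hww (by simp [hv, hqw w' hw'])
      have := h0 w hv
      lia
    · rw [S.step_same v w w' hww hw hw' (by have := hqw w hw; have := hqw w' hw'; lia), ih hw]

/-- The `q`-monotone serpent passes over any vertex at most once. -/
theorem serpent_le_one (S : ShootingData p q n Z r) (h0 : ∀ v, p v = 0 → r v = 0 ∧ q v = 0)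
    (hq : ∀ v, 0 ≤ q v) {g w : E} (hw : w ∈ serpent p r) (h : g ≠ w) :
    Z g w ≤ 1 := by
  by_cases hg : g ∈ serpent p r
  · rw [S.serpent_zero hg hw h]
    exact Nat.zero_le _
  suffices (q w < q g → Z g w = 0) ∧ Z g w ≤ 1 from this.2
  revert hw h
  refine S.induction (P := fun w => w ∈ serpent p r → g ≠ w →
    (q w < q g → Z g w = 0) ∧ Z g w ≤ 1) ?_ ?_ w
  · intro w hw _ h
    have := S.pole_zero h0 hq hw h
    rw [S.symm] at this
    simp [this]
  · intro w w' hww ih hw' h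
    have hw := serpent_of_le (w := w) S.inj hw' (by lia)
    have hwg : g ≠ w := by
      rintro rfl
      exact hg hw
    have hm := (S.serpent_step hww hw').1
    have ih := ih hw hwg
    rcases S.step_cases hww hwg.symm h.symm with ⟨h1, h2⟩ | ⟨h1, h2⟩
    · rw [h2]
      exact ⟨fun h => ih.1 (h1.2 h), ih.2⟩
    · have := ih.1 (by lia)
      exact ⟨by lia, by lia⟩

theorem exists_terminator (S : ShootingData p q n Z r) {O : E} (hO : O ∉ serpent p r) :
    ∃ t, IsTerminator p r t ∧ p t ≤ p O := by
  by_contra hcon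
  push Not at hcon
  refine hO (S.induction (P := fun v => p v ≤ p O → v ∈ serpent p r) ?_ ?_ O le_rfl)
  · intro v hv h
    by_contra hn
    exact absurd h (not_le.mpr (hcon v ⟨hn, fun w hw => by have := S.nonneg w; lia⟩))
  · intro w w' hww ih h
    by_contra hn
    refine absurd h (not_le.mpr (hcon w' ⟨hn, fun u hu => ?_⟩))
    exact serpent_of_le S.inj (ih (by lia)) (by lia)

/-- Reversing both orders exchanges the poles. -/
theorem reverse (S : ShootingData p q n Z r) (hn : Even n) :
    ShootingData (fun v => n - p v) (fun v => n - q v) n Z r where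
  nonneg v := by have := S.le v; lia
  le v := by have := S.nonneg v; lia
  surj k h0 h1 := by
    obtain ⟨v, hv⟩ := S.surj (n - k) (by lia) (by lia)
    exact ⟨v, by lia⟩
  inj v w h := S.inj (by simpa using h)
  inj' v w h := S.inj' (by simpa using h)
  symm := S.symm
  parity v w h := by
    rw [S.symm, S.parity w v (by lia)]
    lia
  step_same v w w' h hw hw' hs := by
    refine (S.step_same v w' w (by lia) hw' hw ?_).symm
    have h1 : q w ≠ q v := fun e => hw (S.inj' e)
    have h2 : q w' ≠ q v := fun e => hw' (S.inj' e)
    lia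
  step_up v w w' h hs he := by
    refine S.step_down v w' w (by lia) (by lia) ?_
    rw [show p w' = p w - 1 by lia, Int.even_sub_one]
    rw [Int.even_sub] at he
    simp only [hn, true_iff] at he
    rw [he]
    lia
  step_down v w w' h hs he := by
    refine S.step_up v w' w (by lia) (by lia) ?_
    rw [show p w' = p w - 1 by lia, Int.even_sub_one]
    rw [Int.even_sub] at he
    simp only [hn, true_iff] at he
    by_cases h1 : Even (p w) <;>
      simp only [h1, true_iff, false_iff, not_true, not_false_iff] at he ⊢ <;> lia
  morse_up w w' h he := by
    have := S.morse_down w' w (by lia) (by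
      rw [show p w' = p w - 1 by lia, Int.even_sub_one]
      rw [Int.even_sub] at he
      simp only [hn, true_iff] at he
      rw [he]
      lia)
    rw [S.symm]
    lia
  morse_down w w' h he := by
    have hne : q w ≠ q w' := (S.q_ne (v := w') (w := w) (by lia)).symm
    have := S.morse_up w' w (by lia) (by
      rw [show p w' = p w - 1 by lia, Int.even_sub_one]
      rw [Int.even_sub] at he
      simp only [hn, true_iff] at he
      by_cases h1 : Even (p w) <;>
        simp only [h1, true_iff, false_iff, not_true, not_false_iff] at he ⊢ <;> lia)
    rw [S.symm]
    lia

end ShootingData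

end Serpent

/-! ### Zero numbers in 3-meander templates -/

/-- The vertices `w`, `w'` are consecutive on the curve. -/
def NextOn {E : Type*} (p : E → ℤ) (w w' : E) : Prop := p w' = p w + 1

/-- A 3-meander template with center `O`, in terms of the labels `p` along the curve and `q` along
the axis. The serpents at the second pole are the serpents of the reversed order `n - p`. -/
structure TemplateData {E : Type*} (p q : E → ℤ) (n : ℤ) (Z : E → E → ℕ) (r : E → ℤ) (O : E) :
    Prop where
  data : ShootingData p q n Z r
  dual : ShootingData q p n Z r
  even : Even n
  morse_nonneg : ∀ v, 0 ≤ r v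
  first : ∀ v, p v = 0 → r v = 0 ∧ q v = 0
  last : ∀ v, p v = n → r v = 0 ∧ q v = n
  noncrossing : ∀ w w' u u', NextOn p w w' → NextOn p u u' → (Even (p w) ↔ Even (p u)) →
    ¬ (min (q w) (q w') < min (q u) (q u') ∧ min (q u) (q u') < max (q w) (q w') ∧
      max (q w) (q w') < max (q u) (q u'))
  center : r O = 3
  le_two : ∀ v, v ≠ O → r v ≤ 2
  overlap : ∃ c, c ∈ serpent p r ∧ c ∈ serpent (fun v => n - q v) r
  overlap' : ∃ c, c ∈ serpent (fun v => n - p v) r ∧ c ∈ serpent q r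
  between_first : ∀ v, p v = 1 → q O < q v
  between_first' : ∀ v, q v = 1 → p O < p v
  between_last : ∀ v, p v + 1 = n → q v < q O
  between_last' : ∀ v, q v + 1 = n → p v < p O
  neighbor : ∀ v, p v + 1 = p O ∨ p v = p O + 1 → r v = 2
  neighbor' : ∀ v, q v + 1 = q O ∨ q v = q O + 1 → r v = 2
  terminator : ∀ v, IsTerminator q r v ∨ IsTerminator (fun v => n - q v) r v →
    p v + 1 = p O ∨ p v = p O + 1
  terminator' : ∀ v, IsTerminator p r v ∨ IsTerminator (fun v => n - p v) r v →
    q v + 1 = q O ∨ q v = q O + 1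

namespace TemplateData

variable {E : Type*} {p q : E → ℤ} {n : ℤ} {Z : E → E → ℕ} {r : E → ℤ} {O : E}

theorem first' (T : TemplateData p q n Z r O) : ∀ v, q v = 0 → r v = 0 ∧ p v = 0 := by
  intro v hv
  obtain ⟨u, hu⟩ := T.data.surj 0 le_rfl (by have := T.data.nonneg v; have := T.data.le v; lia)
  have h := T.first u hu
  rw [T.dual.inj (hv.trans h.2.symm)]
  exact ⟨h.1, hu⟩

/-- Reversing both orders exchanges the poles. -/
theorem reverse (T : TemplateData p q n Z r O) :
    TemplateData (fun v => n - p v) (fun v => n - q v) n Z r O where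
  data := T.data.reverse T.even
  dual := T.dual.reverse T.even
  even := T.even
  morse_nonneg := T.morse_nonneg
  first v hv := by have := T.last v (by lia); lia
  last v hv := by have := T.first v (by lia); lia
  noncrossing w w' u u' h h' he := by
    unfold NextOn at h h'
    have := T.noncrossing u' u w' w (by unfold NextOn; lia) (by unfold NextOn; lia) (by
      rw [Int.even_sub, Int.even_sub, show p w = p w' + 1 by lia, show p u = p u' + 1 by lia,
        Int.even_add_one, Int.even_add_one] at he
      have := T.even
      tauto)
    lia
  center := T.center
  le_two := T.le_two
  overlap := by simpa using T.overlap'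
  overlap' := by simpa using T.overlap
  between_first v hv := by have := T.between_last v (by lia); lia
  between_first' v hv := by have := T.between_last' v (by lia); lia
  between_last v hv := by have := T.between_first v (by lia); lia
  between_last' v hv := by have := T.between_first' v (by lia); lia
  neighbor v hv := T.neighbor v (by lia)
  neighbor' v hv := T.neighbor' v (by lia)
  terminator v hv := by
    have := T.terminator v (by simpa using hv.symm)
    lia
  terminator' v hv := by
    have := T.terminator' v (by simpa using hv.symm)
    lia

theorem center_notMem (T : TemplateData p q n Z r O) (f : E → ℤ) : O ∉ serpent f r := by
  intro h
  have := morse_of_mem_serpent h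
  have := T.center
  lia

theorem odd_center (T : TemplateData p q n Z r O) : ¬ Even (p O) := by
  rw [← T.data.parity_morse (fun v hv => (T.first v hv).1), T.center]
  decide

/-- Vertices on the first serpent, other than the pole, are separated from the center: they precede
it on the curve and follow it on the axis. -/
theorem serpent_center (T : TemplateData p q n Z r O) {v : E} (hv : v ∈ serpent p r)
    (h : p v ≠ 0) : p v < p O ∧ q O < q v ∧ Z v O = 1 := by
  have h1 := serpent_lt T.data.inj hv (T.center_notMem p)
  have h2 : q O < q v := by
    obtain ⟨w, hw⟩ := T.data.surj 1 (by lia) (by have := T.data.nonneg v; have := T.data.le v; lia)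
    have h3 := T.between_first w hw
    rcases (show p w ≤ p v by have := T.data.nonneg v; lia).lt_or_eq with h4 | h4
    · have := (T.data.serpent_pair hv h4).1
      lia
    · rwa [← T.data.inj h4]
  refine ⟨h1, h2, ?_⟩
  have h3 := T.data.serpent_le_one T.first T.dual.nonneg hv (g := O) (by rintro rfl; lia)
  rw [T.data.symm] at h3
  have h4 : ¬ Even (Z v O) := by
    rw [T.data.parity v O h1]
    lia
  interval_cases Z v O
  · simp at h4
  · rfl

/-- The same for the serpent along the axis, with the roles of the two orders exchanged. -/
theorem serpent_center_dual (T : TemplateData p q n Z r O) {v : E} (hv : v ∈ serpent q r)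
    (h : p v ≠ 0) : q v < q O ∧ p O < p v ∧ Z v O = 1 := by
  have h1 := serpent_lt T.dual.inj hv (T.center_notMem q)
  have h0 : q v ≠ 0 := fun e => h (T.first' v e).2
  have h2 : p O < p v := by
    obtain ⟨w, hw⟩ := T.dual.surj 1 (by lia) (by have := T.dual.nonneg v; have := T.dual.le v; lia)
    have h3 := T.between_first' w hw
    rcases (show q w ≤ q v by have := T.dual.nonneg v; lia).lt_or_eq with h4 | h4
    · have := (T.dual.serpent_pair hv h4).1
      lia
    · rwa [← T.dual.inj h4]
  refine ⟨h1, h2, ?_⟩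
  have h3 := T.dual.serpent_le_one T.first' T.data.nonneg hv (g := O) (by rintro rfl; lia)
  rw [T.data.symm] at h3
  have h4 : ¬ Even (Z v O) := by
    rw [T.dual.parity v O h1]
    lia
  interval_cases Z v O
  · simp at h4
  · rfl

/-- The terminator of the first serpent is the predecessor of the center on the axis. -/
theorem exists_first_terminator (T : TemplateData p q n Z r O) :
    ∃ t, IsTerminator p r t ∧ p t < p O ∧ q t + 1 = q O ∧ Z t O = 2 := by
  obtain ⟨t, ht, hle⟩ := T.data.exists_terminator (T.center_notMem p)
  have hadj := T.terminator' t (Or.inl ht)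
  have hr := T.neighbor' t hadj
  have hc := T.center
  have hlt : p t < p O := by
    refine hle.lt_of_ne fun e => ?_
    rw [T.data.inj e] at hr
    lia
  have hz : Z t O = 2 := by
    rcases hadj with h | h
    · by_cases he : Even (q t) ↔ p t < p O
      · have := T.dual.morse_up t O h.symm he; lia
      · have := T.dual.morse_down t O h.symm he; lia
    · rw [T.data.symm]
      by_cases he : Even (q O) ↔ p O < p t
      · have := T.dual.morse_up O t h he; lia
      · have := T.dual.morse_down O t h he; lia
  have := (T.data.parity t O hlt).1 (by rw [hz]; decide)
  exact ⟨t, ht, hlt, by lia, hz⟩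

/-- The terminator of the first dual serpent is the predecessor of the center on the curve. -/
theorem exists_first_terminator_dual (T : TemplateData p q n Z r O) :
    ∃ t, IsTerminator q r t ∧ q t < q O ∧ p t + 1 = p O := by
  obtain ⟨t, ht, hle⟩ := T.dual.exists_terminator (T.center_notMem q)
  have hadj := T.terminator t (Or.inl ht)
  have hr := T.neighbor t hadj
  have hc := T.center
  have hlt : q t < q O := by
    refine hle.lt_of_ne fun e => ?_
    rw [T.dual.inj e] at hr
    lia
  refine ⟨t, ht, hlt, ?_⟩
  have hz : Z t O = 2 := by
    rcases hadj with h | h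
    · by_cases he : Even (p t) ↔ q t < q O
      · have := T.data.morse_up t O h.symm he; lia
      · have := T.data.morse_down t O h.symm he; lia
    · rw [T.data.symm]
      by_cases he : Even (p O) ↔ q O < q t
      · have := T.data.morse_up O t h he; lia
      · have := T.data.morse_down O t h he; lia
  have := (T.dual.parity t O hlt).1 (by rw [hz]; decide)
  lia

/-- On its way from the first serpent to the center, the curve can leave the left side of the
center only into the second dual serpent: otherwise it would cross one of the two arches at the
center. It returns from that serpent to the left side, because the Morse numbers there are `0` or
`1`. -/
theorem zero_center_of_lt (T : TemplateData p q n Z r O) {v : E} (hv : v ∉ serpent p r)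
    (hv' : v ∉ serpent (fun v => n - q v) r) (h : p v < p O) : q v < q O ∧ Z v O = 2 := by
  obtain ⟨t, ht, htO, htq, htz⟩ := T.exists_first_terminator
  obtain ⟨a, ha, haO, hap⟩ := T.exists_first_terminator_dual
  obtain ⟨b, hb, hbO, hbp⟩ := T.reverse.exists_first_terminator_dual
  have hodd := T.odd_center
  have hbq : q O < q b := by lia
  have hpb : p b = p O + 1 := by lia
  have hmem : ∀ w, q b < q w → w ∈ serpent (fun v => n - q v) r := fun w hw => hb.2 w (by lia)
  have hmem' : ∀ w, w ∈ serpent (fun v => n - q v) r → q b < q w := fun w hw => by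
    have := serpent_lt T.reverse.dual.inj hw hb.1
    lia
  have htv : ∀ w, w ∉ serpent p r → p t ≤ p w := fun w hw => by
    by_contra hcon
    exact hw (ht.2 w (by lia))
  have ht0 : 0 < p t := by
    have := T.data.nonneg t
    refine this.lt_of_ne fun e => ht.1 ?_
    intro w hw
    have hw0 : p w = 0 := by
      rcases hw with rfl | hw
      · exact e.symm
      · have := T.data.nonneg w; lia
    exact Or.inl (T.first w hw0).1
  suffices hmain : p t ≤ p v → p v < p O →
      (q v < q O ∧ Z v O = 2) ∨ v ∈ serpent (fun v => n - q v) r by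
    exact (hmain (htv v hv) h).resolve_right hv'
  clear hv hv' h
  refine T.data.induction (P := fun v => p t ≤ p v → p v < p O →
      (q v < q O ∧ Z v O = 2) ∨ v ∈ serpent (fun v => n - q v) r) ?_ ?_ v
  · intro v hv0 h1 _
    lia
  intro w w' hww ih h1 h2
  rcases h1.lt_or_eq with h1 | h1
  swap
  · rw [← T.data.inj h1]
    exact Or.inl ⟨by lia, htz⟩
  have hw'O : q w' ≠ q O := T.data.q_ne h2
  have hwO : q w ≠ q O := T.data.q_ne (by lia)
  have hstep := T.data.step_cases (v := O) hww (by rintro rfl; lia) (by rintro rfl; lia)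
  rw [T.data.symm O w, T.data.symm O w'] at hstep
  have hb' : q w' ≠ q b := fun e => by
    have := T.dual.inj e
    subst this
    lia
  by_cases he : Even (p w)
  · rcases ih (by lia) (by lia) with ⟨h3, h4⟩ | h3
    · by_cases h5 : q w' < q O
      · left
        exact ⟨h5, by lia⟩
      · -- The arch from `w` to `w'` would cross the arch from the first dual terminator to `O`.
        exfalso
        have h6 : q a < q w := by
          have h7 : q a ≠ q w := fun e => by
            have := T.dual.inj e
            subst this
            rw [hap] at hww
            exact hw'O (congrArg q (T.data.inj hww))
          by_contra h8
          have := T.serpent_center_dual (ha.2 w (by lia)) (by lia)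
          lia
        refine T.noncrossing a O w w' hap.symm hww ?_ (by lia)
        rw [← hap, Int.even_add_one, not_not] at hodd
        simp [hodd, he]
    · -- As `r w = 0`, the curve continues to the right along the axis.
      right
      have hr : r w = 0 := by
        have h4 := morse_of_mem_serpent h3
        have := T.data.parity_morse (fun v hv => (T.first v hv).1) w
        rcases h4 with h4 | h4
        · exact h4
        · rw [h4] at this
          simp [he] at this
      have h4 : q w < q w' := by
        by_contra h5
        have := T.data.morse_down w w' hww (by simp [he]; lia)
        have := T.morse_nonneg w'
        lia
      exact hmem _ (by have := hmem' _ h3; lia)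
  · -- The arch from `w` to `w'` does not cross the arch from `O` to the terminator `b`.
    have hcross := T.noncrossing O b w w' hpb hww (by simp [hodd, he])
    have hcross' := T.noncrossing w w' O b hww hpb (by simp [hodd, he])
    rcases ih (by lia) (by lia) with ⟨h3, h4⟩ | h3
    · by_cases h5 : q w' < q O
      · left
        exact ⟨h5, by lia⟩
      · right
        exact hmem _ (by lia)
    · have h4 := hmem' _ h3
      by_cases h5 : q b < q w'
      · exact Or.inr (hmem _ h5)
      · have h6 : q w' < q O := by lia
        left
        refine ⟨h6, ?_⟩
        have h7 := (T.reverse.serpent_center_dual h3 (fun e => by have := T.data.le O; lia)).2.2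
        simp only [he, false_iff] at hstep
        lia

/-- On an interval of the curve with Morse numbers at most `2`, all zero numbers are at most `1`:
for the first pair with zero number `2`, the curve would have to turn around the first vertex of
that pair, and this forces a zero number `2` earlier. -/
theorem zero_le_one_of_lt (T : TemplateData p q n Z r O) {v w : E} (hv : p v < p O)
    (hw : p w < p O) (hne : v ≠ w) : Z v w ≤ 1 := by
  have key : ∀ (m : ℕ) (v w : E), p w - p v = m → 0 < m → p w < p O → Z v w ≤ 1 := by
    intro m
    induction m using Nat.strong_induction_on with
    | _ m IH =>
      intro v w hm hm0 hwO
      by_contra hcon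
      have IH' : ∀ x y, p x < p y → p y < p O → p y - p x < m → Z x y ≤ 1 := by
        intro x y h1 h2 h3
        exact IH (p y - p x).toNat (by lia) x y (by lia) (by lia) h2
      -- The vertices of the pair are not adjacent, as the Morse numbers are at most `2`.
      obtain ⟨w₀, hw₀⟩ := T.data.exists_pred (v := v) (w := w) (by lia)
      obtain ⟨v₁, hv₁⟩ := T.data.exists_succ (v := v) (w := w) (by lia)
      have hv₁r := T.le_two v₁ (by rintro rfl; lia)
      have hvr := T.le_two v (by rintro rfl; lia)
      have hadj : Z v v₁ ≤ 1 := by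
        by_cases he : Even (p v) ↔ q v < q v₁
        · have := T.data.morse_up v v₁ hv₁ he; lia
        · have := T.data.morse_down v v₁ hv₁ he; lia
      have hm1 : p v < p w₀ := by
        by_contra h1
        have : v₁ = w := T.data.inj (by lia)
        subst this
        lia
      have h1 := IH' v w₀ (by lia) (by lia) (by lia)
      have h2 := IH' v₁ w (by lia) (by lia) (by lia)
      have hs1 := T.data.step_cases (v := v) hw₀ (by rintro rfl; lia) (by rintro rfl; lia)
      have hs2 := T.data.step_cases (v := w) hv₁ (by rintro rfl; lia) (by rintro rfl; lia)
      rw [T.data.symm w v, T.data.symm w v₁] at hs2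
      have hz : Z v w = 2 := by lia
      have hqw : q v < q w := (T.data.parity v w (by lia)).1 (by rw [hz]; decide)
      have hq₀ : q w₀ < q v := by lia
      have hq₁ : q w < q v₁ := by lia
      have hoddv : ¬ Even (p v) := by
        intro he
        simp only [he, true_iff] at hs2
        lia
      have hzero : Z v v₁ = 0 := by
        have h4 : ¬ (Even (p v) ↔ q v < q v₁) := by simp only [hoddv, false_iff]; lia
        have h5 := (T.data.parity v v₁ (by lia)).2 (by lia)
        rw [Nat.even_iff] at h5
        lia
      -- Between `v₁` and `w₀`, the curve passes from the right to the left side of `v`.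
      obtain ⟨l, l', hl, hl1, hl2, hl3, hl4⟩ : ∃ l l', p l' = p l + 1 ∧ p v₁ ≤ p l ∧ p l' ≤ p w₀ ∧
          q v < q l ∧ q l' < q v := by
        by_contra hno
        push Not at hno
        have : p v₁ ≤ p w₀ → p w₀ ≤ p w₀ → q v < q w₀ := by
          refine T.data.induction (P := fun x => p v₁ ≤ p x → p x ≤ p w₀ → q v < q x) ?_ ?_ w₀
          · intro x hx h5 _
            have := T.data.nonneg v
            lia
          · intro x x' hx ih h5 h6
            rcases h5.lt_or_eq with h5 | h5
            · have := hno x x' hx (by lia) h6 (ih (by lia) (by lia))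
              have := T.data.q_ne (v := v) (w := x') (by lia)
              lia
            · rw [← T.data.inj h5]
              lia
        have := this (by lia) le_rfl
        lia
      have hzl := IH' v l (by lia) (by lia) (by lia)
      have hzl' := IH' v l' (by lia) (by lia) (by lia)
      have hel := (T.data.parity v l (by lia)).2 hl3
      have hel' : ¬ Even (Z v l') := by
        rw [T.data.parity v l' (by lia)]
        lia
      rw [Nat.even_iff] at hel hel'
      have hs3 := T.data.step_cases (v := v) hl (by rintro rfl; lia) (by rintro rfl; lia)
      have hoddl : ¬ Even (p l) := by
        intro he
        simp only [he, true_iff] at hs3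
        lia
      have hcross := T.noncrossing v v₁ l l' hv₁ hl (by simp [hoddv, hoddl])
      have hcross' := T.noncrossing l l' v v₁ hl hv₁ (by simp [hoddv, hoddl])
      have hne1 : q l ≠ q v₁ := by
        intro e
        have := T.dual.inj e
        subst this
        rw [hv₁, Int.even_add_one, not_not] at hoddl
        exact hoddv hoddl
      have hql : q v₁ < q l := by lia
      have hel2 : ¬ Even (Z l w) := by
        rw [T.data.parity l w (by lia)]
        lia
      have h6 : Z w l' = Z w l + 1 := T.data.step_up w l l' hl (by lia) (by
        simp only [hoddl, false_iff]; lia)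
      rw [T.data.symm w l, T.data.symm w l'] at h6
      have h7 := IH' l' w (by lia) (by lia) (by lia)
      rw [Nat.even_iff] at hel2
      lia
  rcases lt_or_gt_of_ne (fun e => hne (T.data.inj e)) with h | h
  · exact key (p w - p v).toNat v w (by lia) (by lia) hw
  · rw [T.data.symm]
    exact key (p v - p w).toNat w v (by lia) (by lia) hv

/-- The first serpent and the second dual serpent form a chain, since they overlap. -/
theorem zero_chain (T : TemplateData p q n Z r O) {v w : E}
    (hv : v ∈ serpent p r ∪ serpent (fun v => n - q v) r)
    (hw : w ∈ serpent p r ∪ serpent (fun v => n - q v) r) (h : v ≠ w) : Z v w = 0 := by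
  have key : ∀ v w, v ∈ serpent p r → w ∈ serpent (fun v => n - q v) r → v ≠ w → Z v w = 0 := by
    intro v w hv hw h
    by_cases hv' : v ∈ serpent (fun v => n - q v) r
    · exact T.reverse.dual.serpent_zero hv' hw h
    by_cases hw' : w ∈ serpent p r
    · exact T.data.serpent_zero hv hw' h
    obtain ⟨c, hc, hc'⟩ := T.overlap
    have h1 := serpent_lt T.reverse.dual.inj hc' hv'
    have h2 := serpent_lt T.data.inj hc hw'
    have h3 := (T.data.serpent_mono hv hc).2 (by lia)
    have h4 := (T.reverse.dual.serpent_mono hw hc').2 (by lia)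
    have h5 := (T.data.parity v w (by lia)).2 (by lia)
    have h6 := T.data.serpent_le_one T.first T.dual.nonneg hv h.symm
    rw [T.data.symm] at h6
    rw [Nat.even_iff] at h5
    lia
  rcases hv with hv | hv <;> rcases hw with hw | hw
  · exact T.data.serpent_zero hv hw h
  · exact key v w hv hw h
  · rw [T.data.symm]
    exact key w v hw hv h.symm
  · exact T.reverse.dual.serpent_zero hv hw h

end TemplateData

/-! ### Hemispheres of a 3-meander template -/

/-- The vertices other than the center on the side of the first pole: the pole itself, the vertices
on the serpents from the first pole along the curve and from the second pole along the axis, and the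
vertices on no serpent which precede the center on the axis. -/
def side {E : Type*} (p q : E → ℤ) (n : ℤ) (r : E → ℤ) (O : E) : ℕ → Set E
  | 0 => {v | p v = 0}
  | 1 => {v | v ∈ serpent p r ∪ serpent (fun v => n - q v) r ∧ p v ≠ 0 ∧ p v ≠ n}
  | 2 => {v | v ∉ serpent p r ∧ v ∉ serpent (fun v => n - q v) r ∧
      v ∉ serpent (fun v => n - p v) r ∧ v ∉ serpent q r ∧ v ≠ O ∧ q v < q O}
  | _ => ∅

namespace TemplateData

variable {E : Type*} {p q : E → ℤ} {n : ℤ} {Z : E → E → ℕ} {r : E → ℤ} {O : E}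

/-- The signed zero numbers with respect to the center. -/
theorem side_center (T : TemplateData p q n Z r O) {k : ℕ} {v : E} (hv : v ∈ side p q n r O k) :
    v ≠ O ∧ p v < p O ∧ Z v O = k ∧ r v ≤ k := by
  match k, hv with
  | 0, hv =>
    have hv : p v = 0 := hv
    have h1 := T.odd_center
    have h2 : p O ≠ 0 := fun e => by simp [e] at h1
    have h3 := T.data.nonneg O
    have h4 : O ≠ v := fun e => h2 (by rw [e, hv])
    refine ⟨h4.symm, by lia, ?_, (T.first v hv).1.le⟩
    exact T.data.pole_zero T.first T.dual.nonneg hv h4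
  | 1, hv =>
    obtain ⟨hv, h0, h1⟩ := hv
    rcases hv with hv | hv
    · obtain ⟨h2, h3, h4⟩ := T.serpent_center hv h0
      have := morse_of_mem_serpent hv
      exact ⟨fun e => by simp [e] at h2, h2, h4, by lia⟩
    · obtain ⟨h2, h3, h4⟩ := T.reverse.serpent_center_dual hv (by lia)
      have := morse_of_mem_serpent hv
      exact ⟨fun e => by simp [e] at h2, by lia, h4, by lia⟩
  | 2, hv =>
    obtain ⟨h1, h2, h3, h4, h5, h6⟩ := hv
    have h7 : p v < p O := by
      by_contra h8
      have h9 : p v ≠ p O := fun e => h5 (T.data.inj e)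
      have := (T.reverse.zero_center_of_lt h3 (by simpa using h4) (by lia)).1
      lia
    exact ⟨h5, h7, (T.zero_center_of_lt h1 h2 h7).2, T.le_two v h5⟩

/-- Any polar serpent has zero numbers at most `1` with all other vertices. -/
theorem serpent_zero_le_one (T : TemplateData p q n Z r O) {v w : E} (h : w ≠ v)
    (hv : v ∈ serpent p r ∨ v ∈ serpent (fun v => n - q v) r ∨ v ∈ serpent (fun v => n - p v) r ∨
      v ∈ serpent q r) : Z w v ≤ 1 := by
  rcases hv with hv | hv | hv | hv
  · exact T.data.serpent_le_one T.first T.dual.nonneg hv h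
  · exact T.reverse.dual.serpent_le_one T.reverse.first' T.reverse.data.nonneg hv h
  · exact T.reverse.data.serpent_le_one T.reverse.first T.reverse.dual.nonneg hv h
  · exact T.dual.serpent_le_one T.first' T.data.nonneg hv h

theorem mem_serpent_of_pole (T : TemplateData p q n Z r O) {v : E} (hv : p v = 0) :
    v ∈ serpent p r ∧ v ∈ serpent q r := by
  obtain ⟨h1, h2⟩ := T.first v hv
  constructor
  · rintro w (rfl | hw)
    · exact Or.inl h1
    · have := T.data.nonneg w
      lia
  · rintro w (rfl | hw)
    · exact Or.inl h1
    · have := T.dual.nonneg w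
      lia

theorem mem_serpent_of_side (T : TemplateData p q n Z r O) {k : ℕ} (hk : k < 2) {v : E}
    (hv : v ∈ side p q n r O k) : v ∈ serpent p r ∪ serpent (fun v => n - q v) r := by
  interval_cases k
  · exact Or.inl (T.mem_serpent_of_pole hv).1
  · exact hv.1

/-- Zero numbers within the closed hemispheres. -/
theorem zero_lt_of_side (T : TemplateData p q n Z r O) {j : ℕ} (hj : j ≤ 2) {v w : E}
    (hv : v ∈ side p q n r O j ∨ ∃ k < j, v ∈ side p q n r O k ∨
      v ∈ side (fun v => n - p v) (fun v => n - q v) n r O k)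
    (hw : w ∈ side p q n r O j ∨ ∃ k < j, w ∈ side p q n r O k ∨
      w ∈ side (fun v => n - p v) (fun v => n - q v) n r O k) (h : v ≠ w) : Z v w < j := by
  have hmem : ∀ v, ∀ k < 2, (v ∈ side p q n r O k ∨
      v ∈ side (fun v => n - p v) (fun v => n - q v) n r O k) →
      v ∈ serpent p r ∨ v ∈ serpent (fun v => n - q v) r ∨ v ∈ serpent (fun v => n - p v) r ∨
      v ∈ serpent q r := by
    rintro v k hk (hv | hv)
    · have := T.mem_serpent_of_side hk hv
      rcases this with h | h <;> simp [h]
    · have := T.reverse.mem_serpent_of_side hk hv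
      simp only [sub_sub_cancel] at this
      rcases this with h | h <;> simp [h]
  interval_cases j
  · have h1 : p v = 0 := by simpa [side] using hv
    have h2 : p w = 0 := by simpa [side] using hw
    exact absurd (T.data.inj (h1.trans h2.symm)) h
  · have key : ∀ v, (v ∈ side p q n r O 1 ∨ ∃ k < 1, v ∈ side p q n r O k ∨
        v ∈ side (fun v => n - p v) (fun v => n - q v) n r O k) →
        v ∈ serpent p r ∪ serpent (fun v => n - q v) r := by
      rintro v (hv | ⟨k, hk, hv⟩)
      · exact hv.1
      · obtain rfl : k = 0 := by lia
        rcases hv with hv | hv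
        · exact Or.inl (T.mem_serpent_of_pole hv).1
        · exact Or.inr (T.reverse.mem_serpent_of_pole hv).2
    rw [T.zero_chain (key v hv) (key w hw) h]
    exact one_pos
  · rcases hv with hv | ⟨k, hk, hv⟩
    · rcases hw with hw | ⟨k, hk, hw⟩
      · exact Nat.lt_succ_of_le
          (T.zero_le_one_of_lt (T.side_center hv).2.1 (T.side_center hw).2.1 h)
      · exact Nat.lt_succ_of_le (T.serpent_zero_le_one h (hmem w k hk hw))
    · rw [T.data.symm]
      exact Nat.lt_succ_of_le (T.serpent_zero_le_one h.symm (hmem v k hk hv))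

end TemplateData

/-! ### Templates given by labelings -/

theorem pos_injective {E : Type*} {n : ℕ} (h : Fin 2 → (Fin (n + 1) ≃ E)) (ι : Fin 2) :
    Function.Injective fun v => (pos h ι v : ℤ) := fun _ _ e =>
  (h ι).symm.injective (Fin.ext (Int.natCast_inj.1 e))

theorem pos_le {E : Type*} {n : ℕ} (h : Fin 2 → (Fin (n + 1) ≃ E)) (ι : Fin 2) (v : E) :
    (pos h ι v : ℤ) ≤ n := by
  have : pos h ι v < n + 1 := ((h ι).symm v).2
  lia

theorem pos_surjective {E : Type*} {n : ℕ} (h : Fin 2 → (Fin (n + 1) ≃ E)) (ι : Fin 2) (k : ℤ)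
    (h0 : 0 ≤ k) (hn : k ≤ n) : ∃ v, (pos h ι v : ℤ) = k :=
  ⟨h ι ⟨k.toNat, by lia⟩, by simp [pos, h0]⟩

section Labeling

variable {E : Type*} {n : ℕ} {h : Fin 2 → (Fin (n + 1) ≃ E)}

/-- The `k`-th intersection point along the curve has the axis label of the vertex `h 0 k`. -/
theorem axisPos_pos (v : E) : axisPos (sturmPerm h) (pos h 0 v) = pos h 1 v := by
  have : Fin.ofNat (n + 1) (pos h 0 v) = (h 0).symm v := by
    apply Fin.ext
    simp [pos, Fin.ofNat, Nat.mod_eq_of_lt ((h 0).symm v).2]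
  rw [axisPos, this]
  simp [sturmPerm, pos, Equiv.Perm.inv_def]

/-- The recursion for Morse numbers along the curve. -/
theorem morseNumber_eq {Z : E → E → ℕ} {ρ : E → ℕ}
    (D : ShootingData (fun v => (pos h 0 v : ℤ)) (fun v => (pos h 1 v : ℤ)) n Z (fun v => ρ v))
    (h0 : ∀ v, (pos h 0 v : ℤ) = 0 → ρ v = 0) (v : E) : morseNumber h v = ρ v := by
  refine D.induction (P := fun v => morseNumber h v = ρ v) ?_ ?_ v
  · intro v hv
    have hv' : pos h 0 v = 0 := by exact_mod_cast hv
    rw [morseNumber, hv', h0 v hv]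
    rfl
  · intro w w' hww ih
    have hww' : pos h 0 w' = pos h 0 w + 1 := by exact_mod_cast hww
    have h1 := axisPos_pos (h := h) w'
    rw [hww'] at h1
    rw [morseNumber, hww', morseRec, axisPos_pos, h1]
    rw [morseNumber] at ih
    rw [ih]
    have hne : (pos h 1 w' : ℤ) ≠ pos h 1 w := fun e => by
      have := D.inj' e
      subst this
      lia
    have hup := D.morse_up w w' hww
    have hdown := D.morse_down w w' hww
    simp only [Int.even_coe_nat] at hup hdown
    rcases lt_or_gt_of_ne hne with hlt | hlt
    · rw [Int.sign_eq_neg_one_of_neg (sub_neg.2 hlt)]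
      rcases Nat.even_or_odd (pos h 0 w) with he | he
      · rw [he.neg_one_pow, (hdown (by simp [he]; lia)).1]
        ring
      · rw [he.neg_one_pow, (hup (by simp [Nat.not_even_iff_odd.2 he]; lia)).1]
        ring
    · rw [Int.sign_eq_one_of_pos (sub_pos.2 hlt)]
      rcases Nat.even_or_odd (pos h 0 w) with he | he
      · rw [he.neg_one_pow, (hup (by simp [he]; lia)).1]
        ring
      · rw [he.neg_one_pow, (hdown (by simp [Nat.not_even_iff_odd.2 he]; lia)).1]
        ring

theorem closerToPole_neg (ι : Fin 2) (w v : E) :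
    CloserToPole h ι (-1) w v ↔ (pos h ι w : ℤ) < pos h ι v := by
  simp [CloserToPole]

theorem closerToPole_one (ι : Fin 2) (w v : E) :
    CloserToPole h ι 1 w v ↔ (n : ℤ) - pos h ι w < n - pos h ι v := by
  simp [CloserToPole]

variable {r : E → ℤ}

theorem polarSerpent_neg (hr : ∀ v, morseNumber h v = r v) (ι : Fin 2) :
    polarSerpent h ι (-1) = serpent (fun v => (pos h ι v : ℤ)) r := by
  ext v
  simp [polarSerpent, serpent, closerToPole_neg, hr]

theorem polarSerpent_one (hr : ∀ v, morseNumber h v = r v) (ι : Fin 2) :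
    polarSerpent h ι 1 = serpent (fun v => (n : ℤ) - pos h ι v) r := by
  ext v
  simp only [polarSerpent, serpent, closerToPole_one, hr]

theorem terminatesSerpent_neg (hr : ∀ v, morseNumber h v = r v) (ι : Fin 2) (w : E) :
    TerminatesSerpent h ι (-1) w ↔ IsTerminator (fun v => (pos h ι v : ℤ)) r w := by
  simp only [TerminatesSerpent, IsTerminator, polarSerpent_neg hr, closerToPole_neg]

theorem terminatesSerpent_one (hr : ∀ v, morseNumber h v = r v) (ι : Fin 2) (w : E) :
    TerminatesSerpent h ι 1 w ↔ IsTerminator (fun v => (n : ℤ) - pos h ι v) r w := by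
  simp only [TerminatesSerpent, IsTerminator, polarSerpent_one hr, closerToPole_one]

/-- The second pole is even, and hence has Morse number `0`, because overlaps are nonempty. -/
theorem IsThreeMeanderTemplate.templateData {O : E} (H : IsThreeMeanderTemplate h O)
    {Z : E → E → ℕ} (hr : ∀ v, morseNumber h v = r v)
    (D : ShootingData (fun v => (pos h 0 v : ℤ)) (fun v => (pos h 1 v : ℤ)) n Z r)
    (D' : ShootingData (fun v => (pos h 1 v : ℤ)) (fun v => (pos h 0 v : ℤ)) n Z r) :
    TemplateData (fun v => (pos h 0 v : ℤ)) (fun v => (pos h 1 v : ℤ)) n Z r O := by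
  obtain ⟨⟨hodd, hnc⟩, ⟨hσ0, hσn⟩, hnonneg⟩ := H.sturm
  have hn : Even n := by
    rw [Nat.odd_add_one, Nat.not_odd_iff_even] at hodd
    exact hodd
  have hle : ∀ ι v, pos h ι v ≤ n := fun ι v => by exact_mod_cast pos_le h ι v
  have hfirst : ∀ v, (pos h 0 v : ℤ) = 0 → r v = 0 ∧ (pos h 1 v : ℤ) = 0 := by
    intro v hv
    have hv' : pos h 0 v = 0 := by exact_mod_cast hv
    refine ⟨by rw [← hr, morseNumber, hv']; rfl, ?_⟩
    have h1 : v = h 0 0 := by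
      rw [← Equiv.symm_apply_eq]
      exact Fin.ext hv'
    have h2 : h 1 0 = h 0 0 := by
      rw [← Equiv.symm_apply_eq]
      exact hσ0
    rw [h1, ← h2]
    simp [pos]
  have hlast : ∀ v, (pos h 0 v : ℤ) = n → r v = 0 ∧ (pos h 1 v : ℤ) = n := by
    intro v hv
    have hv' : pos h 0 v = n := by exact_mod_cast hv
    constructor
    · obtain ⟨c, hc, -⟩ := H.overlap 0 1
      rw [polarSerpent_one hr] at hc
      have h1 : r v = 0 ∨ r v = 1 := by
        refine hc v ?_
        by_cases e : v = c
        · exact Or.inl e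
        · right
          have h2 : (pos h 0 v : ℤ) ≠ pos h 0 c := fun e' => e (D.inj e')
          have := hle 0 c
          lia
      have h2 := D.parity_morse (fun v hv => (hfirst v hv).1) v
      rcases h1 with h1 | h1
      · exact h1
      · rw [h1, hv] at h2
        simp [hn] at h2
    · have h1 : v = h 0 (Fin.last n) := by
        rw [← Equiv.symm_apply_eq]
        exact Fin.ext hv'
      have h2 : h 1 (Fin.last n) = h 0 (Fin.last n) := by
        rw [← Equiv.symm_apply_eq]
        exact hσn
      rw [h1, ← h2]
      simp [pos]
  refine
    { data := D
      dual := D'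
      even := by exact_mod_cast hn
      morse_nonneg := fun v => by
        rw [← hr]
        exact hnonneg _ (hle 0 v)
      first := hfirst
      last := hlast
      noncrossing := fun w w' u u' hw hu he => ?_
      center := by rw [← hr]; exact H.center.1
      le_two := fun v hv => by rw [← hr]; exact H.center.2 v hv
      overlap := ?_
      overlap' := ?_
      between_first := fun v hv => by
        exact_mod_cast ((H.between 0 v).1 (by exact_mod_cast hv)).2
      between_first' := fun v hv => by
        exact_mod_cast ((H.between 1 v).1 (by exact_mod_cast hv)).2
      between_last := fun v hv => by
        exact_mod_cast ((H.between 0 v).2 (by exact_mod_cast hv)).1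
      between_last' := fun v hv => by
        exact_mod_cast ((H.between 1 v).2 (by exact_mod_cast hv)).1
      neighbor := fun v hv => by
        rw [← hr]
        exact (H.neighbors 0 v).1 (by unfold IsNeighbor; exact_mod_cast hv)
      neighbor' := fun v hv => by
        rw [← hr]
        exact (H.neighbors 1 v).1 (by unfold IsNeighbor; exact_mod_cast hv)
      terminator := fun v hv => ?_
      terminator' := fun v hv => ?_ }
  · simp only [NextOn] at hw hu
    have hw' : pos h 0 w' = pos h 0 w + 1 := by exact_mod_cast hw
    have hu' : pos h 0 u' = pos h 0 u + 1 := by exact_mod_cast hu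
    simp only [Int.even_coe_nat, Nat.even_iff] at he
    have := hnc (pos h 0 w) (pos h 0 u) (by have := hle 0 w'; lia) (by have := hle 0 u'; lia)
      (by lia)
    rwa [← hw', ← hu', axisPos_pos, axisPos_pos, axisPos_pos, axisPos_pos] at this
  · have := H.overlap 0 (-1)
    rw [neg_neg, polarSerpent_neg hr, show (1 - 0 : Fin 2) = 1 from rfl,
      polarSerpent_one hr] at this
    exact this
  · have := H.overlap 0 1
    rw [polarSerpent_neg hr, show (1 - 0 : Fin 2) = 1 from rfl, polarSerpent_one hr] at this
    exact this
  · have : IsNeighbor h 0 O v := (H.neighbors 0 v).2.2 (by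
      rcases hv with hv | hv
      · exact ⟨-1, (terminatesSerpent_neg hr 1 v).2 hv⟩
      · exact ⟨1, (terminatesSerpent_one hr 1 v).2 hv⟩)
    unfold IsNeighbor at this
    exact_mod_cast this
  · have : IsNeighbor h 1 O v := (H.neighbors 1 v).2.2 (by
      rcases hv with hv | hv
      · exact ⟨-1, (terminatesSerpent_neg hr 0 v).2 hv⟩
      · exact ⟨1, (terminatesSerpent_one hr 0 v).2 hv⟩)
    unfold IsNeighbor at this
    exact_mod_cast this

theorem pole_neg_iff (v : E) : v = pole h (-1) ↔ (pos h 0 v : ℤ) = 0 := by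
  simp only [pole, if_true, ← Equiv.symm_apply_eq, pos, Nat.cast_eq_zero, Fin.ext_iff, Fin.val_zero]

theorem pole_one_iff (v : E) : v = pole h 1 ↔ (pos h 0 v : ℤ) = n := by
  have : ¬ (1 : ℤˣ) = -1 := by decide
  simp only [pole, if_neg this, ← Equiv.symm_apply_eq, pos, Nat.cast_inj, Fin.ext_iff, Fin.val_last]

theorem primedSet_subset {O : E} (hr : ∀ v, morseNumber h v = r v)
    (k : ℕ) :
    primedSet h O (-1) k ⊆ side (fun v => (pos h 0 v : ℤ)) (fun v => (pos h 1 v : ℤ)) n r O k ∧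
    primedSet h O 1 k ⊆ side (fun v => (n : ℤ) - pos h 0 v) (fun v => (n : ℤ) - pos h 1 v) n r O
      k := by
  match k with
  | 0 =>
    refine ⟨fun v hv => (pole_neg_iff v).1 hv, fun v hv => ?_⟩
    have := (pole_one_iff v).1 hv
    change (n : ℤ) - pos h 0 v = 0
    lia
  | 1 =>
    constructor
    · rintro v ⟨hv, hp⟩
      rw [polarSerpent_neg hr, neg_neg, polarSerpent_one hr] at hv
      simp only [Set.mem_insert_iff, Set.mem_singleton_iff, not_or, pole_neg_iff,
        pole_one_iff] at hp
      exact ⟨hv, hp⟩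
    · rintro v ⟨hv, hp⟩
      rw [polarSerpent_one hr, polarSerpent_neg hr] at hv
      simp only [Set.mem_insert_iff, Set.mem_singleton_iff, not_or, pole_neg_iff,
        pole_one_iff] at hp
      exact ⟨by simpa using hv, by lia, by lia⟩
  | 2 =>
    have key : ∀ v, v ∉ ({pole h (-1), pole h 1} ∪ meridianSet h (-1) ∪ meridianSet h 1 : Set E) →
        v ∉ serpent (fun v => (pos h 0 v : ℤ)) r ∧ v ∉ serpent (fun v => (n : ℤ) - pos h 1 v) r ∧
        v ∉ serpent (fun v => (n : ℤ) - pos h 0 v) r ∧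
        v ∉ serpent (fun v => (pos h 1 v : ℤ)) r := by
      intro v hv
      simp only [meridianSet, polarSerpent_neg hr, polarSerpent_one hr, neg_neg, Set.mem_union,
        Set.mem_sdiff] at hv
      tauto
    constructor
    · rintro v ⟨hv, hO, hlt⟩
      obtain ⟨h1, h2, h3, h4⟩ := key v hv
      refine ⟨h1, h2, h3, h4, hO, ?_⟩
      simpa using hlt
    · rintro v ⟨hv, hO, hlt⟩
      obtain ⟨h1, h2, h3, h4⟩ := key v hv
      refine ⟨h3, by simpa using h4, by simpa using h1, h2, hO, ?_⟩
      simpa using hlt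
  | k + 3 => exact ⟨fun v hv => hv.elim, fun v hv => hv.elim⟩

end Labeling

open Set Real

/-! ### Calculus on the unit interval -/

/-- `w'` is the derivative of `w` on `[0,1]`, one-sided at the end points. -/
def DerivOn {E : Type*} [NormedAddCommGroup E] [NormedSpace ℝ E] (w w' : ℝ → E) : Prop :=
  ∀ x ∈ Icc (0 : ℝ) 1, HasDerivWithinAt w (w' x) (Icc 0 1) x

section Calculus

variable {E : Type*} [NormedAddCommGroup E] [NormedSpace ℝ E] {w w' : ℝ → E}

theorem DerivOn.continuousOn (h : DerivOn w w') : ContinuousOn w (Icc 0 1) :=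
  fun x hx => (h x hx).continuousWithinAt

theorem DerivOn.hasDerivWithinAt_Ici (h : DerivOn w w') {x : ℝ} (hx : x ∈ Ico (0 : ℝ) 1) :
    HasDerivWithinAt w (w' x) (Ici x) x :=
  (h x (Ico_subset_Icc_self hx)).mono_of_mem_nhdsWithin (Icc_mem_nhdsGE_of_mem hx)

theorem DerivOn.reflect (h : DerivOn w w') :
    DerivOn (fun x => w (1 - x)) (fun x => -w' (1 - x)) := by
  intro x hx
  have hx' : 1 - x ∈ Icc (0 : ℝ) 1 := ⟨by linarith [hx.2], by linarith [hx.1]⟩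
  have h1 : HasDerivWithinAt (fun y : ℝ => 1 - y) (-1) (Icc 0 1) x := by
    simpa using (hasDerivWithinAt_id x (Icc (0 : ℝ) 1)).const_sub 1
  have := (h (1 - x) hx').scomp x h1 (fun y hy => ⟨by linarith [hy.2], by linarith [hy.1]⟩)
  simpa [Function.comp_def] using this

theorem DerivOn.congr {v v' : ℝ → E} (h : DerivOn w w') (hv : ∀ x ∈ Icc (0 : ℝ) 1, v x = w x)
    (hv' : ∀ x ∈ Icc (0 : ℝ) 1, v' x = w' x) : DerivOn v v' := by
  intro x hx
  rw [hv' x hx]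
  exact (h x hx).congr hv (hv x hx)

theorem DerivOn.sub {v v' : ℝ → E} (h : DerivOn w w') (hv : DerivOn v v') :
    DerivOn (fun x => w x - v x) (fun x => w' x - v' x) :=
  fun x hx => (h x hx).sub (hv x hx)

theorem DerivOn.derivWithin_eq (h : DerivOn w w') {x : ℝ} (hx : x ∈ Icc (0 : ℝ) 1) :
    derivWithin w (Icc 0 1) x = w' x :=
  (h x hx).derivWithin (uniqueDiffOn_Icc zero_lt_one x hx)

/-- Gronwall's inequality, forward and backward. -/
theorem DerivOn.norm_le {C : ℝ} (hC0 : 0 ≤ C) (h : DerivOn w w')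
    (hC : ∀ x ∈ Icc (0 : ℝ) 1, ‖w' x‖ ≤ C * ‖w x‖) {x y : ℝ} (hx : x ∈ Icc (0 : ℝ) 1)
    (hy : y ∈ Icc (0 : ℝ) 1) : ‖w y‖ ≤ exp C * ‖w x‖ := by
  have key : ∀ (v v' : ℝ → E), DerivOn v v' → (∀ x ∈ Icc (0 : ℝ) 1, ‖v' x‖ ≤ C * ‖v x‖) →
      ∀ x ∈ Icc (0 : ℝ) 1, ∀ y ∈ Icc x 1, ‖v y‖ ≤ exp C * ‖v x‖ := by
    intro v v' hv hb x hx y hy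
    have := norm_le_gronwallBound_of_norm_deriv_right_le (f' := v') (K := C) (ε := 0)
      (hv.continuousOn.mono (Icc_subset_Icc_left hx.1))
      (fun z hz => hv.hasDerivWithinAt_Ici ⟨hx.1.trans hz.1, hz.2⟩) le_rfl
      (fun z hz => by simpa using hb z ⟨hx.1.trans hz.1, hz.2.le⟩) y hy
    rw [gronwallBound_ε0, mul_comm] at this
    refine this.trans ?_
    gcongr
    exact mul_le_of_le_one_right hC0 (by linarith [hx.1, hy.2])
  rcases le_total x y with h1 | h1
  · exact key w w' h hC x hx y ⟨h1, hy.2⟩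
  · have := key _ _ h.reflect (fun z hz => by
      rw [norm_neg]
      exact hC (1 - z) ⟨by linarith [hz.2], by linarith [hz.1]⟩) (1 - x)
      ⟨by linarith [hx.2], by linarith [hx.1]⟩ (1 - y) ⟨by linarith, by linarith [hy.1]⟩
    simpa using this

theorem DerivOn.eq_zero {C : ℝ} (h : DerivOn w w')
    (hC : ∀ x ∈ Icc (0 : ℝ) 1, ‖w' x‖ ≤ C * ‖w x‖) {x₀ : ℝ} (hx₀ : x₀ ∈ Icc (0 : ℝ) 1)
    (h₀ : w x₀ = 0) : ∀ x ∈ Icc (0 : ℝ) 1, w x = 0 := by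
  intro x hx
  have := h.norm_le (C := max C 0) (le_max_right _ _) (fun x hx => (hC x hx).trans
    (mul_le_mul_of_nonneg_right (le_max_left _ _) (norm_nonneg _))) hx₀ hx
  rwa [h₀, norm_zero, mul_zero, norm_le_zero_iff] at this

theorem DerivOn.monotoneOn {w w' : ℝ → ℝ} (h : DerivOn w w')
    (hw : ∀ x ∈ Icc (0 : ℝ) 1, 0 ≤ w' x) : MonotoneOn w (Icc 0 1) :=
  monotoneOn_of_hasDerivWithinAt_nonneg (convex_Icc 0 1) h.continuousOn
    (fun x hx => (h x (interior_subset hx)).mono interior_subset)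
    (fun x hx => hw x (interior_subset hx))

theorem exists_derivOn {g : ℝ → ℝ} (hg : ContinuousOn g (Icc 0 1)) :
    ∃ G : ℝ → ℝ, G 0 = 0 ∧ DerivOn G g := by
  have hc : Continuous (IccExtend (zero_le_one (α := ℝ)) ((Icc 0 1).domRestrict g)) :=
    (continuousOn_iff_continuous_domRestrict.1 hg).Icc_extend'
  refine ⟨fun x => ∫ t in (0 : ℝ)..x, IccExtend (zero_le_one (α := ℝ)) ((Icc 0 1).domRestrict g) t,
    by simp, fun x hx => ?_⟩
  have := (hc.integral_hasStrictDerivAt 0 x).hasDerivAt.hasDerivWithinAt (s := Icc (0 : ℝ) 1)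
  rwa [IccExtend_of_mem _ _ hx] at this

/-- Global existence for bounded Lipschitz vector fields. -/
theorem exists_solution [CompleteSpace E] (F : ℝ → E → E) (K L : NNReal)
    (hK : ∀ t ∈ Icc (0 : ℝ) 1, LipschitzWith K (F t))
    (hc : ∀ y, ContinuousOn (fun t => F t y) (Icc 0 1))
    (hL : ∀ t ∈ Icc (0 : ℝ) 1, ∀ y, ‖F t y‖ ≤ L) (y₀ : E) :
    ∃ α : ℝ → E, α 0 = y₀ ∧ DerivOn α (fun t => F t (α t)) := by
  have : IsPicardLindelof F (tmin := 0) (tmax := 1) ⟨0, by simp⟩ y₀ L 0 L K :=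
    { lipschitzOnWith := fun t ht => (hK t ht).lipschitzOnWith
      continuousOn := fun y _ => hc y
      norm_le := fun t ht y _ => hL t ht y
      mul_max_le := by simp }
  exact this.exists_eq_forall_mem_Icc_hasDerivWithinAt₀

/-- Comparison of a sub- and a supersolution of a scalar equation `θ' = F(x,θ)`. -/
theorem comparison {F : ℝ → ℝ → ℝ} {K : ℝ}
    (hF : ∀ x ∈ Icc (0 : ℝ) 1, ∀ s t, |F x s - F x t| ≤ K * |s - t|)
    {θ₁ g₁ θ₂ g₂ : ℝ → ℝ} (h₁ : DerivOn θ₁ g₁) (h₂ : DerivOn θ₂ g₂)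
    (hg₁ : ∀ x ∈ Icc (0 : ℝ) 1, g₁ x ≤ F x (θ₁ x))
    (hg₂ : ∀ x ∈ Icc (0 : ℝ) 1, F x (θ₂ x) ≤ g₂ x) (h0 : θ₁ 0 ≤ θ₂ 0) :
    (∀ x ∈ Icc (0 : ℝ) 1, θ₁ x ≤ θ₂ x) ∧
      MonotoneOn (fun x => exp (K * x) * (θ₂ x - θ₁ x)) (Icc 0 1) := by
  have hle : ∀ x ∈ Icc (0 : ℝ) 1, θ₁ x ≤ θ₂ x := by
    -- A strict supersolution is obtained by adding a small, rapidly growing exponential.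
    have key : ∀ ε > 0, ∀ x ∈ Icc (0 : ℝ) 1, θ₁ x ≤ θ₂ x + ε * exp ((K + 1) * x) := by
      intro ε hε
      have hB : DerivOn (fun x => θ₂ x + ε * exp ((K + 1) * x))
          (fun x => g₂ x + ε * (exp ((K + 1) * x) * (K + 1))) := by
        intro x hx
        have h3 : HasDerivWithinAt (fun y : ℝ => (K + 1) * y) (K + 1) (Icc 0 1) x := by
          simpa using (hasDerivWithinAt_id x (Icc (0 : ℝ) 1)).const_mul (K + 1)
        exact (h₂ x hx).add (h3.exp.const_mul ε)
      refine fun x hx => image_le_of_deriv_right_lt_deriv_boundary' h₁.continuousOn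
        (fun x hx => h₁.hasDerivWithinAt_Ici hx) ?_ hB.continuousOn
        (fun x hx => hB.hasDerivWithinAt_Ici hx) ?_ hx
      · simp only [mul_zero, exp_zero]
        linarith
      · intro x hx he
        have hx' := Ico_subset_Icc_self hx
        have h3 := abs_le.1 (hF x hx' (θ₁ x) (θ₂ x))
        have h4 : |θ₁ x - θ₂ x| = ε * exp ((K + 1) * x) := by
          rw [he, add_sub_cancel_left, abs_of_pos (by positivity)]
        rw [h4] at h3
        have h5 : 0 < ε * exp ((K + 1) * x) := by positivity
        have := hg₁ x hx'
        have := hg₂ x hx'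
        nlinarith [h3.2]
    intro x hx
    refine le_of_forall_pos_le_add fun ε hε => ?_
    have := key (ε / exp ((K + 1) * x)) (by positivity) x hx
    rwa [div_mul_cancel₀ _ (exp_pos _).ne'] at this
  refine ⟨hle, ?_⟩
  have hd : DerivOn (fun x => exp (K * x) * (θ₂ x - θ₁ x))
      (fun x => exp (K * x) * K * (θ₂ x - θ₁ x) + exp (K * x) * (g₂ x - g₁ x)) := by
    intro x hx
    have h3 : HasDerivWithinAt (fun y : ℝ => K * y) K (Icc 0 1) x := by
      simpa using (hasDerivWithinAt_id x (Icc (0 : ℝ) 1)).const_mul K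
    exact h3.exp.mul ((h₂ x hx).sub (h₁ x hx))
  refine hd.monotoneOn fun x hx => ?_
  have h3 := abs_le.1 (hF x hx (θ₂ x) (θ₁ x))
  rw [abs_of_nonneg (sub_nonneg.2 (hle x hx))] at h3
  have := hg₁ x hx
  have := hg₂ x hx
  have h4 : 0 ≤ exp (K * x) * (K * (θ₂ x - θ₁ x) + (g₂ x - g₁ x)) :=
    mul_nonneg (exp_pos _).le (by linarith [h3.1])
  linarith

end Calculus

/-! ### Prüfer angles -/

/-- The Prüfer equation for the angle `θ` of `w = A cos θ`, `w' = A sin θ`, where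
`w'' + b w' + c w = 0`, is `θ' = pruferField b c x θ`. -/
noncomputable def pruferField (b c : ℝ → ℝ) (x θ : ℝ) : ℝ :=
  -sin θ ^ 2 - cos θ * (b x * sin θ + c x * cos θ)

theorem abs_pruferField_sub_le {b c : ℝ → ℝ} {C x : ℝ} (hb : |b x| ≤ C) (hc : |c x| ≤ C)
    (s t : ℝ) : |pruferField b c x s - pruferField b c x t| ≤ (2 + 4 * C) * |s - t| := by
  have h1 := abs_sin_sub_sin_le s t
  have h2 := abs_cos_sub_cos_le s t
  have hprod : ∀ a a' d d' : ℝ, |a| ≤ 1 → |d'| ≤ 1 → |a - a'| ≤ |s - t| → |d - d'| ≤ |s - t| →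
      |a * d - a' * d'| ≤ 2 * |s - t| := by
    intro a a' d d' ha hd' h3 h4
    have : a * d - a' * d' = a * (d - d') + (a - a') * d' := by ring
    rw [this]
    calc |a * (d - d') + (a - a') * d'| ≤ |a * (d - d')| + |(a - a') * d'| := abs_add_le _ _
      _ = |a| * |d - d'| + |a - a'| * |d'| := by rw [abs_mul, abs_mul]
      _ ≤ 1 * |s - t| + |s - t| * 1 := by gcongr
      _ = 2 * |s - t| := by ring
  have hss := hprod _ _ _ _ (abs_sin_le_one s) (abs_sin_le_one t) h1 h1
  have hcs := hprod _ _ _ _ (abs_cos_le_one s) (abs_sin_le_one t) h2 h1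
  have hcc := hprod _ _ _ _ (abs_cos_le_one s) (abs_cos_le_one t) h2 h2
  have : pruferField b c x s - pruferField b c x t = -(sin s * sin s - sin t * sin t)
      - b x * (cos s * sin s - cos t * sin t) - c x * (cos s * cos s - cos t * cos t) := by
    unfold pruferField
    ring
  rw [this]
  have hC : 0 ≤ C := (abs_nonneg _).trans hb
  calc |-(sin s * sin s - sin t * sin t) - b x * (cos s * sin s - cos t * sin t)
        - c x * (cos s * cos s - cos t * cos t)|
      ≤ |-(sin s * sin s - sin t * sin t)| + |b x * (cos s * sin s - cos t * sin t)|
        + |c x * (cos s * cos s - cos t * cos t)| :=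
        (abs_sub _ _).trans (add_le_add_left (abs_sub _ _) _)
    _ = |sin s * sin s - sin t * sin t| + |b x| * |cos s * sin s - cos t * sin t|
        + |c x| * |cos s * cos s - cos t * cos t| := by rw [abs_neg, abs_mul, abs_mul]
    _ ≤ 2 * |s - t| + C * (2 * |s - t|) + C * (2 * |s - t|) := by gcongr
    _ = (2 + 4 * C) * |s - t| := by ring

theorem exists_bound {b c : ℝ → ℝ} (hb : ContinuousOn b (Icc 0 1))
    (hc : ContinuousOn c (Icc 0 1)) :
    ∃ C, 0 ≤ C ∧ ∀ x ∈ Icc (0 : ℝ) 1, |b x| ≤ C ∧ |c x| ≤ C := by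
  obtain ⟨B, hB⟩ := isCompact_Icc.exists_bound_of_continuousOn hb
  obtain ⟨D, hD⟩ := isCompact_Icc.exists_bound_of_continuousOn hc
  refine ⟨max 0 (max B D), le_max_left _ _, fun x hx => ⟨(hB x hx).trans ?_, (hD x hx).trans ?_⟩⟩
  · exact (le_max_left _ _).trans (le_max_right _ _)
  · exact (le_max_right _ _).trans (le_max_right _ _)

/-- `θ` is a solution of the Prüfer equation with `θ(0) = 0`. -/
def IsPruferAngle (b c θ : ℝ → ℝ) : Prop :=
  θ 0 = 0 ∧ DerivOn θ (fun x => pruferField b c x (θ x))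

theorem exists_pruferAngle {b c : ℝ → ℝ} (hb : ContinuousOn b (Icc 0 1))
    (hc : ContinuousOn c (Icc 0 1)) : ∃ θ, IsPruferAngle b c θ := by
  obtain ⟨C, hC0, hC⟩ := exists_bound hb hc
  refine exists_solution (pruferField b c) ⟨2 + 4 * C, by positivity⟩ ⟨1 + 2 * C, by positivity⟩
    (fun t ht => LipschitzWith.of_dist_le_mul fun x y => ?_) (fun y => ?_) (fun t ht y => ?_) 0
  · exact abs_pruferField_sub_le (hC t ht).1 (hC t ht).2 x y
  · unfold pruferField
    fun_prop
  · have h1 := abs_le.1 (hC t ht).1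
    have h2 := abs_le.1 (hC t ht).2
    have h3 : |b t * (cos y * sin y)| ≤ C * 1 := by
      rw [abs_mul]
      have : |cos y * sin y| ≤ 1 := by
        rw [abs_mul]
        exact mul_le_one₀ (abs_cos_le_one y) (abs_nonneg _) (abs_sin_le_one y)
      gcongr
      exact (hC t ht).1
    have h4 : |c t * (cos y ^ 2)| ≤ C * 1 := by
      rw [abs_mul, abs_of_nonneg (sq_nonneg (cos y))]
      gcongr
      · exact (hC t ht).2
      · exact cos_sq_le_one y
    have h5 := sin_sq_le_one y
    have h6 := sq_nonneg (sin y)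
    have h3 := abs_le.1 h3
    have h4 := abs_le.1 h4
    change |pruferField b c t y| ≤ 1 + 2 * C
    unfold pruferField
    rw [abs_le]
    constructor <;> nlinarith [h3.1, h3.2, h4.1, h4.2]

/-- Polar coordinates for a curve `(w, w')` which avoids the origin. -/
theorem exists_angle {w w₁ w₂ : ℝ → ℝ} (h₁ : DerivOn w w₁) (h₂ : DerivOn w₁ w₂)
    (hc : ContinuousOn w₂ (Icc 0 1)) (hpos : 0 < w 0) (h0 : w₁ 0 = 0)
    (hne : ∀ x ∈ Icc (0 : ℝ) 1, 0 < w x ^ 2 + w₁ x ^ 2) :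
    ∃ θ A : ℝ → ℝ, θ 0 = 0 ∧
      (∀ x ∈ Icc (0 : ℝ) 1, 0 < A x ∧ w x = A x * cos (θ x) ∧ w₁ x = A x * sin (θ x)) ∧
      DerivOn θ (fun x => -sin (θ x) ^ 2 + cos (θ x) * (w₂ x / A x)) := by
  have hcw := h₁.continuousOn
  have hcw₁ := h₂.continuousOn
  have hne' : ∀ x ∈ Icc (0 : ℝ) 1, w x ^ 2 + w₁ x ^ 2 ≠ 0 := fun x hx => (hne x hx).ne'
  set g : ℝ → ℝ := fun x => (w x * w₂ x - w₁ x ^ 2) / (w x ^ 2 + w₁ x ^ 2) with hg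
  set μ : ℝ → ℝ := fun x => (w x * w₁ x + w₁ x * w₂ x) / (w x ^ 2 + w₁ x ^ 2) with hμ
  have hgc : ContinuousOn g (Icc 0 1) := by
    refine ContinuousOn.div (by fun_prop) (by fun_prop) hne'
  have hμc : ContinuousOn μ (Icc 0 1) := by
    refine ContinuousOn.div (by fun_prop) (by fun_prop) hne'
  obtain ⟨θ, hθ0, hθ⟩ := exists_derivOn hgc
  -- The coordinates in the frame which rotates by `θ`; the second one vanishes identically.
  set A : ℝ → ℝ := fun x => w x * cos (θ x) + w₁ x * sin (θ x) with hA
  set D : ℝ → ℝ := fun x => w₁ x * cos (θ x) - w x * sin (θ x) with hD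
  have hw₁ : ∀ x ∈ Icc (0 : ℝ) 1, w₁ x = μ x * w x - g x * w₁ x := by
    intro x hx
    have := hne' x hx
    simp only [hμ, hg]
    field_simp
    ring
  have hw₂ : ∀ x ∈ Icc (0 : ℝ) 1, w₂ x = μ x * w₁ x + g x * w x := by
    intro x hx
    have := hne' x hx
    simp only [hμ, hg]
    field_simp
    ring
  have hD' : DerivOn D (fun x => μ x * D x) := by
    intro x hx
    have h3 := ((h₂ x hx).mul (hθ x hx).cos).sub ((h₁ x hx).mul (hθ x hx).sin)
    refine h3.congr_deriv ?_
    simp only [hD]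
    linear_combination (cos (θ x)) * hw₂ x hx - sin (θ x) * hw₁ x hx
  obtain ⟨M, hM⟩ := isCompact_Icc.exists_bound_of_continuousOn hμc
  have hD0 : ∀ x ∈ Icc (0 : ℝ) 1, D x = 0 := by
    refine hD'.eq_zero (C := M) (fun x hx => ?_) (x₀ := 0) (by simp) (by simp [hD, h0, hθ0])
    rw [norm_mul]
    exact mul_le_mul_of_nonneg_right (hM x hx) (norm_nonneg _)
  have hsc := fun x => sin_sq_add_cos_sq (θ x)
  have hAw : ∀ x ∈ Icc (0 : ℝ) 1, w x = A x * cos (θ x) ∧ w₁ x = A x * sin (θ x) := by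
    intro x hx
    have h3 := hD0 x hx
    simp only [hD] at h3
    simp only [hA]
    constructor
    · linear_combination (-w x) * hsc x + (-sin (θ x)) * h3
    · linear_combination (-w₁ x) * hsc x + (cos (θ x)) * h3
  have hA2 : ∀ x ∈ Icc (0 : ℝ) 1, A x ^ 2 = w x ^ 2 + w₁ x ^ 2 := by
    intro x hx
    rw [(hAw x hx).1, (hAw x hx).2]
    linear_combination (-A x ^ 2) * hsc x
  have hA0 : 0 < A 0 := by
    simp only [hA, hθ0, h0, cos_zero, sin_zero]
    linarith
  have hcA : ContinuousOn A (Icc 0 1) := by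
    have := hθ.continuousOn
    fun_prop
  have hApos : ∀ x ∈ Icc (0 : ℝ) 1, 0 < A x := by
    intro x hx
    by_contra hcon
    have := intermediate_value_Icc' hx.1 (hcA.mono (Icc_subset_Icc_right hx.2))
      ⟨not_lt.1 hcon, hA0.le⟩
    obtain ⟨y, hy, hy0⟩ := this
    have h3 := hA2 y ⟨hy.1, hy.2.trans hx.2⟩
    have h4 := hne y ⟨hy.1, hy.2.trans hx.2⟩
    rw [hy0] at h3
    linarith
  refine ⟨θ, A, hθ0, fun x hx => ⟨hApos x hx, hAw x hx⟩, fun x hx => ?_⟩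
  refine (hθ x hx).congr_deriv ?_
  have h3 := hApos x hx
  have h4 := (hApos x hx).ne'
  simp only [hg]
  rw [← hA2 x hx]
  obtain ⟨h5, h6⟩ := hAw x hx
  rw [h5, h6]
  field_simp
  ring

theorem angle_deriv_eq (b c : ℝ → ℝ) (x w₂ : ℝ) {w w₁ θ A : ℝ} (hA : 0 < A)
    (hw : w = A * cos θ) (hw₁ : w₁ = A * sin θ) :
    -sin θ ^ 2 + cos θ * (w₂ / A) = pruferField b c x θ
      + cos θ * ((w₂ + b x * w₁ + c x * w) / A) := by
  have := hA.ne'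
  rw [hw, hw₁]
  unfold pruferField
  field_simp
  ring

/-- Angles depend continuously on the equation, by Gronwall's inequality. -/
theorem angle_stable {b c w w₁ w₂ θ A η : ℝ → ℝ} {C ε : ℝ} (hC0 : 0 ≤ C)
    (hC : ∀ x ∈ Icc (0 : ℝ) 1, |b x| ≤ C ∧ |c x| ≤ C)
    (hA : ∀ x ∈ Icc (0 : ℝ) 1, 0 < A x ∧ w x = A x * cos (θ x) ∧ w₁ x = A x * sin (θ x))
    (hθ0 : θ 0 = 0) (hθ : DerivOn θ (fun x => -sin (θ x) ^ 2 + cos (θ x) * (w₂ x / A x)))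
    (hη : IsPruferAngle b c η)
    (hε : ∀ x ∈ Icc (0 : ℝ) 1, |w₂ x + b x * w₁ x + c x * w x| ≤ ε * A x) :
    |θ 1 - η 1| ≤ ε * exp (2 + 4 * C) := by
  have h := dist_le_of_approx_trajectories_ODE_of_mem (v := pruferField b c)
    (s := fun _ => univ) (K := ⟨2 + 4 * C, by positivity⟩) (a := 0) (b := 1) (δ := 0) (εf := ε)
    (εg := 0)
    (fun t ht => (LipschitzWith.of_dist_le_mul fun x y =>
      abs_pruferField_sub_le (hC t (Ico_subset_Icc_self ht)).1
        (hC t (Ico_subset_Icc_self ht)).2 x y).lipschitzOnWith)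
    hθ.continuousOn (fun t ht => hθ.hasDerivWithinAt_Ici ht) (fun t ht => ?_)
    (fun _ _ => mem_univ _) hη.2.continuousOn (fun t ht => hη.2.hasDerivWithinAt_Ici ht)
    (fun t ht => by simp) (fun _ _ => mem_univ _) (by rw [hθ0, hη.1]; simp) 1 (by simp)
  · rw [Real.dist_eq, gronwallBound_of_K_ne_0 (by change (2 + 4 * C) ≠ 0; positivity)] at h
    refine h.trans ?_
    change 0 * _ + (ε + 0) / (2 + 4 * C) * (exp ((2 + 4 * C) * (1 - 0)) - 1) ≤ _
    have hε0 : 0 ≤ ε := by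
      have h1 := hA 0 (by simp)
      have h2 := (abs_nonneg _).trans (hε 0 (by simp))
      by_contra hneg
      nlinarith [h1.1]
    simp only [zero_mul, zero_add, add_zero, sub_zero, mul_one]
    refine mul_le_mul (div_le_self hε0 (by linarith)) (by linarith)
      (by linarith [add_one_le_exp (2 + 4 * C)]) hε0
  · have ht' := Ico_subset_Icc_self ht
    obtain ⟨h1, h2, h3⟩ := hA t ht'
    rw [Real.dist_eq, angle_deriv_eq b c t (w₂ t) h1 h2 h3, add_sub_cancel_left, abs_mul,
      abs_div, abs_of_pos h1]
    calc |cos (θ t)| * (|w₂ t + b t * w₁ t + c t * w t| / A t)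
        ≤ 1 * (ε * A t / A t) := by
          gcongr
          · exact abs_cos_le_one _
          · exact hε t ht'
      _ = ε := by field_simp

/-- Angles can cross the zeros `θ = π/2 + mπ` of `cos θ` only downwards. -/
theorem angle_le_of_le {θ θ' : ℝ → ℝ} (hθ : DerivOn θ θ')
    (hneg : ∀ x ∈ Icc (0 : ℝ) 1, cos (θ x) = 0 → θ' x < 0) (m : ℤ) {x y : ℝ}
    (hx : x ∈ Icc (0 : ℝ) 1) (hy : y ∈ Icc (0 : ℝ) 1) (hxy : x ≤ y)
    (h : θ x ≤ π / 2 + m * π) : θ y ≤ π / 2 + m * π := by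
  refine image_le_of_deriv_right_lt_deriv_boundary (a := x) (b := y) (f := θ) (f' := θ')
    (B := fun _ => π / 2 + m * π) (B' := fun _ => 0)
    (hθ.continuousOn.mono (Icc_subset_Icc hx.1 hy.2))
    (fun z hz => hθ.hasDerivWithinAt_Ici ⟨hx.1.trans hz.1, hz.2.trans_le hy.2⟩) h
    (fun z => hasDerivAt_const _ _) (fun z hz he => ?_) ⟨hxy, le_rfl⟩
  refine hneg z ⟨hx.1.trans hz.1, hz.2.le.trans hy.2⟩ ?_
  rw [he, cos_add_int_mul_pi, cos_pi_div_two, mul_zero]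

theorem angle_deriv_neg {θ s : ℝ} (h : cos θ = 0) : -sin θ ^ 2 + cos θ * s < 0 := by
  have := sin_sq_add_cos_sq θ
  rw [h] at this ⊢
  nlinarith

theorem cos_sign {θ : ℝ} {m : ℤ} (h1 : -(π / 2) - m * π < θ) (h2 : θ < π / 2 - m * π) :
    0 < (-1 : ℝ) ^ m * cos θ := by
  have h3 : 0 < cos (θ + m * π) :=
    cos_pos_of_mem_Ioo ⟨by linarith, by linarith⟩
  rwa [cos_add_int_mul_pi] at h3

theorem exists_int_angle {θ : ℝ} (h : cos θ ≠ 0) :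
    ∃ m : ℤ, -(π / 2) - m * π < θ ∧ θ < π / 2 - m * π := by
  have hpi := pi_pos
  refine ⟨-⌊θ / π + 1 / 2⌋, ?_, ?_⟩
  · have h1 := Int.floor_le (θ / π + 1 / 2)
    have h2 : (⌊θ / π + 1 / 2⌋ : ℝ) ≠ θ / π + 1 / 2 := by
      intro h3
      apply h
      rw [cos_eq_zero_iff]
      refine ⟨⌊θ / π + 1 / 2⌋ - 1, ?_⟩
      push_cast
      have : θ = (⌊θ / π + 1 / 2⌋ - 1 / 2) * π := by
        rw [h3]
        field_simp
        ring
      linarith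
    have h3 := lt_of_le_of_ne h1 h2
    have h4 : (⌊θ / π + 1 / 2⌋ : ℝ) * π < (θ / π + 1 / 2) * π := by gcongr
    have h5 : (θ / π + 1 / 2) * π = θ + π / 2 := by field_simp
    push_cast
    linarith
  · have h1 := Int.lt_floor_add_one (θ / π + 1 / 2)
    have h4 : (θ / π + 1 / 2) * π < (⌊θ / π + 1 / 2⌋ + 1) * π := by gcongr
    have h5 : (θ / π + 1 / 2) * π = θ + π / 2 := by field_simp
    push_cast
    linarith

theorem zeroNumber_eq {φ : unitInterval → ℝ} {m : ℕ} (h : HasSignChanges φ m)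
    (h' : ∀ k, HasSignChanges φ k → k ≤ m) : zeroNumber φ = m :=
  le_antisymm (iSup₂_le fun k hk => by exact_mod_cast h' k hk) (le_iSup₂ (f := fun (k : ℕ)
    (_ : HasSignChanges φ k) => (k : ℕ∞)) m h)

/-- The zero number counts the half-turns of the angle. -/
theorem zeroNumber_of_angle {θ θ' A : ℝ → ℝ} {φ : unitInterval → ℝ} (hθ : DerivOn θ θ')
    (hneg : ∀ x ∈ Icc (0 : ℝ) 1, cos (θ x) = 0 → θ' x < 0) (h0 : θ 0 = 0)
    (hA : ∀ x ∈ Icc (0 : ℝ) 1, 0 < A x) (hφ : ∀ x : unitInterval, φ x = A x * cos (θ x)) {k : ℕ}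
    (hk : θ 1 = -(k * π)) : zeroNumber φ = k := by
  have hpi := pi_pos
  apply zeroNumber_eq
  · have hex : ∀ i : Fin (k + 1), ∃ x : unitInterval, θ x = -((i : ℕ) * π) := by
      intro i
      have : -((i : ℕ) * π) ∈ Icc (θ 1) (θ 0) := by
        rw [h0, hk]
        have : ((i : ℕ) : ℝ) ≤ k := by exact_mod_cast Nat.lt_succ_iff.1 i.2
        constructor
        · have : (i : ℕ) * π ≤ k * π := by gcongr
          linarith
        · have : 0 ≤ (i : ℕ) * π := by positivity
          linarith
      obtain ⟨x, hx, hx'⟩ := intermediate_value_Icc' zero_le_one hθ.continuousOn this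
      exact ⟨⟨x, hx⟩, hx'⟩
    choose x hx using hex
    refine ⟨x, Fin.strictMono_iff_lt_succ.2 fun i => ?_, fun i => ?_⟩
    · by_contra hcon
      have h1 := angle_le_of_le hθ hneg (-(i : ℤ) - 1) (x i.succ).2 (x i.castSucc).2
        (not_lt.1 hcon)
      rw [hx, hx] at h1
      simp only [Fin.val_succ, Fin.val_castSucc] at h1
      push_cast at h1
      have := h1 (by nlinarith)
      nlinarith
    · have hs : ∀ j : ℕ, cos (-(j * π)) = (-1) ^ j := by
        intro j
        rw [cos_neg]
        exact_mod_cast cos_nat_mul_pi j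
      rw [hφ, hφ, hx, hx, hs, hs, Fin.val_succ, Fin.val_castSucc, pow_succ]
      have h1 := hA _ (x i.castSucc).2
      have h2 := hA _ (x i.succ).2
      have h3 : ((-1 : ℝ) ^ (i : ℕ)) * (-1) ^ (i : ℕ) = 1 := by
        rw [← mul_pow]
        simp
      have h4 : A (x i.castSucc) * (-1) ^ (i : ℕ) * (A (x i.succ) * ((-1) ^ (i : ℕ) * -1))
          = -(A (x i.castSucc) * A (x i.succ)) * (((-1 : ℝ) ^ (i : ℕ)) * (-1) ^ (i : ℕ)) := by ring
      rw [h4, h3]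
      nlinarith [mul_pos h1 h2]
  · intro M ⟨x, hx, hM⟩
    have hcos : ∀ y ∈ Icc (0 : ℝ) 1, ∀ z ∈ Icc (0 : ℝ) 1, ∀ m l : ℤ, y ≤ z →
        (-(π / 2) - m * π < θ y ∧ θ y < π / 2 - m * π) →
        (-(π / 2) - l * π < θ z ∧ θ z < π / 2 - l * π) → m ≤ l := by
      intro y hy z hz m l hyz h1 h2
      have h3 := angle_le_of_le hθ hneg (-m) hy hz hyz (by push_cast; linarith [h1.2])
      push_cast at h3
      have h4 : (m : ℝ) * π < (l + 1) * π := by linarith [h2.1]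
      have h5 := lt_of_mul_lt_mul_right h4 hpi.le
      have : m < l + 1 := by exact_mod_cast h5
      lia
    rcases Nat.eq_zero_or_pos M with rfl | hMpos
    · exact Nat.zero_le _
    have hne : ∀ i, φ (x i) ≠ 0 := by
      intro i
      rcases Fin.eq_castSucc_or_eq_last i with ⟨j, rfl⟩ | rfl
      · exact left_ne_zero_of_mul (hM j).ne
      · have := right_ne_zero_of_mul (hM ⟨M - 1, by lia⟩).ne
        convert this using 3
        ext
        simp
        lia
    have hex : ∀ i, ∃ m : ℤ, -(π / 2) - m * π < θ (x i) ∧ θ (x i) < π / 2 - m * π :=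
      fun i => exists_int_angle fun h1 => hne i (by rw [hφ, h1, mul_zero])
    choose m hm using hex
    have hstep : ∀ i : Fin M, m i.castSucc + 1 ≤ m i.succ := by
      intro i
      have h1 := hcos _ (x i.castSucc).2 _ (x i.succ).2 _ _
        (hx (Fin.castSucc_lt_succ (i := i))).le (hm _) (hm _)
      refine Int.add_one_le_iff.2 (h1.lt_of_ne fun h2 => ?_)
      have h3 := cos_sign (hm i.castSucc).1 (hm i.castSucc).2
      have h4 := cos_sign (hm i.succ).1 (hm i.succ).2
      rw [← h2] at h4
      have h5 := mul_pos h3 h4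
      have h6 : ((-1 : ℝ) ^ m i.castSucc) * (-1) ^ m i.castSucc = 1 := by
        rw [← mul_zpow]
        simp
      have h7 := hM i
      rw [hφ, hφ] at h7
      have h8 : 0 < cos (θ (x i.castSucc)) * cos (θ (x i.succ)) := by
        calc 0 < _ := h5
          _ = ((-1 : ℝ) ^ m i.castSucc * (-1) ^ m i.castSucc)
            * (cos (θ (x i.castSucc)) * cos (θ (x i.succ))) := by ring
          _ = _ := by rw [h6, one_mul]
      have h9 := mul_pos (hA _ (x i.castSucc).2) (hA _ (x i.succ).2)
      nlinarith [mul_pos h9 h8]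
    have hlow : ∀ i : Fin (M + 1), ((i : ℕ) : ℤ) ≤ m i := by
      intro i
      induction i using Fin.induction with
      | zero =>
        have := hcos 0 (by simp) _ (x 0).2 0 (m 0) (x 0).2.1
          (by rw [h0]; constructor <;> simp [hpi]) (hm 0)
        simpa using this
      | succ i ih =>
        have := hstep i
        simp only [Fin.val_succ, Fin.val_castSucc] at ih ⊢
        push_cast
        lia
    have hlast := hlow (Fin.last M)
    have := hcos _ (x (Fin.last M)).2 1 (by simp) _ k (x (Fin.last M)).2.2 (hm _)
      (by rw [hk]; push_cast; constructor <;> linarith)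
    simp only [Fin.val_last] at hlast
    lia

/-! ### Linear equations, eigenvalues and reflection -/

/-- `(φ, φ')` solves `φ'' + b φ' + c φ = 0` with Neumann boundary conditions. -/
def IsLinearNeumann (b c φ φ₁ : ℝ → ℝ) : Prop :=
  DerivOn φ φ₁ ∧ DerivOn φ₁ (fun x => -(b x * φ₁ x + c x * φ x)) ∧ φ₁ 0 = 0 ∧ φ₁ 1 = 0

theorem IsPruferAngle.le {b c θ : ℝ → ℝ} (h : IsPruferAngle b c θ) : θ 1 ≤ π / 2 := by
  have := angle_le_of_le h.2 (fun x _ hx => ?_) 0 (x := 0) (y := 1) (by simp) (by simp) (by simp)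
    (by rw [h.1]; simp; positivity)
  · simpa using this
  · have := angle_deriv_neg (s := -(b x * sin (θ x) + c x * cos (θ x))) hx
    unfold pruferField
    linarith

theorem exists_nat_of_sin_eq_zero {t : ℝ} (h : sin t = 0) (ht : t ≤ π / 2) :
    ∃ k : ℕ, t = -(k * π) := by
  obtain ⟨m, hm⟩ := sin_eq_zero_iff.1 h
  have hpi := pi_pos
  have : (m : ℝ) < 1 := by
    by_contra hcon
    nlinarith
  have : m < 1 := by exact_mod_cast this
  obtain ⟨k, hk⟩ := Int.eq_ofNat_of_zero_le (show 0 ≤ -m by lia)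
  refine ⟨k, ?_⟩
  rw [← hm, show m = -(k : ℤ) by lia]
  push_cast
  ring

theorem exists_int_of_sin_ne_zero {t : ℝ} (h : sin t ≠ 0) :
    ∃ m : ℤ, m * π < t ∧ t < (m + 1) * π := by
  have hpi := pi_pos
  refine ⟨⌊t / π⌋, ?_, ?_⟩
  · refine lt_of_le_of_ne ((le_div_iff₀ hpi).1 (Int.floor_le _)) fun he => h ?_
    rw [← he]
    exact sin_int_mul_pi _
  · exact (div_lt_iff₀ hpi).1 (Int.lt_floor_add_one _)

theorem exists_nat_of_sin_ne_zero {t : ℝ} (h : sin t ≠ 0) (ht : t ≤ π / 2) :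
    ∃ r : ℕ, -(r * π) < t ∧ t < (1 - r) * π := by
  obtain ⟨m, h1, h2⟩ := exists_int_of_sin_ne_zero h
  have hpi := pi_pos
  have : (m : ℝ) < 1 := by
    by_contra hcon
    nlinarith
  have : m < 1 := by exact_mod_cast this
  obtain ⟨k, hk⟩ := Int.eq_ofNat_of_zero_le (show 0 ≤ -m by lia)
  refine ⟨k, ?_, ?_⟩
  · rw [show m = -(k : ℤ) by lia] at h1
    push_cast at h1
    linarith
  · rw [show m = -(k : ℤ) by lia] at h2
    push_cast at h2
    linarith

theorem sq_add_sq_pos {a b : ℝ} (h : a = 0 → b ≠ 0) : 0 < a ^ 2 + b ^ 2 := by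
  by_cases ha : a = 0
  · have := sq_pos_of_ne_zero (h ha)
    positivity
  · have := sq_pos_of_ne_zero ha
    positivity

theorem norm_linear_le {b c C p u : ℝ} (hb : |b| ≤ C) (hc : |c| ≤ C) :
    ‖((p, -(b * p + c * u)) : ℝ × ℝ)‖ ≤ (1 + 2 * C) * ‖((u, p) : ℝ × ℝ)‖ := by
  have hC : 0 ≤ C := (abs_nonneg _).trans hb
  have h1 : |u| ≤ ‖((u, p) : ℝ × ℝ)‖ := norm_fst_le (u, p)
  have h2 : |p| ≤ ‖((u, p) : ℝ × ℝ)‖ := norm_snd_le (u, p)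
  set N := ‖((u, p) : ℝ × ℝ)‖
  have hN : 0 ≤ N := (abs_nonneg _).trans h1
  refine max_le ?_ ?_
  · change |p| ≤ _
    nlinarith
  · change |-(b * p + c * u)| ≤ _
    rw [abs_neg]
    calc |b * p + c * u| ≤ |b * p| + |c * u| := abs_add_le _ _
      _ = |b| * |p| + |c| * |u| := by rw [abs_mul, abs_mul]
      _ ≤ C * N + C * N := by gcongr
      _ ≤ (1 + 2 * C) * N := by linarith

/-- Uniqueness for the initial value problem. -/
theorem IsLinearNeumann.eq_zero {b c φ φ₁ : ℝ → ℝ} (hb : ContinuousOn b (Icc 0 1))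
    (hc : ContinuousOn c (Icc 0 1)) (h : IsLinearNeumann b c φ φ₁) {x₀ : ℝ}
    (hx₀ : x₀ ∈ Icc (0 : ℝ) 1) (h0 : φ x₀ = 0) (h1 : φ₁ x₀ = 0) :
    ∀ x ∈ Icc (0 : ℝ) 1, φ x = 0 ∧ φ₁ x = 0 := by
  obtain ⟨C, hC0, hC⟩ := exists_bound hb hc
  have hW : DerivOn (fun x => (φ x, φ₁ x)) (fun x => (φ₁ x, -(b x * φ₁ x + c x * φ x))) :=
    fun x hx => (h.1 x hx).prodMk (h.2.1 x hx)
  have := hW.eq_zero (C := 1 + 2 * C)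
    (fun x hx => norm_linear_le (hC x hx).1 (hC x hx).2) hx₀ (by simp [h0, h1])
  intro x hx
  exact Prod.mk_eq_zero.1 (this x hx)

/-- A Neumann solution of the linear equation has an angle which ends at a multiple of `π`. -/
theorem IsLinearNeumann.exists_pruferAngle {b c φ φ₁ : ℝ → ℝ} (hb : ContinuousOn b (Icc 0 1))
    (hc : ContinuousOn c (Icc 0 1)) (h : IsLinearNeumann b c φ φ₁)
    (hne : ∃ x ∈ Icc (0 : ℝ) 1, φ x ≠ 0) : ∃ θ, IsPruferAngle b c θ ∧ sin (θ 1) = 0 := by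
  have hφ0 : φ 0 ≠ 0 := by
    intro h0
    obtain ⟨x, hx, hx'⟩ := hne
    exact hx' (h.eq_zero hb hc (x₀ := 0) (by simp) h0 h.2.2.1 x hx).1
  -- Normalize the solution by `φ(0) = 1`.
  have h1 : DerivOn (fun x => (φ 0)⁻¹ * φ x) (fun x => (φ 0)⁻¹ * φ₁ x) :=
    fun x hx => (h.1 x hx).const_mul _
  have h2 : DerivOn (fun x => (φ 0)⁻¹ * φ₁ x) (fun x => (φ 0)⁻¹ * -(b x * φ₁ x + c x * φ x)) :=
    fun x hx => (h.2.1 x hx).const_mul _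
  have hcφ := h.1.continuousOn
  have hcφ₁ := h.2.1.continuousOn
  obtain ⟨θ, A, hθ0, hA, hθ⟩ := exists_angle h1 h2 (by fun_prop) (by simp [hφ0])
    (by simp [h.2.2.1]) (fun x hx => by
      refine sq_add_sq_pos fun h3 h4 => ?_
      have h5 := h.eq_zero hb hc hx ((mul_eq_zero.1 h3).resolve_left (inv_ne_zero hφ0))
        ((mul_eq_zero.1 h4).resolve_left (inv_ne_zero hφ0))
      exact hφ0 (h5 0 (by simp)).1)
  refine ⟨θ, ⟨hθ0, fun x hx => ?_⟩, ?_⟩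
  · refine (hθ x hx).congr_deriv ?_
    obtain ⟨h3, h4, h5⟩ := hA x hx
    refine (angle_deriv_eq b c x _ h3 h4 h5).trans ?_
    ring
  · obtain ⟨h3, h4, h5⟩ := hA 1 (by simp)
    rw [h.2.2.2, mul_zero] at h5
    exact (mul_eq_zero.1 h5.symm).resolve_left h3.ne'

/-- An angle which ends at a multiple of `π` belongs to a nontrivial Neumann solution, which is
recovered by integration of its logarithmic amplitude `G`. -/
theorem IsPruferAngle.sin_ne_zero {b c θ : ℝ → ℝ} (hb : ContinuousOn b (Icc 0 1))
    (hc : ContinuousOn c (Icc 0 1)) (hθ : IsPruferAngle b c θ)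
    (hnd : ∀ φ φ₁, IsLinearNeumann b c φ φ₁ → ∀ x ∈ Icc (0 : ℝ) 1, φ x = 0) :
    sin (θ 1) ≠ 0 := by
  intro hsin
  have hcθ := hθ.2.continuousOn
  obtain ⟨G, hG0, hG⟩ := exists_derivOn (g := fun x => cos (θ x) * sin (θ x)
    - sin (θ x) * (b x * sin (θ x) + c x * cos (θ x))) (by fun_prop)
  have h := hnd (fun x => exp (G x) * cos (θ x)) (fun x => exp (G x) * sin (θ x))
    ⟨fun x hx => ?_, fun x hx => ?_, by simp [hθ.1], by simp [hsin]⟩ 0 (by simp)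
  · rw [hG0, hθ.1] at h
    simp at h
  · refine ((hG x hx).exp.mul (hθ.2 x hx).cos).congr_deriv ?_
    have := sin_sq_add_cos_sq (θ x)
    unfold pruferField
    linear_combination (exp (G x) * sin (θ x)) * this
  · refine ((hG x hx).exp.mul (hθ.2 x hx).sin).congr_deriv ?_
    have := sin_sq_add_cos_sq (θ x)
    unfold pruferField
    linear_combination (-exp (G x) * (b x * sin (θ x) + c x * cos (θ x))) * this

/-- Sturm comparison: smaller coefficients `c` give larger angles. -/
theorem pruferAngle_lt {b c₁ c₂ θ₁ θ₂ : ℝ → ℝ} (hb : ContinuousOn b (Icc 0 1))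
    (hc₂ : ContinuousOn c₂ (Icc 0 1)) (h₁ : IsPruferAngle b c₁ θ₁) (h₂ : IsPruferAngle b c₂ θ₂)
    (hc : ∀ x, c₂ x < c₁ x) : θ₁ 1 < θ₂ 1 := by
  obtain ⟨C, hC0, hC⟩ := exists_bound hb hc₂
  obtain ⟨hle, hmono⟩ := comparison (F := pruferField b c₂) (K := 2 + 4 * C)
    (fun x hx s t => abs_pruferField_sub_le (hC x hx).1 (hC x hx).2 s t) h₁.2 h₂.2
    (fun x _ => by
      have := mul_nonneg (sub_pos.2 (hc x)).le (sq_nonneg (cos (θ₁ x)))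
      unfold pruferField
      nlinarith) (fun x _ => le_rfl) (by rw [h₁.1, h₂.1])
  refine (hle 1 (by simp)).lt_of_ne fun he => ?_
  -- Equality at `x = 1` would imply equality throughout, hence equality of the derivatives.
  have heq : ∀ x ∈ Icc (0 : ℝ) 1, θ₂ x = θ₁ x := by
    intro x hx
    have h3 := hmono hx (right_mem_Icc.2 zero_le_one) hx.2
    simp only [he, sub_self, mul_zero] at h3
    have h4 := nonpos_of_mul_nonpos_right h3 (exp_pos _)
    linarith [hle x hx]
  have h0 : (0 : ℝ) ∈ Icc (0 : ℝ) 1 := by simp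
  have h3 := ((h₁.2 0 h0).congr heq (heq 0 h0)).derivWithin (uniqueDiffOn_Icc zero_lt_one 0 h0)
  rw [h₂.2.derivWithin_eq h0] at h3
  beta_reduce at h3
  rw [h₁.1, h₂.1] at h3
  unfold pruferField at h3
  simp at h3
  linarith [hc 0]

/-- The number of positive eigenvalues is bounded by the number of half-turns of the angle, because
the angle is strictly increasing in the eigenvalue parameter. -/
theorem encard_eigenvalues_le {b c θ : ℝ → ℝ} (hb : ContinuousOn b (Icc 0 1))
    (hc : ContinuousOn c (Icc 0 1)) (hθ : IsPruferAngle b c θ) {r : ℕ} (hr : -(r * π) < θ 1)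
    {S : Set ℝ} (hS : ∀ lam ∈ S, 0 < lam ∧ ∃ φ φ₁, IsLinearNeumann b (fun x => c x - lam) φ φ₁ ∧
      ∃ x ∈ Icc (0 : ℝ) 1, φ x ≠ 0) : S.encard ≤ r := by
  have hcl : ∀ lam : ℝ, ContinuousOn (fun x => c x - lam) (Icc 0 1) := fun lam => by fun_prop
  have hex : ∀ lam ∈ S, ∃ (k : ℕ) (η : ℝ → ℝ), IsPruferAngle b (fun x => c x - lam) η ∧
      η 1 = -(k * π) := by
    intro lam hlam
    obtain ⟨-, φ, φ₁, h1, h2⟩ := hS lam hlam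
    obtain ⟨η, hη, hη'⟩ := h1.exists_pruferAngle hb (hcl lam) h2
    obtain ⟨k, hk⟩ := exists_nat_of_sin_eq_zero hη' hη.le
    exact ⟨k, η, hη, hk⟩
  choose! k η hη hk using hex
  have hpi := pi_pos
  have := encard_le_encard_of_injOn (s := S) (t := (Finset.range r : Set ℕ)) (f := k)
    (fun lam hlam => ?_) (fun lam hlam lam' hlam' he => ?_)
  · rwa [encard_coe_eq_coe_finsetCard, Finset.card_range] at this
  · have h1 := pruferAngle_lt hb (hcl lam) hθ (hη lam hlam)
      (fun x => by linarith [(hS lam hlam).1])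
    rw [hk lam hlam] at h1
    have h2 : (k lam : ℝ) * π < r * π := by linarith
    have h3 := lt_of_mul_lt_mul_right h2 hpi.le
    simpa using (by exact_mod_cast h3 : k lam < r)
  · have key : ∀ l ∈ S, ∀ l' ∈ S, k l = k l' → ¬ l < l' := by
      intro l hl l' hl' he hlt
      have h1 := pruferAngle_lt hb (hcl l') (hη l hl) (hη l' hl') (fun x => by linarith)
      rw [hk l hl, hk l' hl', he] at h1
      exact lt_irrefl _ h1
    exact le_antisymm (not_lt.1 (key lam' hlam' lam hlam he.symm))
      (not_lt.1 (key lam hlam lam' hlam' he))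

/-- Solutions of the Prüfer equation keep their order. -/
theorem pruferField_order {b c θ η : ℝ → ℝ} (hb : ContinuousOn b (Icc 0 1))
    (hc : ContinuousOn c (Icc 0 1)) (hθ : DerivOn θ (fun x => pruferField b c x (θ x)))
    (hη : DerivOn η (fun x => pruferField b c x (η x))) (h : θ 0 < η 0) : θ 1 < η 1 := by
  obtain ⟨C, hC0, hC⟩ := exists_bound hb hc
  have := (comparison (F := pruferField b c) (K := 2 + 4 * C)
    (fun x hx s t => abs_pruferField_sub_le (hC x hx).1 (hC x hx).2 s t) hθ hη
    (fun x _ => le_rfl) (fun x _ => le_rfl) h.le).2 (left_mem_Icc.2 zero_le_one)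
    (right_mem_Icc.2 zero_le_one) zero_le_one
  simp only [mul_zero, exp_zero, one_mul, mul_one] at this
  have h1 : 0 < exp (2 + 4 * C) * (η 1 - θ 1) := by linarith
  linarith [pos_of_mul_pos_right h1 (exp_pos (2 + 4 * C)).le]

/-- The number of half-turns is invariant under the reflection `x ↦ 1 - x`. -/
theorem pruferAngle_reflect {b c θ η : ℝ → ℝ} (hb : ContinuousOn b (Icc 0 1))
    (hc : ContinuousOn c (Icc 0 1)) (hθ : IsPruferAngle b c θ)
    (hη : IsPruferAngle (fun x => -b (1 - x)) (fun x => c (1 - x)) η) {r s : ℕ}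
    (hr : -(r * π) < θ 1 ∧ θ 1 < (1 - r) * π) (hs : -(s * π) < η 1 ∧ η 1 < (1 - s) * π) :
    r = s := by
  have hshift : ∀ m : ℤ, DerivOn (fun x => -η (1 - x) + m * π)
      (fun x => pruferField b c x (-η (1 - x) + m * π)) := by
    intro m x hx
    refine ((hη.2.reflect x hx).neg.add_const _).congr_deriv ?_
    have hsq : (((-1 : ℤ) : ℝ) ^ m) * ((-1 : ℤ) : ℝ) ^ m = 1 := by
      rw [← mul_zpow]
      simp
    unfold pruferField
    beta_reduce
    rw [cos_add_int_mul_pi, sin_add_int_mul_pi, cos_neg, sin_neg, sub_sub_cancel]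
    push_cast at hsq
    linear_combination (sin (η (1 - x)) ^ 2 - b x * cos (η (1 - x)) * sin (η (1 - x))
      + c x * cos (η (1 - x)) ^ 2) * hsq
  have hpi := pi_pos
  have hη1 : ∀ m : ℤ, -η (1 - 1) + m * π = m * π := by simp [hη.1]
  have h1 := pruferField_order hb hc (hshift (-s)) hθ.2 (by
    rw [hθ.1]; push_cast; norm_num; linarith [hs.1])
  have h2 := pruferField_order hb hc hθ.2 (hshift (1 - s)) (by
    rw [hθ.1]; push_cast; norm_num; linarith [hs.2])
  rw [hη1] at h1 h2
  push_cast at h1 h2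
  have h3 : (-(s : ℝ)) * π < (1 - r) * π := by linarith
  have h4 : (-(r : ℝ)) * π < (1 - s) * π := by linarith
  have h3 := lt_of_mul_lt_mul_right h3 hpi.le
  have h4 := lt_of_mul_lt_mul_right h4 hpi.le
  have h5 : (r : ℝ) < s + 1 := by linarith
  have h6 : (s : ℝ) < r + 1 := by linarith
  have h5 : r < s + 1 := by exact_mod_cast h5
  have h6 : s < r + 1 := by exact_mod_cast h6
  lia

/-! ### The shooting flow -/

/-- Bounded nonlinearities which are globally Lipschitz continuous in `(u,p)`. -/
structure IsTame (g : ℝ → ℝ → ℝ → ℝ) (L M : ℝ) : Prop where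
  cont : Continuous fun q : ℝ × ℝ × ℝ => g q.1 q.2.1 q.2.2
  lip : ∀ x u p u' p', |g x u p - g x u' p'| ≤ L * max |u - u'| |p - p'|
  bound : ∀ x u p, |g x u p| ≤ M

/-- `u'' + g(x,u,u') = 0` on `[0,1]`, with `u' = p`. -/
def IsSol (g : ℝ → ℝ → ℝ → ℝ) (U P : ℝ → ℝ) : Prop :=
  DerivOn U P ∧ DerivOn P (fun x => -g x (U x) (P x))

section Flow

variable {g : ℝ → ℝ → ℝ → ℝ} {L M : ℝ}

theorem IsTame.lip_nonneg (hg : IsTame g L M) : 0 ≤ L := by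
  have := (abs_nonneg _).trans (hg.lip 0 1 0 0 0)
  simpa using this

/-- Lipschitz dependence of solutions on initial values at any point `x`. -/
theorem IsTame.sol_dist (hg : IsTame g L M) {U P U' P' : ℝ → ℝ} (h : IsSol g U P)
    (h' : IsSol g U' P') {x y : ℝ} (hx : x ∈ Icc (0 : ℝ) 1) (hy : y ∈ Icc (0 : ℝ) 1) :
    max |U y - U' y| |P y - P' y| ≤ exp (1 + L) * max |U x - U' x| |P x - P' x| := by
  have hL := hg.lip_nonneg
  have hW : DerivOn (fun x => (U x - U' x, P x - P' x))
      (fun x => (P x - P' x, -g x (U x) (P x) - -g x (U' x) (P' x))) :=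
    fun x hx => (h.1.sub h'.1 x hx).prodMk (h.2.sub h'.2 x hx)
  refine hW.norm_le (C := 1 + L) (by linarith) (fun x _ => ?_) hx hy
  change max |P x - P' x| |-g x (U x) (P x) - -g x (U' x) (P' x)|
    ≤ (1 + L) * max |U x - U' x| |P x - P' x|
  have h1 := hg.lip x (U' x) (P' x) (U x) (P x)
  rw [abs_sub_comm (U' x), abs_sub_comm (P' x)] at h1
  have h2 := le_max_right |U x - U' x| |P x - P' x|
  have h3 := abs_nonneg (P x - P' x)
  refine max_le (by nlinarith) ?_
  rw [show -g x (U x) (P x) - -g x (U' x) (P' x) = g x (U' x) (P' x) - g x (U x) (P x) by ring]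
  nlinarith

theorem IsTame.continuousOn_comp (hg : IsTame g L M) {U P : ℝ → ℝ}
    (hU : ContinuousOn U (Icc 0 1)) (hP : ContinuousOn P (Icc 0 1)) :
    ContinuousOn (fun x => g x (U x) (P x)) (Icc 0 1) :=
  hg.cont.comp_continuousOn (f := fun x => (x, U x, P x)) (by fun_prop)

theorem abs_clip_le {a t : ℝ} (ha : 0 ≤ a) : |max (-a) (min a t)| ≤ a :=
  abs_le.2 ⟨le_max_left _ _, max_le (by linarith) (min_le_left _ _)⟩

theorem clip_eq {a t : ℝ} (h : |t| ≤ a) : max (-a) (min a t) = t := by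
  rw [min_eq_right (abs_le.1 h).2, max_eq_right (abs_le.1 h).1]

theorem abs_clip_sub_clip_le (a b s t : ℝ) : |max a (min b s) - max a (min b t)| ≤ |s - t| := by
  refine (abs_max_sub_max_le_max _ _ _ _).trans (max_le (by simp) ?_)
  refine (abs_min_sub_min_le_max _ _ _ _).trans ?_
  simp

/-- Global solutions of the shooting problem. -/
theorem IsTame.exists_sol (hg : IsTame g L M) (a : ℝ) :
    ∃ U P, IsSol g U P ∧ U 0 = a ∧ P 0 = 0 := by
  have hL := hg.lip_nonneg
  have hM : 0 ≤ M := (abs_nonneg _).trans (hg.bound 0 0 0)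
  -- The component `p` is cut off at its a priori bound `M`.
  obtain ⟨α, hα0, hα⟩ : ∃ α : ℝ → ℝ × ℝ, α 0 = (a, 0) ∧
      DerivOn α (fun x => (max (-M) (min M (α x).2), -g x (α x).1 (α x).2)) := by
    refine exists_solution (fun x (y : ℝ × ℝ) => (max (-M) (min M y.2), -g x y.1 y.2))
      ⟨1 + L, by positivity⟩ ⟨M, hM⟩ (fun x _ => LipschitzWith.of_dist_le_mul fun y z => ?_)
      (fun y => ?_) (fun x _ y => ?_) (a, 0)
    · change max |max (-M) (min M y.2) - max (-M) (min M z.2)| |-g x y.1 y.2 - -g x z.1 z.2|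
        ≤ (1 + L) * max |y.1 - z.1| |y.2 - z.2|
      have h1 := hg.lip x y.1 y.2 z.1 z.2
      have h2 := abs_clip_sub_clip_le (-M) M y.2 z.2
      have h3 := le_max_right |y.1 - z.1| |y.2 - z.2|
      have h4 := abs_nonneg (y.2 - z.2)
      rw [neg_sub_neg, abs_sub_comm (g x z.1 z.2)]
      exact max_le (by nlinarith) (by nlinarith)
    · exact (continuous_const.prodMk (hg.cont.comp (f := fun x : ℝ => (x, y.1, y.2))
        (by fun_prop)).neg).continuousOn
    · exact max_le (abs_clip_le hM) ((abs_neg _).le.trans (hg.bound x y.1 y.2))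
  have hU : DerivOn (fun x => (α x).1) (fun x => max (-M) (min M (α x).2)) :=
    fun x hx => (hα x hx).fst
  have hP : DerivOn (fun x => (α x).2) (fun x => -g x (α x).1 (α x).2) :=
    fun x hx => (hα x hx).snd
  have hPM : ∀ x ∈ Icc (0 : ℝ) 1, |(α x).2| ≤ M := by
    intro x hx
    have := Convex.norm_image_sub_le_of_norm_hasDerivWithin_le (f := fun x => (α x).2)
      (f' := fun x => -g x (α x).1 (α x).2) (C := M) hP
      (fun z _ => by simpa using hg.bound z (α z).1 (α z).2) (convex_Icc 0 1)
      (left_mem_Icc.2 zero_le_one) hx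
    simp only [hα0, sub_zero, norm_eq_abs, abs_of_nonneg hx.1] at this
    refine this.trans (mul_le_of_le_one_right hM hx.2)
  exact ⟨_, _, ⟨hU.congr (fun _ _ => rfl) (fun x hx => (clip_eq (hPM x hx)).symm), hP⟩,
    by simp [hα0], by simp [hα0]⟩

/-- The angle of the difference of two solutions, divided by the difference of their initial
values. -/
theorem IsTame.exists_secant_angle (hg : IsTame g L M) {U P V Q : ℝ → ℝ} (hU : IsSol g U P)
    (hV : IsSol g V Q) (hP0 : P 0 = 0) (hQ0 : Q 0 = 0) (hne : U 0 ≠ V 0) :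
    ∃ θ A : ℝ → ℝ, θ 0 = 0 ∧
      (∀ x ∈ Icc (0 : ℝ) 1, 0 < A x ∧ (U x - V x) / (U 0 - V 0) = A x * cos (θ x) ∧
        (P x - Q x) / (U 0 - V 0) = A x * sin (θ x) ∧ 1 ≤ exp (1 + L) * A x) ∧
      DerivOn θ (fun x => -sin (θ x) ^ 2 + cos (θ x) *
        ((-(g x (U x) (P x) - g x (V x) (Q x)) / (U 0 - V 0)) / A x)) := by
  have hd : U 0 - V 0 ≠ 0 := sub_ne_zero.2 hne
  have h1 : DerivOn (fun x => (U x - V x) / (U 0 - V 0)) (fun x => (P x - Q x) / (U 0 - V 0)) :=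
    fun x hx => (hU.1.sub hV.1 x hx).div_const _
  have h2 : DerivOn (fun x => (P x - Q x) / (U 0 - V 0))
      (fun x => -(g x (U x) (P x) - g x (V x) (Q x)) / (U 0 - V 0)) := fun x hx =>
    ((hU.2.sub hV.2 x hx).div_const _).congr_deriv (by ring)
  have hc1 := hg.continuousOn_comp hU.1.continuousOn hU.2.continuousOn
  have hc2 := hg.continuousOn_comp hV.1.continuousOn hV.2.continuousOn
  have hlow : ∀ x ∈ Icc (0 : ℝ) 1,
      |U 0 - V 0| ≤ exp (1 + L) * max |U x - V x| |P x - Q x| := by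
    intro x hx
    exact (le_max_left _ _).trans (hg.sol_dist hU hV hx (left_mem_Icc.2 zero_le_one))
  obtain ⟨θ, A, hθ0, hA, hθ⟩ := exists_angle h1 h2 ((hc1.sub hc2).neg.div_const _) (by simp [hd])
    (by simp [hP0, hQ0]) (fun x hx => sq_add_sq_pos fun h3 h4 => by
      have h5 := hlow x hx
      rw [(div_eq_zero_iff.1 h3).resolve_right hd, (div_eq_zero_iff.1 h4).resolve_right hd] at h5
      simp only [abs_zero, max_self, mul_zero] at h5
      exact hd (abs_nonpos_iff.1 h5))
  refine ⟨θ, A, hθ0, fun x hx => ⟨(hA x hx).1, (hA x hx).2.1, (hA x hx).2.2, ?_⟩, hθ⟩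
  obtain ⟨h3, h4, h5⟩ := hA x hx
  have hdpos := abs_pos.2 hd
  have h6 : max |U x - V x| |P x - Q x| ≤ |U 0 - V 0| * A x := by
    rw [div_eq_iff hd] at h4 h5
    rw [h4, h5, abs_mul, abs_mul, abs_mul, abs_mul, abs_of_pos h3]
    have h7 := abs_cos_le_one (θ x)
    have h8 := abs_sin_le_one (θ x)
    refine max_le ?_ ?_
    · nlinarith [mul_pos h3 hdpos]
    · nlinarith [mul_pos h3 hdpos]
  have h7 : |U 0 - V 0| * 1 ≤ |U 0 - V 0| * (exp (1 + L) * A x) := by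
    have h8 : exp (1 + L) * max |U x - V x| |P x - Q x| ≤ exp (1 + L) * (|U 0 - V 0| * A x) := by
      gcongr
    linarith [hlow x hx]
  exact le_of_mul_le_mul_left h7 hdpos

theorem zeroNumber_const_mul {φ ψ : unitInterval → ℝ} {d : ℝ} (hd : d ≠ 0)
    (h : ∀ x, φ x = d * ψ x) : zeroNumber φ = zeroNumber ψ := by
  have : ∀ m, HasSignChanges φ m ↔ HasSignChanges ψ m := by
    intro m
    have hd2 : 0 < d * d := mul_self_pos.2 hd
    have heq : ∀ x y, φ x * φ y < 0 ↔ ψ x * ψ y < 0 := by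
      intro x y
      rw [h x, h y, show d * ψ x * (d * ψ y) = d * d * (ψ x * ψ y) by ring]
      exact ⟨fun h => neg_of_mul_neg_right h hd2.le, mul_neg_of_pos_of_neg hd2⟩
    simp only [HasSignChanges, heq]
  simp only [zeroNumber, this]

/-- The end point angles of the differences `U a - V`, continuously extended to `a = V 0` by the end
point angle of the linearization. -/
theorem IsTame.exists_angle_function (hg : IsTame g L M) {U P : ℝ → ℝ → ℝ}
    (hU : ∀ a, IsSol g (U a) (P a) ∧ U a 0 = a ∧ P a 0 = 0) {V Q : ℝ → ℝ} (hV : IsSol g V Q)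
    (hQ0 : Q 0 = 0) {b c θ : ℝ → ℝ} (hb : ContinuousOn b (Icc 0 1))
    (hc : ContinuousOn c (Icc 0 1)) {D : ℝ}
    (hlin : ∀ x ∈ Icc (0 : ℝ) 1, ∀ u p, |u - V x| ≤ 1 → |p - Q x| ≤ 1 →
      |g x u p - g x (V x) (Q x) - (b x * (p - Q x) + c x * (u - V x))|
        ≤ D * max |u - V x| |p - Q x| ^ 2) (hθ : IsPruferAngle b c θ) :
    ∃ Φ : ℝ → ℝ, Continuous Φ ∧ Φ (V 0) = θ 1 ∧ ∀ a ≠ V 0, Φ a ≤ π / 2 ∧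
      (∃ A > 0, U a 1 - V 1 = (a - V 0) * (A * cos (Φ a)) ∧
        P a 1 - Q 1 = (a - V 0) * (A * sin (Φ a))) ∧
      (∀ k : ℕ, Φ a = -(k * π) → zeroNumber (fun x : unitInterval => U a x - V x) = k) ∧
      ((∀ x ∈ Icc (0 : ℝ) 1, 0 < (U a x - V x) / (a - V 0)) → -(π / 2) < Φ a) := by
  have hE : 0 < exp (1 + L) := exp_pos _
  have hL := hg.lip_nonneg
  have hex : ∀ a, ∃ θ A : ℝ → ℝ, a ≠ V 0 → θ 0 = 0 ∧
      (∀ x ∈ Icc (0 : ℝ) 1, 0 < A x ∧ (U a x - V x) / (a - V 0) = A x * cos (θ x) ∧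
        (P a x - Q x) / (a - V 0) = A x * sin (θ x) ∧ 1 ≤ exp (1 + L) * A x) ∧
      DerivOn θ (fun x => -sin (θ x) ^ 2 + cos (θ x) *
        ((-(g x (U a x) (P a x) - g x (V x) (Q x)) / (a - V 0)) / A x)) := by
    intro a
    by_cases ha : a = V 0
    · exact ⟨0, 0, fun h => absurd ha h⟩
    · obtain ⟨h1, h2, h3⟩ := hU a
      obtain ⟨η, A, h4⟩ := hg.exists_secant_angle h1 hV h3 hQ0 (by rwa [h2])
      rw [h2] at h4
      exact ⟨η, A, fun _ => h4⟩
  choose η A hηA using hex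
  have hstable : ∀ (b₀ c₀ η₀ : ℝ → ℝ) (C ε a : ℝ), 0 ≤ C →
      (∀ x ∈ Icc (0 : ℝ) 1, |b₀ x| ≤ C ∧ |c₀ x| ≤ C) → IsPruferAngle b₀ c₀ η₀ → a ≠ V 0 →
      (∀ x ∈ Icc (0 : ℝ) 1, |-(g x (U a x) (P a x) - g x (V x) (Q x))
        + b₀ x * (P a x - Q x) + c₀ x * (U a x - V x)| ≤ ε) →
      |η a 1 - η₀ 1| ≤ (ε / |a - V 0| * exp (1 + L)) * exp (2 + 4 * C) := by
    intro b₀ c₀ η₀ C ε a hC0 hC hη₀ ha hε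
    obtain ⟨h0, h1, h2⟩ := hηA a ha
    have hd := sub_ne_zero.2 ha
    have hdp := abs_pos.2 hd
    refine angle_stable hC0 hC (fun x hx => ⟨(h1 x hx).1, (h1 x hx).2.1, (h1 x hx).2.2.1⟩) h0 h2
      hη₀ (fun x hx => ?_)
    have h3 : -(g x (U a x) (P a x) - g x (V x) (Q x)) / (a - V 0)
        + b₀ x * ((P a x - Q x) / (a - V 0)) + c₀ x * ((U a x - V x) / (a - V 0))
        = (-(g x (U a x) (P a x) - g x (V x) (Q x))
        + b₀ x * (P a x - Q x) + c₀ x * (U a x - V x)) / (a - V 0) := by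
      field_simp
    rw [h3, abs_div]
    have h4 : 0 ≤ ε / |a - V 0| := div_nonneg ((abs_nonneg _).trans (hε x hx)) hdp.le
    calc |-(g x (U a x) (P a x) - g x (V x) (Q x))
        + b₀ x * (P a x - Q x) + c₀ x * (U a x - V x)| / |a - V 0| ≤ ε / |a - V 0| := by
          gcongr
          exact hε x hx
      _ = ε / |a - V 0| * 1 := (mul_one _).symm
      _ ≤ ε / |a - V 0| * (exp (1 + L) * A a x) := by
          gcongr
          exact (h1 x hx).2.2.2
      _ = _ := by ring
  have hup : ∀ a, ∀ x ∈ Icc (0 : ℝ) 1,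
      max |U a x - V x| |P a x - Q x| ≤ exp (1 + L) * |a - V 0| := by
    intro a x hx
    obtain ⟨h1, h2, h3⟩ := hU a
    have := hg.sol_dist h1 hV (left_mem_Icc.2 zero_le_one) hx
    rw [h2, h3, hQ0] at this
    simpa using this
  have hupU : ∀ a a', ∀ x ∈ Icc (0 : ℝ) 1,
      max |U a x - U a' x| |P a x - P a' x| ≤ exp (1 + L) * |a - a'| := by
    intro a a' x hx
    have := hg.sol_dist (hU a).1 (hU a').1 (left_mem_Icc.2 zero_le_one) hx
    rw [(hU a).2.1, (hU a').2.1, (hU a).2.2, (hU a').2.2] at this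
    simpa using this
  classical
  refine ⟨fun a => if a = V 0 then θ 1 else η a 1, ?_, by simp, ?_⟩
  · rw [continuous_iff_continuousAt]
    intro a₀
    by_cases ha₀ : a₀ = V 0
    · subst ha₀
      obtain ⟨C, hC0, hC⟩ := exists_bound hb hc
      refine continuousAt_of_locally_lipschitz (r := (exp (1 + L))⁻¹) (by positivity)
        (D * exp (1 + L) ^ 2 * exp (1 + L) * exp (2 + 4 * C)) (fun a ha => ?_)
      by_cases ha' : a = V 0
      · simp [ha']
      · simp only [if_neg ha', if_true, Real.dist_eq] at ha ⊢
        have hdp := abs_pos.2 (sub_ne_zero.2 ha')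
        have h1 : exp (1 + L) * |a - V 0| ≤ 1 := by
          have := mul_lt_mul_of_pos_left ha hE
          rw [mul_inv_cancel₀ hE.ne'] at this
          exact this.le
        refine (hstable b c θ C (D * (exp (1 + L) * |a - V 0|) ^ 2) a hC0 hC hθ ha'
          (fun x hx => ?_)).trans (le_of_eq ?_)
        · have h2 := hup a x hx
          have h3 := hlin x hx (U a x) (P a x) ((le_max_left _ _).trans (h2.trans h1))
            ((le_max_right _ _).trans (h2.trans h1))
          have hD : 0 ≤ D := by
            have := (abs_nonneg _).trans (hlin x hx (V x + 1) (Q x) (by simp) (by simp))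
            simpa using this
          rw [← abs_neg] at h3
          refine le_trans (le_of_eq ?_) (h3.trans ?_)
          · congr 1
            ring
          · gcongr
        · field_simp
    · -- On the solution `U a₀ - V` itself, the equation is linear with coefficients which are
      -- obtained by projection.
      obtain ⟨h0, h1, h2⟩ := hηA a₀ ha₀
      have hd₀ := sub_ne_zero.2 ha₀
      have hd₀p := abs_pos.2 hd₀
      set e : ℝ → ℝ := fun x => g x (U a₀ x) (P a₀ x) - g x (V x) (Q x) with he
      set N : ℝ → ℝ := fun x => (U a₀ x - V x) ^ 2 + (P a₀ x - Q x) ^ 2 with hN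
      have hNpos : ∀ x ∈ Icc (0 : ℝ) 1, N x ≠ 0 := by
        intro x hx
        obtain ⟨h3, h4, h5, -⟩ := h1 x hx
        rw [div_eq_iff hd₀] at h4 h5
        simp only [hN]
        rw [h4, h5, show (A a₀ x * cos (η a₀ x) * (a₀ - V 0)) ^ 2
          + (A a₀ x * sin (η a₀ x) * (a₀ - V 0)) ^ 2 = (A a₀ x * (a₀ - V 0)) ^ 2 by
            linear_combination ((A a₀ x * (a₀ - V 0)) ^ 2) * sin_sq_add_cos_sq (η a₀ x)]
        exact pow_ne_zero 2 (mul_ne_zero h3.ne' hd₀)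
      have hcU := (hU a₀).1.1.continuousOn
      have hcP := (hU a₀).1.2.continuousOn
      have hcV := hV.1.continuousOn
      have hcQ := hV.2.continuousOn
      have hce : ContinuousOn e (Icc 0 1) :=
        (hg.continuousOn_comp hcU hcP).sub (hg.continuousOn_comp hcV hcQ)
      have hcN : ContinuousOn N (Icc 0 1) := by fun_prop
      set b₀ : ℝ → ℝ := fun x => e x * (P a₀ x - Q x) / N x with hb₀
      set c₀ : ℝ → ℝ := fun x => e x * (U a₀ x - V x) / N x with hc₀
      have hcb₀ : ContinuousOn b₀ (Icc 0 1) := by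
        refine ContinuousOn.div (by fun_prop) hcN hNpos
      have hcc₀ : ContinuousOn c₀ (Icc 0 1) := by
        refine ContinuousOn.div (by fun_prop) hcN hNpos
      have hproj : ∀ x ∈ Icc (0 : ℝ) 1,
          -e x + b₀ x * (P a₀ x - Q x) + c₀ x * (U a₀ x - V x) = 0 := by
        intro x hx
        have := hNpos x hx
        simp only [hb₀, hc₀]
        field_simp
        simp only [hN]
        ring
      have hη₀ : IsPruferAngle b₀ c₀ (η a₀) := by
        refine ⟨h0, fun x hx => (h2 x hx).congr_deriv ?_⟩
        obtain ⟨h3, h4, h5, -⟩ := h1 x hx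
        refine (angle_deriv_eq b₀ c₀ x _ h3 h4 h5).trans ?_
        have h6 : -(g x (U a₀ x) (P a₀ x) - g x (V x) (Q x)) / (a₀ - V 0)
            + b₀ x * ((P a₀ x - Q x) / (a₀ - V 0)) + c₀ x * ((U a₀ x - V x) / (a₀ - V 0)) = 0 := by
          have h7 := hproj x hx
          simp only [he] at h7
          field_simp
          linarith
        rw [h6, zero_div, mul_zero, add_zero]
      obtain ⟨C, hC0, hC⟩ := exists_bound hcb₀ hcc₀
      refine continuousAt_of_locally_lipschitz (r := |a₀ - V 0| / 2) (by positivity)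
        ((L + 2 * C) * exp (1 + L) / (|a₀ - V 0| / 2) * exp (1 + L) * exp (2 + 4 * C))
        (fun a ha => ?_)
      rw [Real.dist_eq] at ha
      have h3 : |a₀ - V 0| / 2 ≤ |a - V 0| := by
        have h4 := abs_sub_abs_le_abs_sub (a₀ - V 0) (a - V 0)
        rw [show a₀ - V 0 - (a - V 0) = -(a - a₀) by ring, abs_neg] at h4
        linarith
      have ha' : a ≠ V 0 := fun h => by
        rw [h, sub_self, abs_zero] at h3
        linarith
      simp only [if_neg ha', if_neg ha₀, Real.dist_eq]
      have h5 : 0 ≤ (L + 2 * C) * (exp (1 + L) * |a - a₀|) := by positivity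
      refine (hstable b₀ c₀ (η a₀) C ((L + 2 * C) * (exp (1 + L) * |a - a₀|)) a hC0 hC hη₀ ha'
        (fun x hx => ?_)).trans ?_
      · have h4 := hproj x hx
        simp only [he] at h4
        have h6 := hupU a a₀ x hx
        have h7 := (le_max_left _ _).trans h6
        have h8 := (le_max_right _ _).trans h6
        have h9 : |g x (U a₀ x) (P a₀ x) - g x (U a x) (P a x)| ≤ L * (exp (1 + L) * |a - a₀|) := by
          rw [abs_sub_comm]
          exact (hg.lip x _ _ _ _).trans (mul_le_mul_of_nonneg_left h6 hL)
        rw [show -(g x (U a x) (P a x) - g x (V x) (Q x)) + b₀ x * (P a x - Q x)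
          + c₀ x * (U a x - V x) = (g x (U a₀ x) (P a₀ x) - g x (U a x) (P a x))
          + b₀ x * (P a x - P a₀ x) + c₀ x * (U a x - U a₀ x) by linear_combination h4]
        calc |(g x (U a₀ x) (P a₀ x) - g x (U a x) (P a x))
          + b₀ x * (P a x - P a₀ x) + c₀ x * (U a x - U a₀ x)|
            ≤ |g x (U a₀ x) (P a₀ x) - g x (U a x) (P a x)| + |b₀ x * (P a x - P a₀ x)|
              + |c₀ x * (U a x - U a₀ x)| := abs_add_three _ _ _
          _ = |g x (U a₀ x) (P a₀ x) - g x (U a x) (P a x)| + |b₀ x| * |P a x - P a₀ x|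
              + |c₀ x| * |U a x - U a₀ x| := by rw [abs_mul, abs_mul]
          _ ≤ L * (exp (1 + L) * |a - a₀|) + C * (exp (1 + L) * |a - a₀|)
              + C * (exp (1 + L) * |a - a₀|) := by
              gcongr
              · exact (hC x hx).1
              · exact (hC x hx).2
          _ = _ := by ring
      · calc (L + 2 * C) * (exp (1 + L) * |a - a₀|) / |a - V 0| * exp (1 + L) * exp (2 + 4 * C)
            ≤ (L + 2 * C) * (exp (1 + L) * |a - a₀|) / (|a₀ - V 0| / 2) * exp (1 + L)
              * exp (2 + 4 * C) := by gcongr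
          _ = _ := by ring
  · intro a ha
    simp only [if_neg ha]
    obtain ⟨h0, h1, h2⟩ := hηA a ha
    have hd := sub_ne_zero.2 ha
    have hneg : ∀ x ∈ Icc (0 : ℝ) 1, cos (η a x) = 0 → -sin (η a x) ^ 2 + cos (η a x) *
        ((-(g x (U a x) (P a x) - g x (V x) (Q x)) / (a - V 0)) / A a x) < 0 :=
      fun x _ h => angle_deriv_neg h
    refine ⟨?_, ⟨A a 1, (h1 1 (by simp)).1, ?_, ?_⟩, fun k hk => ?_, fun hpos => ?_⟩
    · have := angle_le_of_le h2 hneg 0 (x := 0) (y := 1) (by simp) (by simp) (by simp)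
        (by rw [h0]; simp; positivity)
      simpa using this
    · have := (h1 1 (by simp)).2.1
      rw [div_eq_iff hd] at this
      rw [this]
      ring
    · have := (h1 1 (by simp)).2.2.1
      rw [div_eq_iff hd] at this
      rw [this]
      ring
    · rw [zeroNumber_const_mul (ψ := fun x : unitInterval => (U a x - V x) / (a - V 0)) hd
        (fun x => by field_simp)]
      exact zeroNumber_of_angle h2 hneg h0 (fun x hx => (h1 x hx).1)
        (fun x => (h1 x x.2).2.1) hk
    · by_contra hcon
      have hpi := pi_pos
      obtain ⟨y, hy, hy'⟩ := intermediate_value_Icc' zero_le_one h2.continuousOn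
        (show -(π / 2) ∈ Icc (η a 1) (η a 0) from ⟨not_lt.1 hcon, by rw [h0]; linarith⟩)
      have h3 := hpos y hy
      rw [(h1 y hy).2.1, hy', cos_neg, cos_pi_div_two, mul_zero] at h3
      exact lt_irrefl _ h3

end Flow

/-! ### From the shooting curve to zero numbers -/

/-- On an interval without zeros of the sine, the angle stays within one half-turn. -/
theorem exists_int_of_gap {Ψ : ℝ → ℝ} (hΨ : Continuous Ψ) {α β : ℝ} (hαβ : α < β)
    (hs : ∀ a ∈ Ioo α β, sin (Ψ a) ≠ 0) :
    ∃ m : ℤ, (∀ a ∈ Ioo α β, m * π < Ψ a ∧ Ψ a < (m + 1) * π) ∧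
      ∀ a ∈ Icc α β, m * π ≤ Ψ a ∧ Ψ a ≤ (m + 1) * π := by
  obtain ⟨m, h1, h2⟩ := exists_int_of_sin_ne_zero
    (hs ((α + β) / 2) ⟨by linarith, by linarith⟩)
  have hmid : (α + β) / 2 ∈ Ioo α β := ⟨by linarith, by linarith⟩
  have hmul : ∀ k : ℤ, ∀ a ∈ Ioo α β, Ψ a ≠ k * π := fun k a ha he =>
    hs a ha (by rw [he]; exact sin_int_mul_pi k)
  have hpre : (Ψ '' Ioo α β).OrdConnected :=
    (isPreconnected_Ioo.image Ψ hΨ.continuousOn).ordConnected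
  have hopen : ∀ a ∈ Ioo α β, m * π < Ψ a ∧ Ψ a < (m + 1) * π := by
    intro a ha
    constructor
    · by_contra hcon
      obtain ⟨y, hy, hy'⟩ := hpre.out (mem_image_of_mem Ψ ha) (mem_image_of_mem Ψ hmid)
        ⟨not_lt.1 hcon, h1.le⟩
      exact hmul m y hy hy'
    · by_contra hcon
      obtain ⟨y, hy, hy'⟩ := hpre.out (mem_image_of_mem Ψ hmid) (mem_image_of_mem Ψ ha)
        ⟨h2.le, not_lt.1 hcon⟩
      exact hmul (m + 1) y hy (by push_cast; exact hy')
  refine ⟨m, hopen, ?_⟩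
  have hcl : IsClosed {a | m * π ≤ Ψ a ∧ Ψ a ≤ (m + 1) * π} :=
    (isClosed_le continuous_const hΨ).inter (isClosed_le hΨ continuous_const)
  intro a ha
  rw [← closure_Ioo hαβ.ne] at ha
  exact hcl.closure_subset_iff.2 (fun a ha => ⟨(hopen a ha).1.le, (hopen a ha).2.le⟩) ha

theorem sin_pos_iff_even {t : ℝ} {m : ℤ} (h1 : m * π < t) (h2 : t < (m + 1) * π) :
    0 < sin t ↔ Even m := by
  have h3 : 0 < sin (t - m * π) := sin_pos_of_pos_of_lt_pi (by linarith) (by linarith)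
  have h4 : sin t = (-1) ^ m * sin (t - m * π) := by
    have := sin_add_int_mul_pi (t - m * π) m
    rwa [sub_add_cancel] at this
  rw [h4]
  rcases Int.even_or_odd m with hm | hm
  · simp [hm.neg_one_zpow, h3, hm]
  · simp only [hm.neg_one_zpow, Int.not_even_iff_odd.2 hm, iff_false]
    linarith

theorem int_eq_of_mem {t : ℝ} {m k : ℤ} (h1 : m * π < t) (h2 : t < (m + 1) * π)
    (h3 : k * π ≤ t) (h4 : t ≤ (k + 1) * π) : m = k := by
  have hpi := pi_pos
  have h5 : (m : ℝ) < k + 1 := lt_of_mul_lt_mul_right (h1.trans_le h4) hpi.le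
  have h6 : (k : ℝ) < m + 1 := lt_of_mul_lt_mul_right (h3.trans_lt h2) hpi.le
  have h5 : m < k + 1 := by exact_mod_cast h5
  have h6 : k < m + 1 := by exact_mod_cast h6
  lia

theorem int_mem_of_mul_pi {z : ℕ} {m : ℤ} (h1 : m * π ≤ -(z * π)) (h2 : -(z * π) ≤ (m + 1) * π) :
    (z : ℤ) = -m ∨ (z : ℤ) = -m - 1 := by
  have hpi := pi_pos
  have h5 : (m : ℝ) ≤ -z := le_of_mul_le_mul_right (by linarith) hpi
  have h6 : (-z : ℝ) ≤ m + 1 := le_of_mul_le_mul_right (by linarith) hpi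
  have h5 : m ≤ -z := by exact_mod_cast h5
  have h6 : -(z : ℤ) ≤ m + 1 := by exact_mod_cast h6
  lia

/-- Parity determines how zero numbers change from a vertex to the next one, if both angles `-Z v w`
and `-Z v w'`, in units of `π`, are end points of a common half-turn `[m, m + 1]`. -/
theorem ShootingData.of_steps {E : Type*} {p q : E → ℤ} {n : ℤ} {ρ : E → ℕ} {Z : E → E → ℕ}
    (hnonneg : ∀ v, 0 ≤ p v) (hle : ∀ v, p v ≤ n)
    (hsurj : ∀ k : ℤ, 0 ≤ k → k ≤ n → ∃ v, p v = k)
    (hinj : Function.Injective p) (hinj' : Function.Injective q)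
    (hsymm : ∀ v w, Z v w = Z w v)
    (hparity : ∀ v w, p v < p w → (Even (Z v w) ↔ q v < q w))
    (hρp : ∀ v, Even (ρ v) ↔ Even (p v))
    (hstep : ∀ v w w', p w' = p w + 1 → w ≠ v → w' ≠ v → ∃ m : ℤ,
      (Even m ↔ (p v < p w ↔ Even (p w))) ∧ ((Z v w : ℤ) = -m ∨ (Z v w : ℤ) = -m - 1) ∧
      ((Z v w' : ℤ) = -m ∨ (Z v w' : ℤ) = -m - 1))
    (hmorse : ∀ w w', p w' = p w + 1 →
      ((Z w w' : ℤ) = ρ w ∨ (Z w w' : ℤ) = ρ w - 1) ∧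
      ((Z w w' : ℤ) = ρ w' ∨ (Z w w' : ℤ) = ρ w' - 1)) :
    ShootingData p q n Z (fun v => ρ v) := by
  have hpar : ∀ v w, v ≠ w → (Even (Z v w) ↔ (p v < p w ↔ q v < q w)) := by
    intro v w hvw
    rcases lt_or_gt_of_ne (fun e => hvw (hinj e)) with h | h
    · rw [hparity v w h]
      simp [h]
    · have h1 : q v ≠ q w := fun e => hvw (hinj' e)
      rw [hsymm, hparity w v h]
      lia
  refine
    { nonneg := hnonneg
      le := hle
      surj := hsurj
      inj := hinj
      inj' := hinj'
      symm := hsymm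
      parity := hparity
      step_same := fun v w w' hww hw hw' hs => ?_
      step_up := fun v w w' hww hs he => ?_
      step_down := fun v w w' hww hs he => ?_
      morse_up := fun w w' hww he => ?_
      morse_down := fun w w' hww he => ?_ }
  · obtain ⟨m, h1, h2, h3⟩ := hstep v w w' hww hw hw'
    have h4 := hpar v w hw.symm
    have h5 := hpar v w' hw'.symm
    have h6 : q v ≠ q w := fun e => hw (hinj' e).symm
    have h7 : q v ≠ q w' := fun e => hw' (hinj' e).symm
    have h8 : p v ≠ p w := fun e => hw (hinj e).symm
    have h9 : p v ≠ p w' := fun e => hw' (hinj e).symm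
    have h10 : Even (Z v w) ↔ Even (Z v w') := by
      rw [h4, h5]
      lia
    rw [Nat.even_iff, Nat.even_iff] at h10
    lia
  · have hw : w ≠ v := by rintro rfl; lia
    have hw' : w' ≠ v := by rintro rfl; lia
    obtain ⟨m, h1, h2, h3⟩ := hstep v w w' hww hw hw'
    have h4 := hpar v w hw.symm
    have h5 := hpar v w' hw'.symm
    have h8 : p v ≠ p w := fun e => hw (hinj e).symm
    have h9 : p v ≠ p w' := fun e => hw' (hinj e).symm
    have h10 : Even m ↔ Even (Z v w') := by
      rw [h1, h5, he]
      lia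
    have h11 : Even (Z v w') ↔ ¬ Even (Z v w) := by
      rw [h4, h5]
      lia
    rw [Nat.even_iff, Nat.even_iff] at h11
    rw [Nat.even_iff, Int.even_iff] at h10
    lia
  · have hw : w ≠ v := by rintro rfl; lia
    have hw' : w' ≠ v := by rintro rfl; lia
    obtain ⟨m, h1, h2, h3⟩ := hstep v w w' hww hw hw'
    have h4 := hpar v w hw.symm
    have h5 := hpar v w' hw'.symm
    have h8 : p v ≠ p w := fun e => hw (hinj e).symm
    have h9 : p v ≠ p w' := fun e => hw' (hinj e).symm
    have h12 : Even (p w) ↔ q w' < q w := by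
      by_cases hp : Even (p w) <;> simp only [hp, true_iff, false_iff] at he ⊢ <;> lia
    have h10 : Even m ↔ Even (Z v w) := by
      rw [h1, h4, h12]
      lia
    have h11 : Even (Z v w') ↔ ¬ Even (Z v w) := by
      rw [h4, h5]
      lia
    rw [Nat.even_iff, Nat.even_iff] at h11
    rw [Nat.even_iff, Int.even_iff] at h10
    lia
  · obtain ⟨h1, h2⟩ := hmorse w w' hww
    have h3 := hparity w w' (by lia)
    have h4 := hρp w
    have h5 := hρp w'
    rw [hww, Int.even_add_one] at h5
    have h6 : Even (Z w w') ↔ Even (ρ w) := by rw [h3, h4, he]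
    have h7 : Even (ρ w') ↔ ¬ Even (ρ w) := by rw [h4, h5]
    rw [Nat.even_iff, Nat.even_iff] at h6 h7
    lia
  · obtain ⟨h1, h2⟩ := hmorse w w' hww
    have h3 := hparity w w' (by lia)
    have h4 := hρp w
    have h5 := hρp w'
    rw [hww, Int.even_add_one] at h5
    have h6 : ¬ (Even (Z w w') ↔ Even (ρ w)) := by
      rw [h3, h4]
      tauto
    have h7 : Even (ρ w') ↔ ¬ Even (ρ w) := by rw [h4, h5]
    rw [Nat.even_iff, Nat.even_iff] at h6 h7
    lia

/-- The equilibria of a tame nonlinearity, with their linearizations. The labels `p` and `q` order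
them at `x = 0` and at `x = 1`, and `ρ` counts the half-turns of the linearizations. -/
structure ShootingProblem {E : Type*} (g : ℝ → ℝ → ℝ → ℝ) (L M R : ℝ) (V Q b c θ : E → ℝ → ℝ)
    (p q : E → ℤ) (n : ℤ) (ρ : E → ℕ) : Prop where
  tame : IsTame g L M
  sol : ∀ v, IsSol g (V v) (Q v)
  left : ∀ v, Q v 0 = 0
  right : ∀ v, Q v 1 = 0
  complete : ∀ U P, IsSol g U P → P 0 = 0 → P 1 = 0 → ∃ v, V v 0 = U 0
  bound : ∀ v, ∀ x ∈ Icc (0 : ℝ) 1, |V v x| < R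
  sign : ∀ x ∈ Icc (0 : ℝ) 1, ∀ u ≤ -R, 0 < g x u 0
  b_cont : ∀ v, ContinuousOn (b v) (Icc 0 1)
  c_cont : ∀ v, ContinuousOn (c v) (Icc 0 1)
  linear : ∀ v, ∃ D, ∀ x ∈ Icc (0 : ℝ) 1, ∀ u p, |u - V v x| ≤ 1 → |p - Q v x| ≤ 1 →
    |g x u p - g x (V v x) (Q v x) - (b v x * (p - Q v x) + c v x * (u - V v x))|
      ≤ D * max |u - V v x| |p - Q v x| ^ 2
  angle : ∀ v, IsPruferAngle (b v) (c v) (θ v)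
  turns : ∀ v, -(ρ v * π) < θ v 1 ∧ θ v 1 < (1 - ρ v) * π
  nonneg : ∀ v, 0 ≤ p v
  le : ∀ v, p v ≤ n
  surj : ∀ k, 0 ≤ k → k ≤ n → ∃ v, p v = k
  inj : Function.Injective p
  inj' : Function.Injective q
  lt_iff : ∀ v w, p v < p w ↔ V v 0 < V w 0
  lt_iff' : ∀ v w, q v < q w ↔ V v 1 < V w 1

/-- Solutions which start far below all equilibria are decreasing. -/
theorem IsTame.neg_of_sign {g : ℝ → ℝ → ℝ → ℝ} {L M R : ℝ} (hg : IsTame g L M)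
    (hsign : ∀ x ∈ Icc (0 : ℝ) 1, ∀ u ≤ -R, 0 < g x u 0) {U P : ℝ → ℝ} (hU : IsSol g U P)
    (hP0 : P 0 = 0) (h0 : U 0 ≤ -R - M) : ∀ x ∈ Icc (0 : ℝ) 1, U x ≤ -R ∧ P x ≤ 0 := by
  have hM : 0 ≤ M := (abs_nonneg _).trans (hg.bound 0 0 0)
  have hP : ∀ x ∈ Icc (0 : ℝ) 1, |P x| ≤ M := by
    intro x hx
    have := Convex.norm_image_sub_le_of_norm_hasDerivWithin_le (f := P) (C := M) hU.2
      (fun z _ => (abs_neg _).le.trans (hg.bound z (U z) (P z))) (convex_Icc 0 1)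
      (left_mem_Icc.2 zero_le_one) hx
    simp only [hP0, sub_zero, norm_eq_abs, abs_of_nonneg hx.1] at this
    exact this.trans (mul_le_of_le_one_right hM hx.2)
  have hUR : ∀ x ∈ Icc (0 : ℝ) 1, U x ≤ -R := by
    intro x hx
    have := Convex.norm_image_sub_le_of_norm_hasDerivWithin_le (f := U) (C := M) hU.1
      hP (convex_Icc 0 1) (left_mem_Icc.2 zero_le_one) hx
    simp only [sub_zero, norm_eq_abs, abs_of_nonneg hx.1] at this
    have h1 := (le_abs_self _).trans (this.trans (mul_le_of_le_one_right hM hx.2))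
    linarith
  refine fun x hx => ⟨hUR x hx, ?_⟩
  refine image_le_of_deriv_right_lt_deriv_boundary (B := fun _ => 0) (B' := fun _ => 0)
    hU.2.continuousOn (fun z hz => hU.2.hasDerivWithinAt_Ici hz) hP0.le
    (fun z => hasDerivAt_const _ _) (fun z hz he => ?_) hx
  have hz' := Ico_subset_Icc_self hz
  rw [he]
  have := hsign z hz' (U z) (hUR z hz')
  linarith

set_option maxHeartbeats 800000 in
/-- The end point angles `Φ v a` of the differences `U a - v` stay within a half-turn while `a`
passes from one equilibrium to the next. The parity of that half-turn is the sign of the shooting curve,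
relative to `v`. -/
theorem ShootingProblem.shootingData {E : Type*} {g : ℝ → ℝ → ℝ → ℝ} {L M R : ℝ}
    {V Q b c θ : E → ℝ → ℝ} {p q : E → ℤ} {n : ℤ} {ρ : E → ℕ}
    (H : ShootingProblem g L M R V Q b c θ p q n ρ) (Z : E → E → ℕ)
    (hZ : ∀ v w, Z v w = (zeroNumber fun x : unitInterval => V v x - V w x).toNat) :
    ShootingData p q n Z (fun v => ρ v) ∧ (∀ v, p v = 0 → ρ v = 0) ∧
      ∀ v w, v ≠ w → (zeroNumber fun x : unitInterval => V v x - V w x) = Z v w := by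
  have hpi := pi_pos
  have hg := H.tame
  choose U P hU hU0 hP0 using hg.exists_sol
  have hfun := fun v => (H.linear v).elim fun D hD =>
    hg.exists_angle_function (U := U) (P := P) (fun a => ⟨hU a, hU0 a, hP0 a⟩) (H.sol v) (H.left v)
      (H.b_cont v) (H.c_cont v) hD (H.angle v)
  choose Φ hΦc hΦ0 hΦ using hfun
  -- Equilibria belong to the flow.
  have hVU : ∀ v, ∀ x ∈ Icc (0 : ℝ) 1, U (V v 0) x = V v x ∧ P (V v 0) x = Q v x := by
    intro v x hx
    have := hg.sol_dist (hU (V v 0)) (H.sol v) (left_mem_Icc.2 zero_le_one) hx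
    rw [hU0, hP0, H.left v] at this
    simp only [sub_self, abs_zero, max_self, mul_zero] at this
    exact ⟨sub_eq_zero.1 (abs_nonpos_iff.1 ((le_max_left _ _).trans this)),
      sub_eq_zero.1 (abs_nonpos_iff.1 ((le_max_right _ _).trans this))⟩
  have hzero : ∀ a, P a 1 = 0 → ∃ v, V v 0 = a := by
    intro a ha
    obtain ⟨v, hv⟩ := H.complete (U a) (P a) (hU a) (hP0 a) ha
    exact ⟨v, hv.trans (hU0 a)⟩
  have hV0 : ∀ v w, v ≠ w → V v 0 ≠ V w 0 := by
    intro v w hvw he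
    rcases lt_or_gt_of_ne (fun e => hvw (H.inj e)) with h | h
    · exact ((H.lt_iff v w).1 h).ne he
    · exact ((H.lt_iff w v).1 h).ne he.symm
  have hP1 : ∀ v a, a ≠ V v 0 → ∃ A > 0, U a 1 - V v 1 = (a - V v 0) * (A * cos (Φ v a)) ∧
      P a 1 = (a - V v 0) * (A * sin (Φ v a)) := by
    intro v a ha
    obtain ⟨A, hA, h1, h2⟩ := (hΦ v a ha).2.1
    rw [H.right v, sub_zero] at h2
    exact ⟨A, hA, h1, h2⟩
  have hsinpos : ∀ v a, a ≠ V v 0 → P a 1 ≠ 0 →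
      sin (Φ v a) ≠ 0 ∧ (0 < sin (Φ v a) ↔ (V v 0 < a ↔ 0 < P a 1)) := by
    intro v a ha hPa
    obtain ⟨A, hA, -, h2⟩ := hP1 v a ha
    refine ⟨fun h => hPa (by rw [h2, h, mul_zero, mul_zero]), ?_⟩
    rcases lt_or_gt_of_ne ha with h | h
    · have h3 : (a - V v 0) * A < 0 := mul_neg_of_neg_of_pos (sub_neg.2 h) hA
      rw [h2, ← mul_assoc]
      have h4 : ¬ (V v 0 < a) := not_lt.2 h.le
      have h5 : 0 < (a - V v 0) * A * sin (Φ v a) ↔ sin (Φ v a) < 0 := by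
        constructor
        · intro h6
          by_contra h7
          nlinarith
        · exact fun h6 => mul_pos_of_neg_of_neg h3 h6
      rw [h5]
      simp only [h4, false_iff, not_lt]
      refine ⟨le_of_lt, fun h6 => h6.lt_of_ne fun h7 => hPa ?_⟩
      rw [h2, ← h7, mul_zero, mul_zero]
    · have h3 : 0 < (a - V v 0) * A := mul_pos (sub_pos.2 h) hA
      rw [h2, ← mul_assoc]
      simp only [h, true_iff]
      exact (mul_pos_iff_of_pos_left h3).symm
  -- At another equilibrium, the angle is determined by the zero number.
  have hneg : ∀ v w, (zeroNumber fun x : unitInterval => V v x - V w x)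
      = zeroNumber fun x : unitInterval => V w x - V v x := fun v w =>
    zeroNumber_const_mul (d := -1) (by norm_num) (fun x => by ring)
  have hsymm : ∀ v w, Z v w = Z w v := fun v w => by rw [hZ, hZ, hneg]
  have hΦZ : ∀ v w, v ≠ w → Φ v (V w 0) = -(Z v w * π) ∧
      (zeroNumber fun x : unitInterval => V v x - V w x) = Z v w := by
    intro v w hvw
    have hne := hV0 w v hvw.symm
    obtain ⟨A, hA, -, h2⟩ := hP1 v _ hne
    rw [(hVU w 1 (by simp)).2, H.right w] at h2
    have h3 : sin (Φ v (V w 0)) = 0 := by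
      have := (mul_eq_zero.1 h2.symm).resolve_left (sub_ne_zero.2 hne)
      exact (mul_eq_zero.1 this).resolve_left hA.ne'
    obtain ⟨k, hk⟩ := exists_nat_of_sin_eq_zero h3 (hΦ v _ hne).1
    have h4 := (hΦ v _ hne).2.2.1 k hk
    have h5 : (fun x : unitInterval => U (V w 0) x - V v x) = fun x : unitInterval =>
        V w x - V v x := by
      funext x
      rw [(hVU w x x.2).1]
    rw [h5, hneg] at h4
    have h6 : Z v w = k := by rw [hZ, h4, ENat.toNat_natCast]
    rw [h6]
    exact ⟨hk, h4⟩
  have hparity : ∀ v w, p v < p w → (Even (Z v w) ↔ q v < q w) := by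
    intro v w hvw
    have hne : v ≠ w := fun e => by rw [e] at hvw; exact lt_irrefl _ hvw
    obtain ⟨A, hA, h1, -⟩ := hP1 v _ (hV0 w v hne.symm)
    rw [(hVU w 1 (by simp)).1, (hΦZ v w hne).1, cos_neg, cos_nat_mul_pi] at h1
    have h2 := mul_pos (sub_pos.2 ((H.lt_iff v w).1 hvw)) hA
    rw [H.lt_iff', ← sub_pos, h1, ← mul_assoc]
    rcases Nat.even_or_odd (Z v w) with h | h
    · simp only [h, h.neg_one_pow, mul_one, h2]
    · simp only [Nat.not_even_iff_odd.2 h, h.neg_one_pow, false_iff, not_lt]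
      linarith
  -- Between consecutive equilibria, the shooting curve does not meet the axis.
  have hgap : ∀ w w', p w' = p w + 1 → ∀ a ∈ Ioo (V w 0) (V w' 0), P a 1 ≠ 0 ∧
      ∀ v, a ≠ V v 0 ∧ (V v 0 < a ↔ p v ≤ p w) := by
    intro w w' hww a ha
    have key : ∀ v, a ≠ V v 0 ∧ (V v 0 < a ↔ p v ≤ p w) := by
      intro v
      by_cases h : p v ≤ p w
      · have h1 : V v 0 ≤ V w 0 := by
          by_contra h2
          exact absurd ((H.lt_iff w v).2 (not_le.1 h2)) (by lia)
        exact ⟨(h1.trans_lt ha.1).ne', by simp [h, h1.trans_lt ha.1]⟩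
      · have h1 : V w' 0 ≤ V v 0 := by
          by_contra h2
          exact absurd ((H.lt_iff v w').2 (not_le.1 h2)) (by lia)
        exact ⟨(ha.2.trans_le h1).ne, by simp [h, (ha.2.trans_le h1).le]⟩
    refine ⟨fun h0 => ?_, key⟩
    obtain ⟨v, hv⟩ := hzero a h0
    exact (key v).1 hv.symm
  have hint : ∀ v w w', p w' = p w + 1 → ∃ m : ℤ,
      (∀ a ∈ Ioo (V w 0) (V w' 0), Even m ↔ (p v ≤ p w ↔ 0 < P a 1)) ∧
      ∀ a ∈ Icc (V w 0) (V w' 0), m * π ≤ Φ v a ∧ Φ v a ≤ (m + 1) * π := by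
    intro v w w' hww
    have hlt := (H.lt_iff w w').1 (by lia)
    obtain ⟨m, h1, h2⟩ := exists_int_of_gap (hΦc v) hlt (fun a ha => by
      obtain ⟨h3, h4⟩ := hgap w w' hww a ha
      exact (hsinpos v a (h4 v).1 h3).1)
    refine ⟨m, fun a ha => ?_, h2⟩
    obtain ⟨h3, h4⟩ := hgap w w' hww a ha
    rw [← sin_pos_iff_even (h1 a ha).1 (h1 a ha).2, (hsinpos v a (h4 v).1 h3).2, (h4 v).2]
  have hmid : ∀ w w', p w' = p w + 1 → ∃ a, a ∈ Ioo (V w 0) (V w' 0) := fun w w' hww =>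
    nonempty_Ioo.2 ((H.lt_iff w w').1 (by lia))
  have hturn : ∀ v (m : ℤ), m * π ≤ Φ v (V v 0) → Φ v (V v 0) ≤ (m + 1) * π → m = -ρ v := by
    intro v m h1 h2
    rw [hΦ0] at h1 h2
    obtain ⟨h3, h4⟩ := H.turns v
    exact (int_eq_of_mem (m := -ρ v) (by push_cast; linarith) (by push_cast; linarith) h1 h2).symm
  have hstart : ∀ v, p v = 0 → ρ v = 0 := by
    intro v hv
    -- Start below all equilibria.
    set a₀ := min (V v 0) (-R - M) - 1 with ha₀
    have h1 : a₀ < V v 0 := by have := min_le_left (V v 0) (-R - M); linarith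
    have h2 : a₀ < -R - M := by have := min_le_right (V v 0) (-R - M); linarith
    have hneg := hg.neg_of_sign H.sign (hU a₀) (hP0 a₀) (by rw [hU0]; exact h2.le)
    have hPne : ∀ a, a < V v 0 → P a 1 ≠ 0 := by
      intro a ha h0
      obtain ⟨w, hw⟩ := hzero a h0
      rw [← hw] at ha
      have := (H.lt_iff w v).2 ha
      have := H.nonneg w
      lia
    have hP : P a₀ 1 < 0 := (hneg 1 (by simp)).2.lt_of_ne (hPne a₀ h1)
    obtain ⟨m, h3, h4⟩ := exists_int_of_gap (hΦc v) h1
      (fun a ha => (hsinpos v a ha.2.ne (hPne a ha.2)).1)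
    have h5 : 0 < sin (Φ v a₀) := (hsinpos v a₀ h1.ne hP.ne).2.2
      (by simp [not_lt.2 h1.le, not_lt.2 hP.le])
    have h6 := (hΦ v a₀ h1.ne).1
    have h7 := (hΦ v a₀ h1.ne).2.2.2 (fun x hx => div_pos_of_neg_of_neg
      (by have := (hneg x hx).1; have := (abs_lt.1 (H.bound v x hx)).1; linarith) (sub_neg.2 h1))
    have h8 : 0 < Φ v a₀ := by
      by_contra h8
      exact absurd h5 (not_lt.2 (sin_nonpos_of_nonpos_of_neg_pi_le (not_lt.1 h8) (by linarith)))
    have h9 := h4 a₀ ⟨le_rfl, h1.le⟩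
    have h10 : (0 : ℤ) = m := int_eq_of_mem (t := Φ v a₀) (by simpa using h8)
      (by push_cast; linarith) h9.1 h9.2
    have h11 := h4 (V v 0) ⟨h1.le, le_rfl⟩
    have := hturn v m h11.1 h11.2
    lia
  have hinduct : ∀ {C : E → Prop}, (∀ v, p v = 0 → C v) →
      (∀ w w', p w' = p w + 1 → C w → C w') → ∀ v, C v := by
    intro C h0 h1 v
    have key : ∀ (k : ℕ) (v : E), p v = k → C v := by
      intro k
      induction k with
      | zero => exact fun v hv => h0 v (by simpa using hv)
      | succ k ih =>
        intro v hv
        have := H.le v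
        obtain ⟨w, hw⟩ := H.surj k (by lia) (by lia)
        exact h1 w v (by push_cast at hv; lia) (ih w hw)
    exact key (p v).toNat v (by have := H.nonneg v; lia)
  -- The gaps to the right and to the left of an equilibrium have opposite signs.
  have hsideR : ∀ w w', p w' = p w + 1 → ∀ a ∈ Ioo (V w 0) (V w' 0), Even (ρ w) ↔ 0 < P a 1 := by
    intro w w' hww a ha
    have hlt := (H.lt_iff w w').1 (by lia)
    obtain ⟨m, h1, h2⟩ := hint w w w' hww
    have h3 := h2 (V w 0) ⟨le_rfl, hlt.le⟩
    have h4 := hturn w m h3.1 h3.2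
    have h5 := h1 a ha
    rw [h4, even_neg, Int.even_coe_nat] at h5
    simpa using h5
  have hsideL : ∀ w w', p w' = p w + 1 → ∀ a ∈ Ioo (V w 0) (V w' 0),
      Even (ρ w') ↔ ¬ 0 < P a 1 := by
    intro w w' hww a ha
    have hlt := (H.lt_iff w w').1 (by lia)
    obtain ⟨m, h1, h2⟩ := hint w' w w' hww
    have h3 := h2 (V w' 0) ⟨hlt.le, le_rfl⟩
    have h4 := hturn w' m h3.1 h3.2
    have h5 := h1 a ha
    rw [h4, even_neg, Int.even_coe_nat, hww] at h5
    simpa using h5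
  have hρp : ∀ v, Even (ρ v) ↔ Even (p v) := by
    refine hinduct (fun v hv => by rw [hv, hstart v hv]; simp) (fun w w' hww ih => ?_)
    obtain ⟨a, ha⟩ := hmid w w' hww
    rw [hsideL w w' hww a ha, ← hsideR w w' hww a ha, ih, hww, Int.even_add_one]
  have hstep : ∀ v w w', p w' = p w + 1 → w ≠ v → w' ≠ v → ∃ m : ℤ,
      (Even m ↔ (p v < p w ↔ Even (p w))) ∧ ((Z v w : ℤ) = -m ∨ (Z v w : ℤ) = -m - 1) ∧
      ((Z v w' : ℤ) = -m ∨ (Z v w' : ℤ) = -m - 1) := by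
    intro v w w' hww hw hw'
    have hlt := (H.lt_iff w w').1 (by lia)
    obtain ⟨m, h1, h2⟩ := hint v w w' hww
    obtain ⟨a, ha⟩ := hmid w w' hww
    have h3 := h2 (V w 0) ⟨le_rfl, hlt.le⟩
    have h4 := h2 (V w' 0) ⟨hlt.le, le_rfl⟩
    rw [(hΦZ v w hw.symm).1] at h3
    rw [(hΦZ v w' hw'.symm).1] at h4
    refine ⟨m, ?_, int_mem_of_mul_pi h3.1 h3.2, int_mem_of_mul_pi h4.1 h4.2⟩
    have h5 : p v ≠ p w := fun e => hw (H.inj e).symm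
    rw [h1 a ha, ← hsideR w w' hww a ha, hρp w, show p v ≤ p w ↔ p v < p w by lia]
  have hmorse : ∀ w w', p w' = p w + 1 →
      ((Z w w' : ℤ) = ρ w ∨ (Z w w' : ℤ) = ρ w - 1) ∧
      ((Z w w' : ℤ) = ρ w' ∨ (Z w w' : ℤ) = ρ w' - 1) := by
    intro w w' hww
    have hlt := (H.lt_iff w w').1 (by lia)
    have hne : w ≠ w' := fun e => by rw [e] at hlt; exact lt_irrefl _ hlt
    obtain ⟨m, -, h2⟩ := hint w w w' hww
    obtain ⟨m', -, h2'⟩ := hint w' w w' hww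
    have h3 := h2 (V w 0) ⟨le_rfl, hlt.le⟩
    have h4 := h2 (V w' 0) ⟨hlt.le, le_rfl⟩
    have h3' := h2' (V w' 0) ⟨hlt.le, le_rfl⟩
    have h4' := h2' (V w 0) ⟨le_rfl, hlt.le⟩
    rw [(hΦZ w w' hne).1] at h4
    rw [(hΦZ w' w hne.symm).1, hsymm] at h4'
    have h5 := hturn w m h3.1 h3.2
    have h5' := hturn w' m' h3'.1 h3'.2
    have h6 := int_mem_of_mul_pi h4.1 h4.2
    have h6' := int_mem_of_mul_pi h4'.1 h4'.2
    lia
  refine ⟨?_, hstart, fun v w hvw => (hΦZ v w hvw).2⟩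
  exact .of_steps H.nonneg H.le H.surj H.inj H.inj' hsymm hparity hρp hstep hmorse

/-! ### A priori bounds and truncation -/

theorem pos_of_sign {g : ℝ → ℝ → ℝ → ℝ} {R : ℝ}
    (hR : ∀ x ∈ Icc (0 : ℝ) 1, ∀ u : ℝ, R ≤ |u| → u * g x u 0 < 0) : 0 < R := by
  by_contra h
  have := hR 0 (by simp) 0 (by simpa using h)
  simp at this

/-- The maximum principle. -/
theorem IsSol.abs_lt {g : ℝ → ℝ → ℝ → ℝ} {V Q : ℝ → ℝ} {R : ℝ} (h : IsSol g V Q) (h0 : Q 0 = 0)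
    (h1 : Q 1 = 0) (hR : ∀ x ∈ Icc (0 : ℝ) 1, ∀ u : ℝ, R ≤ |u| → u * g x u 0 < 0) :
    ∀ x ∈ Icc (0 : ℝ) 1, |V x| < R := by
  have hcV := h.1.continuousOn
  obtain ⟨y, hy, hmax⟩ := isCompact_Icc.exists_isMaxOn (nonempty_Icc.2 zero_le_one)
    (hcV.pow 2)
  have hmax' : ∀ x ∈ Icc (0 : ℝ) 1, V x ^ 2 ≤ V y ^ 2 := fun x hx => hmax hx
  intro x hx
  refine (sq_le_sq.1 (hmax' x hx)).trans_lt ?_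
  by_contra hcon
  have hs : ∀ (hQ : Q y = 0), V y * g y (V y) (Q y) < 0 := fun hQ => by
    rw [hQ]
    exact hR y hy _ (not_lt.1 hcon)
  have hV : V y ≠ 0 := by
    intro hV
    have := pos_of_sign hR
    rw [hV, abs_zero] at hcon
    exact hcon this
  have hW : DerivOn (fun x => V x ^ 2) (fun x => 2 * (V x * Q x)) := fun x hx =>
    ((h.1 x hx).pow 2).congr_deriv (by simp; ring)
  have hQ : Q y = 0 := by
    rcases eq_or_lt_of_le hy.1 with e | hy0
    · rw [← e, h0]
    rcases eq_or_lt_of_le hy.2 with e | hy1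
    · rw [e, h1]
    have hn : Icc (0 : ℝ) 1 ∈ nhds y := Icc_mem_nhds hy0 hy1
    have := (hmax.isLocalMax hn).hasDerivAt_eq_zero ((hW y hy).hasDerivAt hn)
    simpa [hV] using this
  have hk : HasDerivWithinAt (fun x => V x * Q x) (-(V y * g y (V y) (Q y))) (Icc 0 1) y :=
    ((h.1 y hy).mul (h.2 y hy)).congr_deriv (by simp only [hQ]; ring)
  -- The derivative of `V²` is increasing at its zero `y`.
  have hsl : ∀ᶠ x in nhdsWithin y (Icc 0 1 \ {y}), 0 < slope (fun x => V x * Q x) y x :=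
    (hasDerivWithinAt_iff_tendsto_slope.1 hk).eventually_const_lt (neg_pos.2 (hs hQ))
  rw [eventually_nhdsWithin_iff, Metric.eventually_nhds_iff] at hsl
  obtain ⟨ε, hε, hsl⟩ := hsl
  have hsl' : ∀ x ∈ Icc (0 : ℝ) 1, x ≠ y → |x - y| < ε → 0 < V x * Q x * (x - y) := by
    intro x hx hxy hd
    have h2 := hsl hd ⟨hx, hxy⟩
    rw [slope_def_field, hQ, mul_zero, sub_zero] at h2
    have h3 := mul_pos h2 (pow_pos (abs_pos.2 (sub_ne_zero.2 hxy)) 2)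
    rw [sq_abs] at h3
    have h4 := sub_ne_zero.2 hxy
    field_simp at h3
    linarith
  rcases lt_or_ge y 1 with hy1 | hy1
  · obtain ⟨z, hz, hz'⟩ : ∃ z, y < z ∧ z < min 1 (y + ε) :=
      exists_between (lt_min hy1 (by linarith))
    have hz1 := hz'.trans_le (min_le_left _ _)
    have hz2 := hz'.trans_le (min_le_right _ _)
    obtain ⟨ξ, hξ, he⟩ := exists_hasDerivAt_eq_slope (fun x => V x ^ 2) (fun x => 2 * (V x * Q x))
      hz (hW.continuousOn.mono (Icc_subset_Icc hy.1 hz1.le)) (fun t ht =>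
        (hW t ⟨hy.1.trans ht.1.le, (ht.2.trans hz1).le⟩).hasDerivAt
          (Icc_mem_nhds (hy.1.trans_lt ht.1) (ht.2.trans hz1)))
    have h2 := hsl' ξ ⟨hy.1.trans hξ.1.le, (hξ.2.trans hz1).le⟩ hξ.1.ne' (by
      rw [abs_of_pos (sub_pos.2 hξ.1)]; linarith [hξ.2])
    have h3 := pos_of_mul_pos_left h2 (sub_pos.2 hξ.1).le
    rw [eq_div_iff (sub_pos.2 hz).ne'] at he
    have h4 := hmax' z ⟨hy.1.trans hz.le, hz1.le⟩
    have h5 := mul_pos h3 (sub_pos.2 hz)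
    linarith
  · obtain ⟨z, hz', hz⟩ : ∃ z, max 0 (y - ε) < z ∧ z < y :=
      exists_between (max_lt (by linarith) (by linarith))
    have hz1 := (le_max_left _ _).trans_lt hz'
    have hz2 := (le_max_right _ _).trans_lt hz'
    obtain ⟨ξ, hξ, he⟩ := exists_hasDerivAt_eq_slope (fun x => V x ^ 2) (fun x => 2 * (V x * Q x))
      hz (hW.continuousOn.mono (Icc_subset_Icc hz1.le hy.2)) (fun t ht =>
        (hW t ⟨(hz1.trans ht.1).le, ht.2.le.trans hy.2⟩).hasDerivAt
          (Icc_mem_nhds (hz1.trans ht.1) (ht.2.trans_le hy.2)))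
    have h2 := hsl' ξ ⟨(hz1.trans hξ.1).le, hξ.2.le.trans hy.2⟩ hξ.2.ne (by
      rw [abs_sub_comm, abs_of_pos (sub_pos.2 hξ.2)]; linarith [hξ.1])
    have h3 : V ξ * Q ξ < 0 := by
      by_contra h4
      have := mul_nonneg (not_lt.1 h4) (sub_pos.2 hξ.2).le
      linarith
    rw [eq_div_iff (sub_pos.2 hz).ne'] at he
    have h4 := hmax' z ⟨hz1.le, hz.le.trans hy.2⟩
    have h5 := mul_neg_of_neg_of_pos h3 (sub_pos.2 hz)
    linarith

/-- Nagumo's bound for the derivative of a solution, under a quadratic growth condition. -/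
theorem IsSol.abs_deriv_le {g : ℝ → ℝ → ℝ → ℝ} {V Q : ℝ → ℝ} {R C : ℝ} (h : IsSol g V Q)
    (h0 : Q 0 = 0) (hV : ∀ x ∈ Icc (0 : ℝ) 1, |V x| ≤ R)
    (hC : ∀ x ∈ Icc (0 : ℝ) 1, ∀ u : ℝ, |u| ≤ R → ∀ p : ℝ, |g x u p| ≤ C * (1 + p ^ 2)) :
    ∀ x ∈ Icc (0 : ℝ) 1, |Q x| ≤ exp (2 * R * C) := by
  have key : ∀ (g : ℝ → ℝ → ℝ → ℝ) (V Q : ℝ → ℝ), IsSol g V Q → Q 0 = 0 →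
      (∀ x ∈ Icc (0 : ℝ) 1, |V x| ≤ R) →
      (∀ x ∈ Icc (0 : ℝ) 1, ∀ u : ℝ, |u| ≤ R → ∀ p : ℝ, |g x u p| ≤ C * (1 + p ^ 2)) →
      ∀ y ∈ Icc (0 : ℝ) 1, 0 < Q y → Q y ≤ exp (2 * R * C) := by
    intro g V Q h h0 hV hC y hy hQy
    have hC0 : 0 ≤ C := by
      have := (abs_nonneg _).trans (hC 0 (by simp) (V 0) (hV 0 (by simp)) 0)
      simpa using this
    have hcQ := h.2.continuousOn
    -- Integrate from the last zero of `Q` to the left of `y`.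
    have hsub : Icc 0 y ⊆ Icc (0 : ℝ) 1 := Icc_subset_Icc_right hy.2
    obtain ⟨z, ⟨hz, hz0⟩, hzmax⟩ : ∃ z, IsGreatest (Icc 0 y ∩ Q ⁻¹' {0}) z := by
      refine IsCompact.exists_isGreatest ?_ ⟨0, ⟨le_rfl, hy.1⟩, h0⟩
      exact isCompact_Icc.of_isClosed_subset
        ((hcQ.mono hsub).preimage_isClosed_of_isClosed isClosed_Icc isClosed_singleton)
        inter_subset_left
    have hz0 : Q z = 0 := hz0
    have hsub' : Icc z y ⊆ Icc (0 : ℝ) 1 := Icc_subset_Icc hz.1 hy.2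
    have hpos : ∀ x ∈ Icc z y, 0 ≤ Q x := by
      intro x hx
      by_contra hneg
      obtain ⟨t, ht, ht0⟩ := intermediate_value_Icc hx.2
        (hcQ.mono (Icc_subset_Icc (hz.1.trans hx.1) hy.2)) ⟨(not_le.1 hneg).le, hQy.le⟩
      have h2 := hzmax ⟨⟨hz.1.trans (hx.1.trans ht.1), ht.2⟩, ht0⟩
      have h3 : x = z := le_antisymm (ht.1.trans h2) hx.1
      rw [h3, hz0] at hneg
      exact hneg le_rfl
    have hd : ∀ x ∈ Icc (0 : ℝ) 1, HasDerivWithinAt (fun x => log (1 + Q x ^ 2) - 2 * C * V x)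
        (2 * Q x * (-g x (V x) (Q x)) / (1 + Q x ^ 2) - 2 * C * Q x) (Icc 0 1) x := by
      intro x hx
      have h2 : HasDerivWithinAt (fun x => 1 + Q x ^ 2) (2 * Q x * (-g x (V x) (Q x)))
          (Icc 0 1) x := (((h.2 x hx).pow 2).const_add 1).congr_deriv (by simp)
      exact (h2.log (by positivity)).sub ((h.1 x hx).const_mul (2 * C))
    have hanti : AntitoneOn (fun x => log (1 + Q x ^ 2) - 2 * C * V x) (Icc z y) := by
      refine antitoneOn_of_hasDerivWithinAt_nonpos (convex_Icc z y)
        (fun x hx => (hd x (hsub' hx)).continuousWithinAt.mono hsub')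
        (fun x hx => (hd x (hsub' (interior_subset hx))).mono (interior_subset.trans hsub'))
        (fun x hx => ?_)
      have hx' := interior_subset hx
      have h2 := hpos x hx'
      have h3 := neg_le_of_abs_le (hC x (hsub' hx') (V x) (hV x (hsub' hx')) (Q x))
      have h4 : (0 : ℝ) < 1 + Q x ^ 2 := by positivity
      rw [sub_nonpos, div_le_iff₀ h4]
      nlinarith [mul_le_mul_of_nonneg_left h3 h2]
    have h2 := hanti ⟨le_rfl, hz.2⟩ ⟨hz.2, le_rfl⟩ hz.2
    simp only [hz0] at h2
    have h3 := abs_le.1 (hV y hy)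
    have h4 := abs_le.1 (hV z (hsub hz))
    have h5 : log (1 + Q y ^ 2) ≤ 2 * (2 * R * C) := by
      simp only [ne_eq, OfNat.ofNat_ne_zero, not_false_eq_true, zero_pow, add_zero, log_one] at h2
      nlinarith [mul_le_mul_of_nonneg_left h3.2 hC0, mul_le_mul_of_nonneg_left h4.1 hC0]
    rw [log_le_iff_le_exp (by positivity)] at h5
    refine le_of_sq_le_sq ?_ (exp_pos _).le
    rw [← exp_nat_mul]
    push_cast
    linarith
  intro x hx
  rcases lt_trichotomy (Q x) 0 with hQ | hQ | hQ
  · rw [abs_of_neg hQ]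
    refine key (fun x u p => -g x (-u) (-p)) (fun x => -V x) (fun x => -Q x)
      ⟨fun x hx => (h.1 x hx).neg, fun x hx => (h.2 x hx).neg.congr_deriv (by simp)⟩ (by simp [h0])
      (fun x hx => by simpa using hV x hx) (fun x hx u hu p => ?_) x hx (by simpa using hQ)
    simpa using hC x hx (-u) (by simpa using hu) (-p)
  · rw [hQ, abs_zero]
    positivity
  · rw [abs_of_pos hQ]
    exact key g V Q h h0 hV hC x hx hQ

theorem uniqueDiffOn_strip :
    UniqueDiffOn ℝ (Icc (0 : ℝ) 1 ×ˢ (univ : Set (ℝ × ℝ))) :=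
  (uniqueDiffOn_Icc zero_lt_one).prod uniqueDiffOn_univ

/-- `C¹` functions on the strip are Lipschitz continuous on boxes. -/
theorem exists_lipschitz_box {H : Type*} [NormedAddCommGroup H] [NormedSpace ℝ H]
    {G : ℝ × ℝ × ℝ → H} (hG : ContDiffOn ℝ 1 G (Icc 0 1 ×ˢ univ)) (a k : ℝ) :
    ∃ K : ℝ, 0 ≤ K ∧ ∀ y ∈ Icc (0 : ℝ) 1 ×ˢ (Icc (-a) a ×ˢ Icc (-k) k),
      ∀ z ∈ Icc (0 : ℝ) 1 ×ˢ (Icc (-a) a ×ˢ Icc (-k) k), ‖G y - G z‖ ≤ K * ‖y - z‖ := by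
  obtain ⟨K, hK⟩ := (hG.mono (prod_mono_right (subset_univ
    (Icc (-a) a ×ˢ Icc (-k) k)))).exists_lipschitzOnWith one_ne_zero
    ((convex_Icc _ _).prod ((convex_Icc _ _).prod (convex_Icc _ _)))
    (isCompact_Icc.prod (isCompact_Icc.prod isCompact_Icc))
  exact ⟨K, K.2, fun y hy z hz => hK.norm_sub_le hy hz⟩

theorem mem_strip {x u p : ℝ} (hx : x ∈ Icc (0 : ℝ) 1) :
    (x, u, p) ∈ Icc (0 : ℝ) 1 ×ˢ (univ : Set (ℝ × ℝ)) :=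
  ⟨hx, mem_univ _⟩

theorem IsC2Nonlinearity.hasFDerivWithinAt {f : ℝ → ℝ → ℝ → ℝ} (hf : IsC2Nonlinearity f)
    {z : ℝ × ℝ × ℝ} (hz : z ∈ Icc (0 : ℝ) 1 ×ˢ (univ : Set (ℝ × ℝ))) :
    HasFDerivWithinAt (fun q : ℝ × ℝ × ℝ => f q.1 q.2.1 q.2.2)
      (fderivWithin ℝ (fun q : ℝ × ℝ × ℝ => f q.1 q.2.1 q.2.2) (Icc 0 1 ×ˢ univ) z)
      (Icc 0 1 ×ˢ univ) z :=
  (hf.differentiableOn two_ne_zero z hz).hasFDerivWithinAt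

theorem IsC2Nonlinearity.deriv_right {f : ℝ → ℝ → ℝ → ℝ} (hf : IsC2Nonlinearity f) {x : ℝ}
    (hx : x ∈ Icc (0 : ℝ) 1) (u p : ℝ) : deriv (fun p => f x u p) p
      = fderivWithin ℝ (fun q : ℝ × ℝ × ℝ => f q.1 q.2.1 q.2.2) (Icc 0 1 ×ˢ univ) (x, u, p)
        (0, 0, 1) := by
  have h1 : HasDerivAt (fun p : ℝ => (x, u, p)) (0, 0, 1) p :=
    (hasDerivAt_const p x).prodMk ((hasDerivAt_const p u).prodMk (hasDerivAt_id p))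
  exact ((hf.hasFDerivWithinAt (mem_strip hx)).comp_hasDerivAt p h1
    (Filter.Eventually.of_forall fun _ => mem_strip hx)).deriv

theorem IsC2Nonlinearity.deriv_middle {f : ℝ → ℝ → ℝ → ℝ} (hf : IsC2Nonlinearity f) {x : ℝ}
    (hx : x ∈ Icc (0 : ℝ) 1) (u p : ℝ) : deriv (fun u => f x u p) u
      = fderivWithin ℝ (fun q : ℝ × ℝ × ℝ => f q.1 q.2.1 q.2.2) (Icc 0 1 ×ˢ univ) (x, u, p)
        (0, 1, 0) := by
  have h1 : HasDerivAt (fun u : ℝ => (x, u, p)) (0, 1, 0) u :=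
    (hasDerivAt_const u x).prodMk ((hasDerivAt_id u).prodMk (hasDerivAt_const u p))
  exact ((hf.hasFDerivWithinAt (mem_strip hx)).comp_hasDerivAt u h1
    (Filter.Eventually.of_forall fun _ => mem_strip hx)).deriv

theorem IsC2Nonlinearity.continuousOn_fderivWithin {f : ℝ → ℝ → ℝ → ℝ} (hf : IsC2Nonlinearity f)
    {V Q : ℝ → ℝ} (hV : ContinuousOn V (Icc 0 1)) (hQ : ContinuousOn Q (Icc 0 1))
    (e : ℝ × ℝ × ℝ) : ContinuousOn (fun x => fderivWithin ℝ
      (fun q : ℝ × ℝ × ℝ => f q.1 q.2.1 q.2.2) (Icc 0 1 ×ˢ univ) (x, V x, Q x) e) (Icc 0 1) :=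
  ((ContDiffOn.continuousOn_fderivWithin hf uniqueDiffOn_strip one_le_two).comp
    (g := fderivWithin ℝ (fun q : ℝ × ℝ × ℝ => f q.1 q.2.1 q.2.2) (Icc 0 1 ×ˢ univ))
    (f := fun x => (x, V x, Q x)) (by fun_prop) (fun x hx => mem_strip hx)).clm_apply
    continuousOn_const

/-- The coefficient `f_p` of the linearization at `V`, `Q = V_x`. -/
noncomputable def coeffP (f : ℝ → ℝ → ℝ → ℝ) (V Q : ℝ → ℝ) : ℝ → ℝ :=
  fun x => deriv (fun p => f x (V x) p) (Q x)

/-- The coefficient `f_u` of the linearization at `V`, `Q = V_x`. -/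
noncomputable def coeffU (f : ℝ → ℝ → ℝ → ℝ) (V Q : ℝ → ℝ) : ℝ → ℝ :=
  fun x => deriv (fun u => f x u (Q x)) (V x)

theorem IsC2Nonlinearity.continuousOn_coeffP {f : ℝ → ℝ → ℝ → ℝ} (hf : IsC2Nonlinearity f)
    {V Q : ℝ → ℝ} (hV : ContinuousOn V (Icc 0 1)) (hQ : ContinuousOn Q (Icc 0 1)) :
    ContinuousOn (coeffP f V Q) (Icc 0 1) :=
  (hf.continuousOn_fderivWithin hV hQ (0, 0, 1)).congr fun _ hx => hf.deriv_right hx _ _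

theorem IsC2Nonlinearity.continuousOn_coeffU {f : ℝ → ℝ → ℝ → ℝ} (hf : IsC2Nonlinearity f)
    {V Q : ℝ → ℝ} (hV : ContinuousOn V (Icc 0 1)) (hQ : ContinuousOn Q (Icc 0 1)) :
    ContinuousOn (coeffU f V Q) (Icc 0 1) :=
  (hf.continuousOn_fderivWithin hV hQ (0, 1, 0)).congr fun _ hx => hf.deriv_middle hx _ _

/-- Quadratic error of the linearization, uniformly on boxes. -/
theorem IsC2Nonlinearity.exists_linear_bound {f : ℝ → ℝ → ℝ → ℝ} (hf : IsC2Nonlinearity f)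
    (a k : ℝ) : ∃ D, ∀ x ∈ Icc (0 : ℝ) 1, ∀ u p u' p' : ℝ, |u| ≤ a → |u'| ≤ a → |p| ≤ k →
      |p'| ≤ k → |f x u' p' - f x u p - (deriv (fun p => f x u p) p * (p' - p)
        + deriv (fun u => f x u p) u * (u' - u))| ≤ D * max |u' - u| |p' - p| ^ 2 := by
  obtain ⟨D, hD0, hD⟩ := exists_lipschitz_box (ContDiffOn.fderivWithin hf uniqueDiffOn_strip
    (m := 1) (by norm_num)) a k
  refine ⟨D, fun x hx u p u' p' hu hu' hp hp' => ?_⟩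
  set F := fun q : ℝ × ℝ × ℝ => f q.1 q.2.1 q.2.2 with hF
  set F' := fderivWithin ℝ F (Icc 0 1 ×ˢ univ) with hF'
  have hbox : Convex ℝ (Icc (0 : ℝ) 1 ×ˢ (Icc (-a) a ×ˢ Icc (-k) k)) :=
    (convex_Icc _ _).prod ((convex_Icc _ _).prod (convex_Icc _ _))
  have hy : (x, u, p) ∈ Icc (0 : ℝ) 1 ×ˢ (Icc (-a) a ×ˢ Icc (-k) k) :=
    ⟨hx, abs_le.1 hu, abs_le.1 hp⟩
  have hz : (x, u', p') ∈ Icc (0 : ℝ) 1 ×ˢ (Icc (-a) a ×ˢ Icc (-k) k) :=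
    ⟨hx, abs_le.1 hu', abs_le.1 hp'⟩
  have hseg := hbox.segment_subset hy hz
  have hstrip : segment ℝ (x, u, p) (x, u', p') ⊆ Icc (0 : ℝ) 1 ×ˢ (univ : Set (ℝ × ℝ)) :=
    hseg.trans (prod_mono_right (subset_univ _))
  have h1 := (convex_segment (x, u, p) (x, u', p')).norm_image_sub_le_of_norm_hasFDerivWithin_le'
    (f := F) (f' := F') (φ := F' (x, u, p)) (C := D * ‖((x, u', p') : ℝ × ℝ × ℝ) - (x, u, p)‖)
    (fun z hz => (hf.hasFDerivWithinAt (hstrip hz)).mono hstrip) (fun z hz =>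
      (hD z (hseg hz) _ hy).trans (mul_le_mul_of_nonneg_left (norm_sub_le_of_mem_segment hz) hD0))
    (left_mem_segment _ _ _) (right_mem_segment _ _ _)
  have h2 : ((x, u', p') : ℝ × ℝ × ℝ) - (x, u, p)
      = (u' - u) • ((0, 1, 0) : ℝ × ℝ × ℝ) + (p' - p) • ((0, 0, 1) : ℝ × ℝ × ℝ) := by
    ext <;> simp
  have h3 : ‖((x, u', p') : ℝ × ℝ × ℝ) - (x, u, p)‖ = max |u' - u| |p' - p| := by
    simp [Prod.norm_def]
  rw [h3, h2, map_add, map_smul, map_smul, ← hf.deriv_right hx, ← hf.deriv_middle hx] at h1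
  simp only [hF, smul_eq_mul, norm_eq_abs] at h1
  rw [mul_assoc, ← sq] at h1
  convert h1 using 3
  ring

/-- A dissipative nonlinearity may be replaced by a tame one, without changing the equilibria and
their linearizations. -/
theorem exists_truncation {f : ℝ → ℝ → ℝ → ℝ} (hf : IsC2Nonlinearity f) (hdiss : IsDissipative f) :
    ∃ (g : ℝ → ℝ → ℝ → ℝ) (L M R : ℝ), IsTame g L M ∧
      (∀ x ∈ Icc (0 : ℝ) 1, ∀ u ≤ -R, 0 < g x u 0) ∧
      (∀ V Q : ℝ → ℝ, Q 0 = 0 → Q 1 = 0 → (IsSol f V Q ↔ IsSol g V Q)) ∧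
      ∀ V Q : ℝ → ℝ, Q 0 = 0 → Q 1 = 0 → IsSol f V Q →
        (∀ x ∈ Icc (0 : ℝ) 1, |V x| < R) ∧ ∃ D, ∀ x ∈ Icc (0 : ℝ) 1, ∀ u p,
          |u - V x| ≤ 1 → |p - Q x| ≤ 1 → |g x u p - g x (V x) (Q x)
            - (coeffP f V Q x * (p - Q x) + coeffU f V Q x * (u - V x))|
              ≤ D * max |u - V x| |p - Q x| ^ 2 := by
  obtain ⟨⟨R, hR⟩, hgrow⟩ := hdiss
  obtain ⟨C, hC⟩ := hgrow R
  have hRpos := pos_of_sign hR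
  set k := exp (2 * R * C) with hk
  have hkpos : 0 < k := exp_pos _
  have ha : 0 ≤ R + 1 := by linarith
  have hk1 : 0 ≤ k + 1 := by linarith
  -- Cut off at distance `1` from the a priori bounds, so that the nonlinearity remains unchanged
  -- near all Neumann solutions.
  set T : ℝ × ℝ × ℝ → ℝ × ℝ × ℝ := fun z => (max 0 (min 1 z.1),
    max (-(R + 1)) (min (R + 1) z.2.1), max (-(k + 1)) (min (k + 1) z.2.2)) with hT
  have hTbox : ∀ z, T z ∈ Icc (0 : ℝ) 1 ×ˢ (Icc (-(R + 1)) (R + 1) ×ˢ Icc (-(k + 1)) (k + 1)) :=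
    fun z => ⟨⟨le_max_left _ _, max_le zero_le_one (min_le_left _ _)⟩, abs_le.1 (abs_clip_le ha),
      abs_le.1 (abs_clip_le hk1)⟩
  have hTc : Continuous T := by
    simp only [hT]
    fun_prop
  have hx01 : ∀ x ∈ Icc (0 : ℝ) 1, max 0 (min 1 x) = x := fun x hx => by
    rw [min_eq_right hx.2, max_eq_right hx.1]
  set g : ℝ → ℝ → ℝ → ℝ := fun x u p => f (max 0 (min 1 x))
    (max (-(R + 1)) (min (R + 1) u)) (max (-(k + 1)) (min (k + 1) p)) with hg
  obtain ⟨L, hL0, hL⟩ := exists_lipschitz_box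
    (G := fun q : ℝ × ℝ × ℝ => f q.1 q.2.1 q.2.2) (hf.of_le one_le_two) (R + 1) (k + 1)
  obtain ⟨M, hM⟩ := (isCompact_Icc.prod
    (isCompact_Icc.prod isCompact_Icc)).exists_bound_of_continuousOn
    (s := Icc (0 : ℝ) 1 ×ˢ (Icc (-(R + 1)) (R + 1) ×ˢ Icc (-(k + 1)) (k + 1)))
    (hf.continuousOn.mono (prod_mono_right (subset_univ _)))
  have hgf : ∀ x ∈ Icc (0 : ℝ) 1, ∀ u p : ℝ, |u| ≤ R + 1 → |p| ≤ k + 1 → g x u p = f x u p := by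
    intro x hx u p hu hp
    simp only [hg, hx01 x hx, clip_eq hu, clip_eq hp]
  have htame : IsTame g L M := by
    refine ⟨?_, fun x u p u' p' => ?_, fun x u p => hM _ (hTbox (x, u, p))⟩
    · have := hf.continuousOn.comp_continuous hTc (fun z => ⟨(hTbox z).1, mem_univ _⟩)
      exact this
    · have h1 := hL _ (hTbox (x, u, p)) _ (hTbox (x, u', p'))
      refine h1.trans (mul_le_mul_of_nonneg_left ?_ hL0)
      simp only [hT, Prod.mk_sub_mk, Prod.norm_mk, norm_eq_abs, sub_self, abs_zero]
      exact max_le (by positivity) (max_le_max (abs_clip_sub_clip_le _ _ _ _)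
        (abs_clip_sub_clip_le _ _ _ _))
  have hclip0 : max (-(k + 1)) (min (k + 1) 0) = (0 : ℝ) := clip_eq (by simpa using hk1)
  have hsign : ∀ x ∈ Icc (0 : ℝ) 1, ∀ u : ℝ, R ≤ |u| → u * g x u 0 < 0 := by
    intro x hx u hu
    simp only [hg, hx01 x hx, hclip0]
    rcases le_abs.1 hu with h | h
    · have h1 : R ≤ max (-(R + 1)) (min (R + 1) u) :=
        le_max_of_le_right (le_min (by linarith) h)
      have h2 := hR x hx _ (h1.trans (le_abs_self _))
      exact mul_neg_of_pos_of_neg (by linarith) (neg_of_mul_neg_right h2 (by linarith))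
    · have h1 : max (-(R + 1)) (min (R + 1) u) ≤ -R :=
        max_le (by linarith) (min_le_of_right_le (by linarith))
      have h2 := hR x hx _ (le_abs.2 (Or.inr (by linarith)))
      exact mul_neg_of_neg_of_pos (by linarith) (pos_of_mul_neg_right h2 (by linarith))
  have hgC : ∀ x ∈ Icc (0 : ℝ) 1, ∀ u : ℝ, |u| ≤ R → ∀ p : ℝ, |g x u p| ≤ C * (1 + p ^ 2) := by
    intro x hx u hu p
    have hC0 : 0 ≤ C := by
      have := (abs_nonneg _).trans (hC 0 (by simp) 0 (by simpa using hRpos.le) 0)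
      simpa using this
    simp only [hg, hx01 x hx, clip_eq (hu.trans (by linarith : R ≤ R + 1))]
    refine (hC x hx u hu _).trans (mul_le_mul_of_nonneg_left ?_ hC0)
    have := abs_clip_sub_clip_le (-(k + 1)) (k + 1) p 0
    rw [hclip0, sub_zero, sub_zero] at this
    have := sq_le_sq.2 this
    linarith
  have hbf : ∀ V Q : ℝ → ℝ, Q 0 = 0 → Q 1 = 0 → IsSol f V Q →
      ∀ x ∈ Icc (0 : ℝ) 1, |V x| < R ∧ |Q x| ≤ k := fun V Q h0 h1 h x hx =>
    ⟨h.abs_lt h0 h1 hR x hx, h.abs_deriv_le h0 (fun x hx => (h.abs_lt h0 h1 hR x hx).le) hC x hx⟩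
  have hbg : ∀ V Q : ℝ → ℝ, Q 0 = 0 → Q 1 = 0 → IsSol g V Q →
      ∀ x ∈ Icc (0 : ℝ) 1, |V x| < R ∧ |Q x| ≤ k := fun V Q h0 h1 h x hx =>
    ⟨h.abs_lt h0 h1 hsign x hx,
      h.abs_deriv_le h0 (fun x hx => (h.abs_lt h0 h1 hsign x hx).le) hgC x hx⟩
  refine ⟨g, L, M, R, htame, fun x hx u hu => ?_, fun V Q h0 h1 => ⟨fun h => ?_, fun h => ?_⟩,
    fun V Q h0 h1 h => ⟨fun x hx => (hbf V Q h0 h1 h x hx).1, ?_⟩⟩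
  · have := hsign x hx u (le_abs.2 (Or.inr (by linarith)))
    exact pos_of_mul_neg_right this (by linarith)
  · refine ⟨h.1, h.2.congr (fun _ _ => rfl) fun x hx => ?_⟩
    obtain ⟨h2, h3⟩ := hbf V Q h0 h1 h x hx
    rw [hgf x hx _ _ (by linarith) (by linarith)]
  · refine ⟨h.1, h.2.congr (fun _ _ => rfl) fun x hx => ?_⟩
    obtain ⟨h2, h3⟩ := hbg V Q h0 h1 h x hx
    rw [hgf x hx _ _ (by linarith) (by linarith)]
  · obtain ⟨D, hD⟩ := hf.exists_linear_bound (R + 1) (k + 1)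
    refine ⟨D, fun x hx u p hu hp => ?_⟩
    obtain ⟨h2, h3⟩ := hbf V Q h0 h1 h x hx
    have h4 : |u| ≤ R + 1 := by
      have := abs_add_le (u - V x) (V x)
      rw [sub_add_cancel] at this
      linarith
    have h5 : |p| ≤ k + 1 := by
      have := abs_add_le (p - Q x) (Q x)
      rw [sub_add_cancel] at this
      linarith
    rw [hgf x hx _ _ h4 h5, hgf x hx _ _ (by linarith) (by linarith)]
    exact hD x hx _ _ _ _ (by linarith) h4 (by linarith) h5

/-- The shooting problem of the Neumann solutions of a dissipative equation. -/
theorem exists_shootingProblem {f : ℝ → ℝ → ℝ → ℝ} (hf : IsC2Nonlinearity f)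
    (hdiss : IsDissipative f) {E : Type*} {V Q : E → ℝ → ℝ} {p q : E → ℤ} {n : ℤ}
    (sol : ∀ v, IsSol f (V v) (Q v)) (left : ∀ v, Q v 0 = 0) (right : ∀ v, Q v 1 = 0)
    (complete : ∀ U P, IsSol f U P → P 0 = 0 → P 1 = 0 → ∃ v, V v 0 = U 0)
    (nondegenerate : ∀ v φ φ₁, IsLinearNeumann (coeffP f (V v) (Q v)) (coeffU f (V v) (Q v)) φ φ₁ →
      ∀ x ∈ Icc (0 : ℝ) 1, φ x = 0)
    (nonneg : ∀ v, 0 ≤ p v) (le : ∀ v, p v ≤ n) (surj : ∀ k, 0 ≤ k → k ≤ n → ∃ v, p v = k)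
    (inj : Function.Injective p) (inj' : Function.Injective q)
    (lt_iff : ∀ v w, p v < p w ↔ V v 0 < V w 0) (lt_iff' : ∀ v w, q v < q w ↔ V v 1 < V w 1) :
    ∃ (g : ℝ → ℝ → ℝ → ℝ) (L M R : ℝ) (θ : E → ℝ → ℝ) (ρ : E → ℕ),
      ShootingProblem g L M R V Q (fun v => coeffP f (V v) (Q v)) (fun v => coeffU f (V v) (Q v))
        θ p q n ρ := by
  obtain ⟨g, L, M, R, hg, hsign, hiff, hlin⟩ := exists_truncation hf hdiss
  have hb := fun v => hf.continuousOn_coeffP (sol v).1.continuousOn (sol v).2.continuousOn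
  have hc := fun v => hf.continuousOn_coeffU (sol v).1.continuousOn (sol v).2.continuousOn
  choose θ hθ using fun v => exists_pruferAngle (hb v) (hc v)
  choose ρ hρ using fun v => exists_nat_of_sin_ne_zero
    ((hθ v).sin_ne_zero (hb v) (hc v) (nondegenerate v)) (hθ v).le
  exact ⟨g, L, M, R, θ, ρ,
    { tame := hg
      sol := fun v => (hiff _ _ (left v) (right v)).1 (sol v)
      left := left
      right := right
      complete := fun U P h h0 h1 => complete U P ((hiff U P h0 h1).2 h) h0 h1
      bound := fun v => (hlin _ _ (left v) (right v) (sol v)).1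
      sign := hsign
      b_cont := hb
      c_cont := hc
      linear := fun v => (hlin _ _ (left v) (right v) (sol v)).2
      angle := hθ
      turns := hρ
      nonneg := nonneg
      le := le
      surj := surj
      inj := inj
      inj' := inj'
      lt_iff := lt_iff
      lt_iff' := lt_iff' }⟩

/-! ### Equilibria and eigenfunctions as solutions of differential equations -/

/-- The extension of a function on `[0,1]` to the real line, by constants. -/
noncomputable def extend (v : unitInterval → ℝ) : ℝ → ℝ := IccExtend (zero_le_one (α := ℝ)) v

/-- The derivative `dx v` as a function on the real line. -/
noncomputable def extendDeriv (v : unitInterval → ℝ) : ℝ → ℝ := derivWithin (extend v) (Icc 0 1)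

theorem extend_coe (v : unitInterval → ℝ) (x : unitInterval) : extend v x = v x :=
  IccExtend_val _ _ _

theorem dx_eq (v : unitInterval → ℝ) (x : unitInterval) : dx v x = extendDeriv v x := rfl

theorem dx_dx_eq (v : unitInterval → ℝ) (x : unitInterval) :
    dx (dx v) x = derivWithin (extendDeriv v) (Icc 0 1) x :=
  derivWithin_congr (fun _ hy => IccExtend_of_mem _ (dx v) hy) (IccExtend_of_mem _ (dx v) x.2)

theorem IsC2Neumann.derivOn {v : unitInterval → ℝ} (h : IsC2Neumann v) :
    DerivOn (extend v) (extendDeriv v) ∧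
      DerivOn (extendDeriv v) (derivWithin (extendDeriv v) (Icc 0 1)) ∧
      extendDeriv v 0 = 0 ∧ extendDeriv v 1 = 0 := by
  obtain ⟨h1, h2, h3⟩ := h
  refine ⟨fun x hx => (h1.differentiableOn two_ne_zero x hx).hasDerivWithinAt, fun x hx => ?_,
    h2, h3⟩
  have h4 : ContDiffOn ℝ 1 (extendDeriv v) (Icc 0 1) :=
    h1.derivWithin (uniqueDiffOn_Icc zero_lt_one) (by norm_num)
  exact (h4.differentiableOn one_ne_zero x hx).hasDerivWithinAt

/-- Pairs `U`, `P = U'` with a continuous second derivative `W` define `C²` functions. -/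
theorem isC2Neumann_of_derivOn {U P W : ℝ → ℝ} (hU : DerivOn U P) (hP : DerivOn P W)
    (hW : ContinuousOn W (Icc 0 1)) (h0 : P 0 = 0) (h1 : P 1 = 0) :
    IsC2Neumann (fun x => U x) ∧ (∀ x : unitInterval, dx (fun x => U x) x = P x) ∧
      ∀ x : unitInterval, dx (dx (fun x => U x)) x = W x := by
  have hext : ∀ x ∈ Icc (0 : ℝ) 1, extend (fun x => U x) x = U x := fun x hx =>
    extend_coe _ ⟨x, hx⟩
  have hd : DerivOn (extend fun x => U x) P := hU.congr hext (fun _ _ => rfl)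
  have hdP : ∀ x ∈ Icc (0 : ℝ) 1, extendDeriv (fun x => U x) x = P x := fun x hx =>
    hd.derivWithin_eq hx
  have hd2 : DerivOn (extendDeriv fun x => U x) W := hP.congr hdP (fun _ _ => rfl)
  have hu := uniqueDiffOn_Icc (zero_lt_one (α := ℝ))
  refine ⟨⟨?_, ?_, ?_⟩, fun x => hdP x x.2, fun x => ?_⟩
  · have h2 : ContDiffOn ℝ 1 (extendDeriv fun x => U x) (Icc 0 1) := by
      refine (contDiffOn_succ_iff_derivWithin (n := 0) hu).2
        ⟨fun x hx => (hd2 x hx).differentiableWithinAt, by simp, ?_⟩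
      exact contDiffOn_zero.2 (hW.congr fun x hx => hd2.derivWithin_eq hx)
    exact (contDiffOn_succ_iff_derivWithin (n := 1) hu).2
      ⟨fun x hx => (hd x hx).differentiableWithinAt, by simp, h2⟩
  · exact (hdP 0 (by simp)).trans h0
  · exact (hdP 1 (by simp)).trans h1
  · rw [dx_dx_eq]
    exact hd2.derivWithin_eq x.2

theorem IsEquilibrium.isSol {f : ℝ → ℝ → ℝ → ℝ} {v : unitInterval → ℝ} (h : IsEquilibrium f v) :
    IsSol f (extend v) (extendDeriv v) := by
  obtain ⟨h1, h2, -, -⟩ := h.1.derivOn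
  refine ⟨h1, h2.congr (fun _ _ => rfl) fun x hx => ?_⟩
  have h3 := h.2 ⟨x, hx⟩
  rw [dx_dx_eq, dx_eq, ← extend_coe v] at h3
  exact (eq_neg_of_add_eq_zero_left h3).symm

theorem IsSol.exists_equilibrium {f : ℝ → ℝ → ℝ → ℝ} (hf : IsC2Nonlinearity f) {U P : ℝ → ℝ}
    (h : IsSol f U P) (h0 : P 0 = 0) (h1 : P 1 = 0) :
    ∃ v : Equilibria f, ∀ x ∈ Icc (0 : ℝ) 1, extend v.1 x = U x := by
  have hc : ContinuousOn (fun x => -f x (U x) (P x)) (Icc 0 1) :=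
    (hf.continuousOn.comp (f := fun x => (x, U x, P x))
      (continuousOn_id.prodMk (h.1.continuousOn.prodMk h.2.continuousOn))
      (fun x hx => mem_strip hx)).neg
  obtain ⟨h2, h3, h4⟩ := isC2Neumann_of_derivOn h.1 h.2 hc h0 h1
  refine ⟨⟨fun x => U x, h2, fun x => ?_⟩, fun x hx => extend_coe _ ⟨x, hx⟩⟩
  rw [h4, h3]
  simp

/-- Eigenfunctions are the nontrivial Neumann solutions of the linear equation with shifted
coefficient. -/
theorem isEigenvalue_iff {f : ℝ → ℝ → ℝ → ℝ} (hf : IsC2Nonlinearity f) {v : unitInterval → ℝ}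
    (hv : IsEquilibrium f v) (lam : ℝ) : IsEigenvalue f v lam ↔
      ∃ φ φ₁, IsLinearNeumann (coeffP f (extend v) (extendDeriv v))
        (fun x => coeffU f (extend v) (extendDeriv v) x - lam) φ φ₁ ∧
        ∃ x ∈ Icc (0 : ℝ) 1, φ x ≠ 0 := by
  obtain ⟨hv1, hv2⟩ := hv.isSol
  have hb := hf.continuousOn_coeffP hv1.continuousOn hv2.continuousOn
  have hc := hf.continuousOn_coeffU hv1.continuousOn hv2.continuousOn
  constructor
  · rintro ⟨φ, hne, hφ, heq⟩
    obtain ⟨h1, h2, h3, h4⟩ := hφ.derivOn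
    refine ⟨extend φ, extendDeriv φ, ⟨h1, h2.congr (fun _ _ => rfl) fun x hx => ?_, h3, h4⟩, ?_⟩
    · have h5 := heq ⟨x, hx⟩
      rw [dx_dx_eq, dx_eq, dx_eq, ← extend_coe φ, ← extend_coe v] at h5
      simp only [coeffP, coeffU]
      linarith
    · obtain ⟨x, hx⟩ := Function.ne_iff.1 hne
      exact ⟨x, x.2, by rwa [extend_coe]⟩
  · rintro ⟨φ, φ₁, ⟨h1, h2, h3, h4⟩, x, hx, hne⟩
    have hcφ := h1.continuousOn
    have hcφ₁ := h2.continuousOn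
    obtain ⟨h5, h6, h7⟩ := isC2Neumann_of_derivOn h1 h2 (by fun_prop) h3 h4
    refine ⟨fun x => φ x, fun h => hne (congrFun h ⟨x, hx⟩), h5, fun x => ?_⟩
    rw [h6, h7, dx_eq v, ← extend_coe v]
    simp only [coeffP, coeffU]
    ring

/-! ### Reflection of the interval -/

theorem one_sub_mem {x : ℝ} (hx : x ∈ Icc (0 : ℝ) 1) : 1 - x ∈ Icc (0 : ℝ) 1 :=
  ⟨by linarith [hx.2], by linarith [hx.1]⟩

/-- The nonlinearity of the equation for `u(1 - x)`. -/
def reflection (f : ℝ → ℝ → ℝ → ℝ) : ℝ → ℝ → ℝ → ℝ := fun x u p => f (1 - x) u (-p)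

theorem IsC2Nonlinearity.reflection {f : ℝ → ℝ → ℝ → ℝ} (hf : IsC2Nonlinearity f) :
    IsC2Nonlinearity (reflection f) :=
  ContDiffOn.comp (f := fun q : ℝ × ℝ × ℝ => (1 - q.1, q.2.1, -q.2.2)) hf
    (ContDiff.contDiffOn (by fun_prop)) (fun q hq => mem_strip (one_sub_mem hq.1))

theorem IsDissipative.reflection {f : ℝ → ℝ → ℝ → ℝ} (hf : IsDissipative f) :
    IsDissipative (reflection f) := by
  obtain ⟨⟨R, hR⟩, hC⟩ := hf
  refine ⟨⟨R, fun x hx u hu => ?_⟩, fun M => ?_⟩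
  · simpa [SturmMeander.reflection] using hR (1 - x) (one_sub_mem hx) u hu
  · obtain ⟨C, hC⟩ := hC M
    exact ⟨C, fun x hx u hu p => by
      simpa [SturmMeander.reflection] using hC (1 - x) (one_sub_mem hx) u hu (-p)⟩

theorem reflection_reflection (f : ℝ → ℝ → ℝ → ℝ) : reflection (reflection f) = f := by
  funext x u p
  simp [reflection]

theorem IsSol.reflect {f : ℝ → ℝ → ℝ → ℝ} {U P : ℝ → ℝ} (h : IsSol f U P) :
    IsSol (reflection f) (fun x => U (1 - x)) (fun x => -P (1 - x)) := by
  refine ⟨h.1.reflect, fun x hx => ((h.2.reflect x hx).neg).congr_deriv ?_⟩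
  simp [reflection]

theorem coeffP_reflection (f : ℝ → ℝ → ℝ → ℝ) (V Q : ℝ → ℝ) :
    coeffP (reflection f) (fun x => V (1 - x)) (fun x => -Q (1 - x))
      = fun x => -coeffP f V Q (1 - x) := by
  funext x
  have := deriv_comp_neg (f := fun p => f (1 - x) (V (1 - x)) p) (-Q (1 - x))
  simpa [coeffP, reflection] using this

theorem coeffU_reflection (f : ℝ → ℝ → ℝ → ℝ) (V Q : ℝ → ℝ) :
    coeffU (reflection f) (fun x => V (1 - x)) (fun x => -Q (1 - x))
      = fun x => coeffU f V Q (1 - x) := by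
  funext x
  simp [coeffU, reflection]

theorem IsLinearNeumann.reflect {b c φ φ₁ : ℝ → ℝ}
    (h : IsLinearNeumann (fun x => -b (1 - x)) (fun x => c (1 - x)) φ φ₁) :
    IsLinearNeumann b c (fun x => φ (1 - x)) (fun x => -φ₁ (1 - x)) := by
  obtain ⟨h1, h2, h3, h4⟩ := h
  refine ⟨h1.reflect, fun x hx => ((h2.reflect x hx).neg).congr_deriv ?_, by simp [h4],
    by simp [h3]⟩
  simp

theorem zeroNumber_reflect (φ : unitInterval → ℝ) :
    zeroNumber (fun x => φ (unitInterval.symm x)) = zeroNumber φ := by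
  have key : ∀ (φ : unitInterval → ℝ) (m : ℕ), HasSignChanges φ m →
      HasSignChanges (fun x => φ (unitInterval.symm x)) m := by
    rintro φ m ⟨x, hx, hs⟩
    refine ⟨fun i => unitInterval.symm (x i.rev), fun i j hij => ?_, fun i => ?_⟩
    · exact unitInterval.strictAnti_symm (hx (Fin.rev_lt_rev.2 hij))
    · have := hs i.rev
      simp only [unitInterval.symm_symm, Fin.rev_castSucc, Fin.rev_succ]
      rwa [mul_comm]
  have : ∀ m, HasSignChanges (fun x => φ (unitInterval.symm x)) m ↔ HasSignChanges φ m :=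
    fun m => ⟨fun h => by simpa using key _ m h, key φ m⟩
  simp only [zeroNumber, this]

/-! ### Zero numbers and Morse numbers of equilibria -/

theorem pos_lt_pos_iff {f : ℝ → ℝ → ℝ → ℝ} {n : ℕ} {h : Fin 2 → (Fin (n + 1) ≃ Equilibria f)}
    (hlabel : IsBoundaryLabeling f h) (ι : Fin 2) (v w : Equilibria f) :
    (pos h ι v : ℤ) < pos h ι w ↔ v.1 (bdryPoint ι) < w.1 (bdryPoint ι) := by
  have := (hlabel ι).lt_iff_lt (a := (h ι).symm v) (b := (h ι).symm w)
  simp only [Equiv.apply_symm_apply] at this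
  rw [this, Fin.lt_def, Nat.cast_lt]
  rfl

/-- Zero numbers and Morse numbers of the equilibria form shooting data, for shooting from the left
boundary as well as from the right boundary. -/
theorem exists_shootingData {f : ℝ → ℝ → ℝ → ℝ} (hf : IsC2Nonlinearity f) (hdiss : IsDissipative f)
    (hhyp : ∀ v : Equilibria f, IsHyperbolic f v.1) {n : ℕ}
    {h : Fin 2 → (Fin (n + 1) ≃ Equilibria f)} (hlabel : IsBoundaryLabeling f h) :
    ∃ (Z : Equilibria f → Equilibria f → ℕ) (ρ : Equilibria f → ℕ),
      ShootingData (fun v => (pos h 0 v : ℤ)) (fun v => (pos h 1 v : ℤ)) n Z (fun v => ρ v) ∧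
      ShootingData (fun v => (pos h 1 v : ℤ)) (fun v => (pos h 0 v : ℤ)) n Z (fun v => ρ v) ∧
      (∀ v, (pos h 0 v : ℤ) = 0 → ρ v = 0) ∧
      (∀ v w, v ≠ w → zeroNumber (v.1 - w.1) = Z v w) ∧
      ∀ v, morseIndex f v.1 ≤ ρ v := by
  set V : Equilibria f → ℝ → ℝ := fun v => extend v.1 with hV
  set Q : Equilibria f → ℝ → ℝ := fun v => extendDeriv v.1 with hQ
  have sol : ∀ v, IsSol f (V v) (Q v) := fun v => v.2.isSol
  have left : ∀ v, Q v 0 = 0 := fun v => v.2.1.derivOn.2.2.1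
  have right : ∀ v, Q v 1 = 0 := fun v => v.2.1.derivOn.2.2.2
  have complete : ∀ U P, IsSol f U P → P 0 = 0 → P 1 = 0 →
      ∃ v, ∀ x ∈ Icc (0 : ℝ) 1, V v x = U x := fun U P h h0 h1 => h.exists_equilibrium hf h0 h1
  have nondeg : ∀ v φ φ₁, IsLinearNeumann (coeffP f (V v) (Q v)) (coeffU f (V v) (Q v)) φ φ₁ →
      ∀ x ∈ Icc (0 : ℝ) 1, φ x = 0 := by
    intro v φ φ₁ hφ x hx
    by_contra hne
    exact hhyp v ((isEigenvalue_iff hf v.2 0).2 ⟨φ, φ₁, by simpa using hφ, x, hx, hne⟩)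
  have hV0 : ∀ v, V v 0 = v.1 (bdryPoint 0) := fun v => extend_coe v.1 0
  have hV1 : ∀ v, V v 1 = v.1 (bdryPoint 1) := fun v => extend_coe v.1 1
  have lt0 : ∀ v w, (pos h 0 v : ℤ) < pos h 0 w ↔ V v 0 < V w 0 := fun v w => by
    rw [hV0, hV0, pos_lt_pos_iff hlabel]
  have lt1 : ∀ v w, (pos h 1 v : ℤ) < pos h 1 w ↔ V v 1 < V w 1 := fun v w => by
    rw [hV1, hV1, pos_lt_pos_iff hlabel]
  obtain ⟨g, L, M, R, θ, ρ, H⟩ := exists_shootingProblem hf hdiss sol left right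
    (fun U P h h0 h1 => (complete U P h h0 h1).imp fun v hv => hv 0 (by simp)) nondeg
    (fun v => Int.natCast_nonneg (pos h 0 v)) (pos_le h 0) (pos_surjective h 0) (pos_injective h 0)
    (pos_injective h 1) lt0 lt1
  obtain ⟨g', L', M', R', θ', ρ', H'⟩ := exists_shootingProblem hf.reflection hdiss.reflection
    (V := fun v x => V v (1 - x)) (Q := fun v x => -Q v (1 - x)) (fun v => (sol v).reflect)
    (fun v => by simp [right]) (fun v => by simp [left])
    (fun U P h h0 h1 => by
      have h2 := h.reflect
      rw [reflection_reflection] at h2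
      obtain ⟨v, hv⟩ := complete _ _ h2 (by simp [h1]) (by simp [h0])
      exact ⟨v, by simpa using hv 1 (by simp)⟩)
    (fun v φ φ₁ hφ x hx => by
      rw [coeffP_reflection, coeffU_reflection] at hφ
      simpa using nondeg v _ _ hφ.reflect (1 - x) (one_sub_mem hx))
    (fun v => Int.natCast_nonneg (pos h 1 v)) (pos_le h 1) (pos_surjective h 1) (pos_injective h 1)
    (pos_injective h 0) (by simpa using lt1) (by simpa using lt0)
  have hρ : ρ' = ρ := by
    funext v
    have h1 := H'.angle v
    simp only [coeffP_reflection, coeffU_reflection] at h1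
    exact (pruferAngle_reflect (H.b_cont v) (H.c_cont v) (H.angle v) h1 (H.turns v)
      (H'.turns v)).symm
  have hZ : ∀ v w : Equilibria f, (fun x : unitInterval => V v x - V w x) = v.1 - w.1 := by
    intro v w
    funext x
    simp [hV, extend_coe]
  have hZ' : ∀ v w : Equilibria f, (zeroNumber fun x : unitInterval => V v (1 - x) - V w (1 - x))
      = zeroNumber (v.1 - w.1) := by
    intro v w
    rw [← hZ, ← zeroNumber_reflect]
    simp
  obtain ⟨h1, h2, h3⟩ := H.shootingData (fun v w => (zeroNumber (v.1 - w.1)).toNat)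
    (fun v w => by rw [hZ])
  obtain ⟨h1', -, -⟩ := H'.shootingData (fun v w => (zeroNumber (v.1 - w.1)).toNat)
    (fun v w => by rw [hZ'])
  rw [hρ] at h1'
  refine ⟨_, ρ, h1, h1', h2, fun v w hvw => by rw [← h3 v w hvw, hZ], fun v => ?_⟩
  exact encard_eigenvalues_le (H.b_cont v) (H.c_cont v) (H.angle v) (H.turns v).1
    (fun lam hlam => ⟨hlam.1, (isEigenvalue_iff hf v.2 lam).1 hlam.2⟩)

end SturmMeander

theorem proposition5p3
    (f : ℝ → ℝ → ℝ → ℝ) (hf : IsC2Nonlinearity f) (hdiss : IsDissipative f)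
    (hhyp : ∀ v : Equilibria f, IsHyperbolic f v.1)
    (n : ℕ) (h : Fin 2 → (Fin (n + 1) ≃ Equilibria f)) (hlabel : IsBoundaryLabeling f h)
    (O : Equilibria f) (htemplate : IsThreeMeanderTemplate h O)
    (j : ℕ) (hj : j ≤ 2) :
    (∀ v ∈ primedUnion h O j, morseIndex f v.1 ≤ (j : ℕ∞)) ∧
    (∀ v ∈ closPrimedUnion h O j, zeroNumber (v.1 - O.1) ≤ (j : ℕ∞)) ∧
    (∀ δ : ℤˣ, ∀ v ∈ primedSet h O δ j, SignedZeroNumberEq (v.1 - O.1) j δ) ∧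
    (∀ δ : ℤˣ, ∀ v₁ ∈ closPrimedSet h O δ j, ∀ v₂ ∈ closPrimedSet h O δ j, v₁ ≠ v₂ →
      zeroNumber (v₁.1 - v₂.1) < (j : ℕ∞)) := by
  obtain ⟨Z, ρ, D, D', h0, hZ, hmorse⟩ := exists_shootingData hf hdiss hhyp hlabel
  have hr := morseNumber_eq D h0
  have T := htemplate.templateData hr D D'
  have hsub := primedSet_subset (O := O) hr
  -- The signed zero numbers with respect to the center, and the Morse numbers.
  have hcenter : ∀ (k : ℕ) (δ : ℤˣ), ∀ v ∈ primedSet h O δ k,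
      SignedZeroNumberEq (v.1 - O.1) k δ ∧ ρ v ≤ k := by
    intro k δ v hv
    rcases Int.units_eq_one_or δ with rfl | rfl
    · obtain ⟨h1, h2, h3, h4⟩ := T.reverse.side_center ((hsub k).2 hv)
      refine ⟨⟨by rw [hZ v O h1, h3], ?_⟩, by lia⟩
      have := (pos_lt_pos_iff hlabel 0 O v).1 (by lia)
      simpa [bdryPoint] using this
    · obtain ⟨h1, h2, h3, h4⟩ := T.side_center ((hsub k).1 hv)
      refine ⟨⟨by rw [hZ v O h1, h3], ?_⟩, by lia⟩
      have := (pos_lt_pos_iff hlabel 0 v O).1 h2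
      simpa [bdryPoint] using this
  refine ⟨?_, ?_, fun δ v hv => (hcenter j δ v hv).1, ?_⟩
  · rintro v ⟨k, hk, δ, hv⟩
    exact (hmorse v).trans (by exact_mod_cast (hcenter k δ v hv).2.trans hk)
  · rintro v ⟨δ, hv | ⟨i, hi, k, hk, δ', hv⟩⟩
    · exact (hcenter j δ v hv).1.1.le
    · rw [(hcenter k δ' v hv).1.1]
      exact_mod_cast (by lia : k ≤ j)
  · intro δ v₁ hv₁ v₂ hv₂ hne
    rw [hZ v₁ v₂ hne]
    have hlow : ∀ v, (∃ i, i + 1 = j ∧ v ∈ primedUnion h O i) → ∃ k < j,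
        v ∈ side (fun v => (pos h 0 v : ℤ)) (fun v => (pos h 1 v : ℤ)) n (fun v => ρ v) O k ∨
        v ∈ side (fun v => (n : ℤ) - pos h 0 v) (fun v => (n : ℤ) - pos h 1 v) n (fun v => ρ v) O
          k := by
      rintro v ⟨i, hi, k, hk, δ', hv⟩
      refine ⟨k, by lia, ?_⟩
      rcases Int.units_eq_one_or δ' with rfl | rfl
      · exact Or.inr ((hsub k).2 hv)
      · exact Or.inl ((hsub k).1 hv)
    rcases Int.units_eq_one_or δ with rfl | rfl
    · have hlt := T.reverse.zero_lt_of_side (v := v₁) (w := v₂) hj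
      simp only [sub_sub_cancel] at hlt
      exact_mod_cast hlt
        (hv₁.imp (fun hv => (hsub j).2 hv)
          fun hv => (hlow v₁ hv).imp fun _ => And.imp_right Or.symm)
        (hv₂.imp (fun hv => (hsub j).2 hv)
          fun hv => (hlow v₂ hv).imp fun _ => And.imp_right Or.symm)
        hne
    · exact_mod_cast T.zero_lt_of_side hj (hv₁.imp (fun hv => (hsub j).1 hv) (hlow v₁))
        (hv₂.imp (fun hv => (hsub j).1 hv) (hlow v₂)) hne
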